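/- Let $\beta$ be a parameter, $x\oplus y=x+y+\beta xy$, $x\ominus y=(x-y)/(1+\beta y)$, $\ominus x=0\ominus x$, and let $R=\mathbb Z[\beta][b_1,b_2,\dots][(1+\beta b_i)^{-1}: i\ge1]$, with $b_{\bar i}=\ominus b_i$. **Weyl groups and strict partitions.** Let $X\in\{B,C,D\}$. Identify $W(B_\infty)=W(C_\infty)$ with the group of signed permutations of $\{1,2,\dots\}$, generated by $s_0=(1\leftrightarrow\bar 1)$ and the transpositions $s_i=(i\leftrightarrow i+1)$, $i\ge1$, and $W(D_\infty)$ with its subgroup generated by $s_{\hat1}=s_0s_1s_0$ and the $s_i$, $i\ge1$; correspondingly $I=\{0,1,2,\dots\}$ or $I=\{\hat1,1,2,\dots\}$. The group acts on $R$ by $w(b_i)=b_{w(i)}$, $w(\beta)=\beta$. To $w$ attach the strict partition whose parts are the $k\geq 1$ with $\bar k\in w(\{1,2,\dots\})$ (types $B$, $C$), respectively these numbers diminished by one, $0$ being dropped (type $D$). This gives a bijection between Grassmannian elements ($w(1)<w(2)<\cdots$ in the order $\cdots<\bar 2<\bar1<1<2<\cdots$) and strict partitions, hence an action of $W(X_\infty)$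 on strict partitions, which are ordered by the Bruhat–Chevalley order of the Grassmannian elements. For a strict partition $\lambda=(\lambda_1>\dots>\lambda_r>0)$ let $\mathbb D(\lambda)=\{(i,j):1\le i\le r,\ i\le j\le\lambda_i+i-1\}$. The content of a box is $c(i,j)=j-i$ in types $B$, $C$; in type $D$, $c(i,j)=j-i+1$ for $i<j$, $c(i,i)=\hat1$ for $i$ odd and $c(i,i)=1$ for $i$ even. $\lambda$ is $i$-removable if some $\alpha\in\mathbb D(\lambda)$ with $c(\alpha)=i$ is such that $\mathbb D(\lambda)\setminus\{\alpha\}$ is the diagram of a strict partition, which is then denoted $\lambda^{(i)}$. **Rings.** $G\Gamma_n$ is the ring of symmetric $f\in\mathbb Z[\beta][x_1,\dots,x_n]$ such that for all $i<j$ the substitution $x_i=t$, $x_j=\ominus t$ in $f$ gives a function independent of $t$; $G\Gamma_{n,+}$ is the subring of those $f$ for which $f(t,x_2,\dots)-f(0,x_2,\dots)$ is divisible by $t\oplus t$. Put $G\Gamma^C_n=G\Gamma_{n,+}$, $G\Gamma^B_n=G\Gamma^D_n=G\Gamma_n$. With transition maps $x_{n+1}=0$, let $G\Gamma^X_R=R\otimes_{\mathbb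 Z[\beta]}\varprojlim_n G\Gamma_n^X$ and let $\widehat{G\Gamma}{}^X_R=\varprojlim_n\,(R\otimes_{\mathbb Z[\beta]}G\Gamma_n^X)$, which contains $G\Gamma_R^X$. **Functions.** Put $[x|b]^k=\prod_{m=1}^k(x\oplus b_m)$, $[[x|b]]^k=(x\oplus x)\prod_{m=1}^{k-1}(x\oplus b_m)$ and, for $n\ge r$, $$GP_\lambda(x_1,\dots,x_n|b)=\frac1{(n-r)!}\sum_{w\in S_n}w\Big[\prod_{i=1}^r[x_i|b]^{\lambda_i}\prod_{i=1}^r\prod_{j=i+1}^n\frac{x_i\oplus x_j}{x_i\ominus x_j}\Big],$$ and $GQ_\lambda(x_1,\dots,x_n|b)$ likewise with $[[x_i|b]]^{\lambda_i}$. Let $GB^{(n)}_\lambda=GP_\lambda(x_1,\dots,x_n|0,b_1,b_2,\dots)$, $GC_\lambda^{(n)}=GQ_\lambda(x_1,\dots,x_n|b)$, and $GD^{(n)}_\lambda=GP_\lambda(x_1,\dots,x_n|b)$ for $n$ even, $GP_\lambda(x_1,\dots,x_n,0|b)$ for $n$ odd. **Operators.** For $i\ge1$, $s_i$ acts on $\widehat{G\Gamma}{}^X_R$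 through its action on the coefficients in $R$; $s_0$ acts on the coefficients and sends $\phi(x_1,x_2,\dots)$ to $\phi(b_1,x_1,x_2,\dots)$; $s_{\hat1}=s_0s_1s_0$. Put $e(\alpha_i)=b_{i+1}\ominus b_i$ for $i\ge1$, $e(\alpha_0)=b_1$ for $B$, $e(\alpha_0)=b_1\oplus b_1$ for $C$, $e(\alpha_{\hat1})=b_1\oplus b_2$ for $D$, and $$\pi_iF=\frac{s_iF-(1+\beta e(\alpha_i))F}{e(\alpha_i)}.$$ **Theorem.** The $\pi_i$ $(i\in I)$ are well-defined operators on $\widehat{G\Gamma}{}_R^X$. For every strict partition $\lambda$ of length $r$ there is an element $GX_\lambda(x|b)=\varprojlim GX_\lambda^{(n)}$ of $G\Gamma_R^X\subset\widehat{G\Gamma}{}_R^X$ whose $n$-variable component is $GX^{(n)}_\lambda$ for all $n\ge r$. For all $i\in I$ and all strict partitions $\lambda$, $$\pi_i\,GX_\lambda(x|b)=\begin{cases}GX_{\lambda^{(i)}}(x|b)&\text{if } s_i\lambda<\lambda,\\ -\beta\,GX_\lambda(x|b)&\text{otherwise},\end{cases}$$ and $s_i\lambda<\lambda$ holds exactly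 when $\lambda$ is $i$-removable. -/

import Mathlib

/-- The three infinite families of types `B_∞`, `C_∞`, `D_∞`. -/
inductive LieType where
  | B
  | C
  | D

/-! ### Formal group operations -/

/-- The ring `ℤ[β]`. -/
abbrev Zbeta : Type := Polynomial ℤ

section FormalGroup

variable {A : Type*} [CommRing A] [Algebra Zbeta A]

/-- The parameter `β`, in any commutative `ℤ[β]`-algebra. -/
noncomputable def betaIn (A : Type*) [CommRing A] [Algebra Zbeta A] : A :=
  algebraMap Zbeta A Polynomial.X

/-- `x ⊕ y = x + y + β x y`. -/
noncomputable def oplus (x y : A) : A := x + y + betaIn A * x * y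

/-- `x ⊖ y = (x - y) / (1 + β y)`; it is only used where `1 + β y` is a unit. -/
noncomputable def ominus (x y : A) : A := (x - y) * Ring.inverse (1 + betaIn A * y)

/-- `[x|b]^k = (x ⊕ b₁) ⋯ (x ⊕ b_k)`; the entry `b_{m+1}` of the sequence is `b m`. -/
noncomputable def factorialPow (x : A) (b : ℕ → A) (k : ℕ) : A :=
  ∏ m ∈ Finset.range k, oplus x (b m)

/-- `[[x|b]]^k = (x ⊕ x)(x ⊕ b₁) ⋯ (x ⊕ b_{k-1})`, for `k ≥ 1`. -/
noncomputable def factorialPow' (x : A) (b : ℕ → A) (k : ℕ) : A :=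
  oplus x x * ∏ m ∈ Finset.range (k - 1), oplus x (b m)

end FormalGroup

/-! ### The coefficient ring and its Weyl group action -/

/-- The multiplicative system generated by all `1 + β b_i` in `ℤ[β][b₁, b₂, …]`
(the variable `b_{m+1}` is `X m`). -/
noncomputable def coeffSubmonoid : Submonoid (MvPolynomial ℕ Zbeta) :=
  Submonoid.closure (Set.range fun m : ℕ =>
    1 + betaIn (MvPolynomial ℕ Zbeta) * MvPolynomial.X m)

/-- The ring `R = ℤ[β][b₁, b₂, …][(1 + β b_i)⁻¹ : i ≥ 1]`. -/
def CoeffRing : Type := Localization coeffSubmonoid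

noncomputable instance : CommRing CoeffRing :=
  inferInstanceAs (CommRing (Localization coeffSubmonoid))

noncomputable instance : Algebra (MvPolynomial ℕ Zbeta) CoeffRing :=
  inferInstanceAs (Algebra (MvPolynomial ℕ Zbeta) (Localization coeffSubmonoid))

instance : IsLocalization coeffSubmonoid CoeffRing :=
  inferInstanceAs (IsLocalization coeffSubmonoid (Localization coeffSubmonoid))

noncomputable instance : Algebra Zbeta CoeffRing :=
  ((algebraMap (MvPolynomial ℕ Zbeta) CoeffRing).comp
    (algebraMap Zbeta (MvPolynomial ℕ Zbeta))).toAlgebra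

theorem coeffSubmonoid_le : coeffSubmonoid ≤ nonZeroDivisors (MvPolynomial ℕ Zbeta) := by
  rw [coeffSubmonoid, Submonoid.closure_le]
  rintro _ ⟨m, rfl⟩
  refine mem_nonZeroDivisors_of_ne_zero fun h => ?_
  have := congrArg (MvPolynomial.eval (fun _ : ℕ => (0 : Zbeta))) h
  simp at this

instance : IsDomain CoeffRing :=
  IsLocalization.isDomain_of_le_nonZeroDivisors (S := CoeffRing) (M := coeffSubmonoid)
    coeffSubmonoid_le

/-- The element `b_k` of `R` for an integer index `k`: `bInt i = b_i` and
`bInt (-i) = b_{\bar i} = ⊖ b_i` for `i ≥ 1` (and `bInt 0 = 0`, which is never used). -/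
noncomputable def bInt : ℤ → CoeffRing
  | Int.ofNat 0 => 0
  | Int.ofNat (m + 1) => algebraMap (MvPolynomial ℕ Zbeta) CoeffRing (MvPolynomial.X m)
  | Int.negSucc m =>
      ominus 0 (algebraMap (MvPolynomial ℕ Zbeta) CoeffRing (MvPolynomial.X m))

theorem isUnit_one_add_gen (m : ℕ) :
    IsUnit (1 + betaIn CoeffRing *
      algebraMap (MvPolynomial ℕ Zbeta) CoeffRing (MvPolynomial.X m)) := by
  have h := IsLocalization.map_units CoeffRing
    (⟨_, Submonoid.subset_closure ⟨m, rfl⟩⟩ : coeffSubmonoid)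
  simpa [betaIn, RingHom.algebraMap_toAlgebra] using h

theorem isUnit_one_add_bInt (k : ℤ) : IsUnit (1 + betaIn CoeffRing * bInt k) := by
  match k with
  | Int.ofNat 0 => simp [bInt]
  | Int.ofNat (m + 1) => exact isUnit_one_add_gen m
  | Int.negSucc m =>
    have h := isUnit_one_add_gen m
    refine IsUnit.of_mul_eq_one (1 + betaIn CoeffRing *
      algebraMap (MvPolynomial ℕ Zbeta) CoeffRing (MvPolynomial.X m)) ?_
    have h2 := Ring.inverse_mul_cancel _ h
    simp only [bInt, ominus]
    linear_combination (-(betaIn CoeffRing *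
      algebraMap (MvPolynomial ℕ Zbeta) CoeffRing (MvPolynomial.X m))) * h2

/-- The action of a signed permutation `w` on `R`: the ring homomorphism that fixes `β` and
sends `b_i` to `b_{w(i)}`. -/
noncomputable def weylCoeff (w : Equiv.Perm ℤ) : CoeffRing →+* CoeffRing :=
  IsLocalization.lift (M := coeffSubmonoid)
    (g := MvPolynomial.eval₂Hom (algebraMap Zbeta CoeffRing)
      (fun m : ℕ => bInt (w ((m : ℤ) + 1)))) <| by
    rintro ⟨y, hy⟩
    refine Submonoid.closure_induction (motive := fun y _ => IsUnit (MvPolynomial.eval₂Hom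
      (algebraMap Zbeta CoeffRing) (fun m : ℕ => bInt (w ((m : ℤ) + 1))) y)) ?_ ?_ ?_ hy
    · rintro _ ⟨m, rfl⟩
      have := isUnit_one_add_bInt (w ((m : ℤ) + 1))
      simpa [betaIn, MvPolynomial.algebraMap_eq] using this
    · simp
    · intro x y _ _ hx hy
      rw [map_mul]
      exact hx.mul hy

/-! ### Weyl groups as groups of signed permutations

A signed permutation is a permutation of `ℤ`, the integer `-i` being the barred index `\bar i`.
The simple reflections are indexed by `ℕ`; in type `D` the index `0` stands for `\hat 1`. -/

/-- The simple reflections `s_i` of types `B` and `C`. -/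
def signedGen : ℕ → Equiv.Perm ℤ
  | 0 => Equiv.swap 1 (-1)
  | i + 1 => Equiv.swap ((i : ℤ) + 1) (i + 2) * Equiv.swap (-((i : ℤ) + 1)) (-(i + 2))

/-- The simple reflections of type `X`; in type `D`, `s_{\hat 1} = s₀ s₁ s₀`. -/
def simpleRefl : LieType → ℕ → Equiv.Perm ℤ
  | LieType.D, 0 => signedGen 0 * signedGen 1 * signedGen 0
  | _, i => signedGen i

/-- The Weyl group `W(X_∞)`. -/
def weylGroup (X : LieType) : Subgroup (Equiv.Perm ℤ) :=
  Subgroup.closure (Set.range (simpleRefl X))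

/-- The length: the least number of simple reflections in an expression of `w`. -/
noncomputable def weylLength (X : LieType) (w : Equiv.Perm ℤ) : ℕ :=
  sInf {k | ∃ l : List ℕ, l.length = k ∧ (l.map (simpleRefl X)).prod = w}

/-- The reflections: the conjugates of the simple reflections. -/
def IsWeylReflection (X : LieType) (t : Equiv.Perm ℤ) : Prop :=
  ∃ w ∈ weylGroup X, ∃ i, t = w * simpleRefl X i * w⁻¹

/-- The Bruhat-Chevalley order `u ≤ v`. -/
def bruhatLE (X : LieType) (u v : Equiv.Perm ℤ) : Prop :=
  Relation.ReflTransGen (fun u v => weylLength X u < weylLength X v ∧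
    ∃ t, IsWeylReflection X t ∧ v = t * u) u v

/-- The Grassmannian elements: `w(1) < w(2) < ⋯`. -/
def IsGrassmannian (X : LieType) (w : Equiv.Perm ℤ) : Prop :=
  w ∈ weylGroup X ∧ StrictMonoOn w (Set.Ioi 0)

/-! ### Strict partitions -/

/-- A strict partition: a strictly decreasing finite sequence of positive integers. -/
structure StrictPartition where
  parts : List ℕ
  decreasing : parts.Pairwise (· > ·)
  pos : ∀ p ∈ parts, 0 < p

instance : Nonempty StrictPartition := ⟨⟨[], List.Pairwise.nil, by simp⟩⟩

namespace StrictPartition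

/-- The length `r` of `λ = (λ₁, …, λ_r)`. -/
def length (l : StrictPartition) : ℕ := l.parts.length

/-- `l.part i = λ_{i+1}`, which is `0` for `i ≥ r`. -/
def part (l : StrictPartition) (i : ℕ) : ℕ := l.parts.getD i 0

/-- The shifted diagram `{(i,j) : 1 ≤ i ≤ r, i ≤ j ≤ λ_i + i - 1}`. -/
def diagram (l : StrictPartition) : Set (ℕ × ℕ) :=
  {a | 1 ≤ a.1 ∧ a.1 ≤ l.length ∧ a.1 ≤ a.2 ∧ a.2 + 1 ≤ l.part (a.1 - 1) + a.1}

end StrictPartition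

/-- The strict partition attached to `w ∈ W(X_∞)`. In types `B`, `C` its parts are the `k ≥ 1` with
`\bar k ∈ w({1, 2, …})`; in type `D` these numbers are diminished by one and `0` is dropped. -/
noncomputable def partitionOf (X : LieType) (w : Equiv.Perm ℤ) : StrictPartition :=
  Classical.epsilon fun l => ∀ k : ℕ, k ∈ l.parts ↔ 0 < k ∧ ∃ m : ℤ, 0 < m ∧
    w m = match X with
      | LieType.D => -((k : ℤ) + 1)
      | _ => -(k : ℤ)

/-- The Grassmannian element `w_λ` with strict partition `λ`. -/
noncomputable def grassmannianOf (X : LieType) (l : StrictPartition) : Equiv.Perm ℤ :=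
  Classical.epsilon fun w => IsGrassmannian X w ∧ partitionOf X w = l

/-- The action `s_i λ` on strict partitions, through the bijection with `W(X_∞) / S_∞`. -/
noncomputable def reflPartition (X : LieType) (i : ℕ) (l : StrictPartition) : StrictPartition :=
  partitionOf X (simpleRefl X i * grassmannianOf X l)

/-- The strict order on strict partitions induced by the Bruhat-Chevalley order of type `X`
on Grassmannian elements. -/
def partitionLT (X : LieType) (l m : StrictPartition) : Prop :=
  bruhatLE X (grassmannianOf X l) (grassmannianOf X m) ∧ l ≠ m

/-- The content of a box, as the index of a simple reflection. In type `D` the diagonal boxes have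
content `\hat 1` (index `0`) in odd rows and `1` in even rows. -/
def content : LieType → ℕ × ℕ → ℕ
  | LieType.D, a => if a.1 = a.2 then (if Odd a.1 then 0 else 1) else a.2 - a.1 + 1
  | _, a => a.2 - a.1

/-- `λ` is `i`-removable and `μ = λ^{(i)}`. -/
def IsRemoved (X : LieType) (i : ℕ) (l m : StrictPartition) : Prop :=
  ∃ a ∈ l.diagram, content X a = i ∧ m.diagram = l.diagram \ {a}

/-! ### The `K`-theoretic `Q`-cancellation property -/

/-- Membership of `f` in `GΓ_n`: `f` is symmetric, and substituting `x_i = t`, `x_j = ⊖ t`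
(`i < j`) gives a rational function that does not depend on `t`. -/
def IsGGamma (n : ℕ) (f : MvPolynomial (Fin n) Zbeta) : Prop :=
  f.IsSymmetric ∧ ∀ i j : Fin n, i < j →
    let K := FractionRing (Polynomial (MvPolynomial (Fin n) Zbeta))
    let t : K := algebraMap (Polynomial (MvPolynomial (Fin n) Zbeta)) K Polynomial.X
    ∃ h : MvPolynomial (Fin n) Zbeta,
      MvPolynomial.aeval (fun k : Fin n =>
        if k = i then t else if k = j then ominus 0 t
        else algebraMap (Polynomial (MvPolynomial (Fin n) Zbeta)) K
          (Polynomial.C (MvPolynomial.X k))) f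
      = algebraMap (Polynomial (MvPolynomial (Fin n) Zbeta)) K (Polynomial.C h)

/-- Membership of `f` in `GΓ_{n,+}`: moreover `f(t, x₂, …) - f(0, x₂, …)` is divisible
by `t ⊕ t` (for `n = 0` there is no further condition). -/
def IsGGammaPlus (n : ℕ) (f : MvPolynomial (Fin n) Zbeta) : Prop :=
  IsGGamma n f ∧ ∀ i : Fin n, i.val = 0 →
    oplus (MvPolynomial.X i) (MvPolynomial.X i) ∣
      f - MvPolynomial.aeval (fun k : Fin n => if k = i then 0 else MvPolynomial.X k) f

/-- The ring at level `n` for type `X`: `GΓ_{n,+}` for type `C`, `GΓ_n` for types `B`, `D`. -/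
def IsGGammaOfType : LieType → (n : ℕ) → MvPolynomial (Fin n) Zbeta → Prop
  | LieType.C, n, f => IsGGammaPlus n f
  | _, n, f => IsGGamma n f

/-- The specialization `x_{n+1} = 0`. -/
noncomputable def setLastZero (A : Type*) [CommRing A] (n : ℕ) :
    MvPolynomial (Fin (n + 1)) A →ₐ[A] MvPolynomial (Fin n) A :=
  MvPolynomial.aeval (Fin.lastCases (motive := fun _ => MvPolynomial (Fin n) A)
    0 MvPolynomial.X)

/-- The substitution `f(x₁, …, x_{n+1}) ↦ f(a, x₁, …, x_n)`. -/
noncomputable def setFirst {A : Type*} [CommRing A] (n : ℕ) (a : A) :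
    MvPolynomial (Fin (n + 1)) A →ₐ[A] MvPolynomial (Fin n) A :=
  MvPolynomial.aeval (Fin.cases (motive := fun _ => MvPolynomial (Fin n) A)
    (MvPolynomial.C a) MvPolynomial.X)

/-- Sequences `(F_n(x₁, …, x_n))_{n ≥ 0}` of polynomials over `R`. -/
abbrev Family : Type := (n : ℕ) → MvPolynomial (Fin n) CoeffRing

/-- `GΓ_R^X = R ⊗_{ℤ[β]} lim GΓ_n` (with `GΓ_{n,+}` for type `C`), realized inside the
sequences of polynomials over `R` as the finite `R`-linear combinations of the elements
of the inverse limit. -/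
noncomputable def GGammaR (X : LieType) : Submodule CoeffRing Family :=
  Submodule.span CoeffRing
    {F | ∃ φ : (n : ℕ) → MvPolynomial (Fin n) Zbeta,
      (∀ n, IsGGammaOfType X n (φ n) ∧ setLastZero Zbeta n (φ (n + 1)) = φ n) ∧
      ∀ n, F n = MvPolynomial.map (algebraMap Zbeta CoeffRing) (φ n)}

/-- The completed ring `lim (R ⊗_{ℤ[β]} GΓ_n)` (with `GΓ_{n,+}` for type `C`), where
`R ⊗ GΓ_n` is realized as the `R`-span of `GΓ_n` in `R[x₁, …, x_n]`. -/
noncomputable def GGammaRHat (X : LieType) : Submodule CoeffRing Family where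
  carrier := {F | ∀ n, setLastZero CoeffRing n (F (n + 1)) = F n ∧
    F n ∈ Submodule.span CoeffRing
      {f | ∃ φ : MvPolynomial (Fin n) Zbeta, IsGGammaOfType X n φ ∧
        f = MvPolynomial.map (algebraMap Zbeta CoeffRing) φ}}
  add_mem' := fun {F G} hF hG n => by
    refine ⟨?_, Submodule.add_mem _ (hF n).2 (hG n).2⟩
    rw [Pi.add_apply, Pi.add_apply, map_add, (hF n).1, (hG n).1]
  zero_mem' := fun n => ⟨by simp, Submodule.zero_mem _⟩
  smul_mem' := fun c F hF n => by
    refine ⟨?_, Submodule.smul_mem _ c (hF n).2⟩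
    rw [Pi.smul_apply, Pi.smul_apply, map_smul, (hF n).1]

/-! ### The functions `GP`, `GQ` and `GX` -/

/-- The field of rational functions in `x₁, …, x_n` over `R`. -/
abbrev RatField (n : ℕ) : Type := FractionRing (MvPolynomial (Fin n) CoeffRing)

/-- The variable `x_{i+1}` as a rational function. -/
noncomputable def ratX {n : ℕ} (i : Fin n) : RatField n :=
  algebraMap (MvPolynomial (Fin n) CoeffRing) (RatField n) (MvPolynomial.X i)

/-- The parameters `b₁, b₂, …` as rational functions (`ratB n m = b_{m+1}`). -/
noncomputable def ratB (n m : ℕ) : RatField n :=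
  algebraMap (MvPolynomial (Fin n) CoeffRing) (RatField n)
    (MvPolynomial.C (bInt ((m : ℤ) + 1)))

/-- The shifted parameter sequence `(0, b₁, b₂, …)`. -/
noncomputable def ratBShift (n : ℕ) : ℕ → RatField n
  | 0 => 0
  | m + 1 => ratB n m

/-- `(1/(n-r)!) ∑_{w ∈ S_n} w[∏_{i ≤ r} p(x_i, λ_i) ∏_{i ≤ r} ∏_{i < j ≤ n} (x_i ⊕ x_j)/(x_i ⊖ x_j)]`,
for `r ≤ n`, where `p(x, k)` is one of the deformed powers of `x`. -/
noncomputable def symmetrization (n : ℕ) (l : StrictPartition)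
    (p : RatField n → ℕ → RatField n) : RatField n :=
  ((Nat.factorial (n - l.length) : ℕ) : RatField n)⁻¹ *
    ∑ w : Equiv.Perm (Fin n), ∏ i : Fin n with i.val < l.length,
      (p (ratX (w i)) (l.part i) *
        ∏ j : Fin n with i < j,
          oplus (ratX (w i)) (ratX (w j)) / ominus (ratX (w i)) (ratX (w j)))

/-- `GP_λ(x₁, …, x_n | b)` for a parameter sequence `b`, as a rational function. -/
noncomputable def ratGP (n : ℕ) (l : StrictPartition) (b : ℕ → RatField n) : RatField n :=
  symmetrization n l fun x k => factorialPow x b k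

/-- `GQ_λ(x₁, …, x_n | b)` for a parameter sequence `b`, as a rational function. -/
noncomputable def ratGQ (n : ℕ) (l : StrictPartition) (b : ℕ → RatField n) : RatField n :=
  symmetrization n l fun x k => factorialPow' x b k

/-- The polynomial `P` equals the rational function `f`. -/
def RepresentsRat {n : ℕ} (P : MvPolynomial (Fin n) CoeffRing) (f : RatField n) : Prop :=
  algebraMap (MvPolynomial (Fin n) CoeffRing) (RatField n) P = f

/-- The polynomial `P` equals `GX_λ^{(n)}(x|b)` (for `n` at least the length of `λ`). -/
def IsGXLevel : LieType → (n : ℕ) → StrictPartition → MvPolynomial (Fin n) CoeffRing → Prop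
  | LieType.B, n, l, P => RepresentsRat P (ratGP n l (ratBShift n))
  | LieType.C, n, l, P => RepresentsRat P (ratGQ n l (ratB n))
  | LieType.D, n, l, P =>
      (Even n → RepresentsRat P (ratGP n l (ratB n))) ∧
      (Odd n → ∃ Q, RepresentsRat Q (ratGP (n + 1) l (ratB (n + 1))) ∧
        P = setLastZero CoeffRing n Q)

/-- `F` is the limit of the `GX_λ^{(n)}(x|b)`: an element of `GΓ_R^X` whose `n`-th component
is `GX_λ^{(n)}(x|b)` for all `n` at least the length of `λ`. -/
def IsGXLimit (X : LieType) (l : StrictPartition) (F : Family) : Prop :=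
  F ∈ GGammaR X ∧ ∀ n, l.length ≤ n → IsGXLevel X n l (F n)

/-- `GX_λ(x|b)`, the limit of the `GX_λ^{(n)}(x|b)`. -/
noncomputable def GX (X : LieType) (l : StrictPartition) : Family :=
  Classical.epsilon (IsGXLimit X l)

/-! ### Weyl group action and divided difference operators -/

/-- The action of `s_i` (types `B`, `C`): for `i ≥ 1` it acts on the coefficients only, and
`s₀` acts on the coefficients and sends `φ(x₁, x₂, …)` to `φ(b₁, x₁, x₂, …)`. -/
noncomputable def signedGenAct : ℕ → Family → Family
  | 0, F => fun n =>
      setFirst n (bInt 1) (MvPolynomial.map (weylCoeff (signedGen 0)) (F (n + 1)))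
  | i + 1, F => fun n => MvPolynomial.map (weylCoeff (signedGen (i + 1))) (F n)

/-- The action of `s_i` for type `X`; in type `D`, `s_{\hat 1} = s₀ s₁ s₀`. -/
noncomputable def simpleReflAct : LieType → ℕ → Family → Family
  | LieType.D, 0, F => signedGenAct 0 (signedGenAct 1 (signedGenAct 0 F))
  | _, i, F => signedGenAct i F

/-- The element `e(α_i)` of `R` for the simple root `α_i`. -/
noncomputable def eRoot : LieType → ℕ → CoeffRing
  | LieType.B, 0 => bInt 1
  | LieType.C, 0 => oplus (bInt 1) (bInt 1)
  | LieType.D, 0 => oplus (bInt 1) (bInt 2)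
  | _, i + 1 => ominus (bInt ((i : ℤ) + 2)) (bInt ((i : ℤ) + 1))

/-- `G = (s_i F - (1 + β e(α_i)) F) / e(α_i)`, with the division cleared. -/
def IsDividedDifference (X : LieType) (i : ℕ) (F G : Family) : Prop :=
  eRoot X i • G = simpleReflAct X i F - (1 + betaIn CoeffRing * eRoot X i) • F

/-- The divided difference operator `π_i F = (s_i F - (1 + β e(α_i)) F) / e(α_i)`. -/
noncomputable def dividedDiff (X : LieType) (i : ℕ) (F : Family) : Family :=
  Classical.epsilon fun G => G ∈ GGammaRHat X ∧ IsDividedDifference X i F G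

/-! The normalized symmetrization behind GP and GQ is an iterated sum, `rowSum`: the first row is
put on a variable x_k with weight ∏ (x_k ⊕ x_j)/(x_k ⊖ x_j) over the other variables, x_k is
discarded, and the next row follows (`sum_perm_prod_eq_rowSum`). In this form the rows may be
arbitrary functions, the sum is linear in each row, and three facts carry the proof. Variables on
which the rows vanish, or whose ratios cancel, can be dropped once their ratios are multiplied into
the rows (`rowSum_union`). Two consecutive rows matter only through their symmetrized product
(`rowSum_pair`). A last row of degree at most two has a closed form (`rowSum_singleton`), by
Lagrange interpolation in u = 1 + βx.

Existence of GX_λ: the denominators disappear because ∑ G(y_k)/∏ (y_k - y_j) is a coefficient of the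
remainder of G modulo ∏ (X - y_k) (`exists_rowSum_eq_eval₂_coeff`). A pair t, ⊖t drops out of a row
sum, which is the cancellation property; it also gives stability in steps of two variables, all that
holds in type D. Expanding the rows into monomials puts GX_λ into the R-span of the limit over ℤ[β]
(`exists_rowFamily`).

The operators: each component of F is an R-combination of elements of GΓ_n^X. The reflection s_i
changes a coefficient by a multiple of e(α_i), and substituting b_1, or b_1 and b_2, changes an
element of GΓ_n^X from its value at 0 by a multiple of e(α_i). This is clear in type B, is the extra
divisibility in type C, and in type D follows from f(b_1, ⊖b_1, …) = f(0, 0, …). A twisted Leibniz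
rule combines the two (`exists_smul_eq_of_generators`), and the quotient is unique since R is a
domain.

The formula is checked at generic points of fields (`eq_of_generic`). For i ≥ 1, s_i exchanges b_i
and b_{i+1}, so it affects only the row containing the first and not the second. Since x ⊕ b_{i+1} =
e ⊕ (x ⊕ b_i), that row becomes (1 + βe) times itself plus e times the row shortened by one; if the
shortened row is also present, the symmetrized product of the two does not see the parameter. For i
= 0 and \hat 1, the twisted rows of length at least two contain x ⊖ b_1 (and x ⊖ b_2) and absorb the
new variables; a row of length one comes last and is summed in closed form. In type D the closed
form depends on the parity of the number of variables left over, and this is how the parity of the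
row of a diagonal box enters.

The order: a Grassmannian element is determined by the set N of its barred values. Left
multiplication by s_i makes an elementary move on N, changing a weight by at most one, so the length
is the weight (`weylLength_eq`). Hence s_iλ < λ exactly when the move lowers N
(`partitionLT_iff_isLowerable`), which translates into the removal of a box of content i. -/

/-! ### Iterated row sums and the closed form of a single row. -/

section RowSum

open Polynomial

variable {K : Type*} [Field K] {ι : Type*} [DecidableEq ι]

/-- The factor `(a ⊕ b) / (a ⊖ b)`, with the inner denominator cleared. -/
def rowRatio (β a b : K) : K := (a + b + β * a * b) * (1 + β * b) / (a - b)

/-- Iterated row sum: the first row is placed at each variable `y k` in turn, weighted by the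
factors `rowRatio` against all remaining variables; `T` is evaluated at what is left over. -/
def rowSum (β : K) (y : ι → K) (T : Finset ι → K) : List (K → K) → Finset ι → K
  | [], s => T s
  | p :: ps, s => ∑ k ∈ s, p (y k) * (∏ j ∈ s.erase k, rowRatio β (y k) (y j)) *
      rowSum β y T ps (s.erase k)

variable {β : K} {y : ι → K} {T T' : Finset ι → K}

theorem rowSum_append (ps qs : List (K → K)) (s : Finset ι) :
    rowSum β y T (ps ++ qs) s = rowSum β y (rowSum β y T qs) ps s := by
  induction ps generalizing s with
  | nil => rfl
  | cons p ps ih => simp [rowSum, ih]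

/-- Each row uses up one variable, so only leftover sets of one fixed size occur. In type D this is
how the parity of the number of variables reaches the last row. -/
theorem rowSum_congr_terminal (ps : List (K → K)) (s : Finset ι)
    (h : ∀ t ⊆ s, t.card + ps.length = s.card → T t = T' t) :
    rowSum β y T ps s = rowSum β y T' ps s := by
  induction ps generalizing s with
  | nil => exact h s subset_rfl (by simp)
  | cons p ps ih =>
    refine Finset.sum_congr rfl fun k hk => ?_
    rw [ih]
    intro t ht hc
    refine h t (ht.trans (Finset.erase_subset _ _)) ?_
    have := Finset.card_erase_add_one hk
    simp only [List.length_cons]; omega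

theorem rowSum_congr {y' : ι → K} (ps ps' : List (K → K)) (s : Finset ι)
    (hy : ∀ k ∈ s, y k = y' k)
    (h : List.Forall₂ (fun p q : K → K => ∀ k ∈ s, p (y k) = q (y k)) ps ps') :
    rowSum β y T ps s = rowSum β y' T ps' s := by
  induction ps generalizing s ps' with
  | nil => cases h; rfl
  | cons p ps ih =>
    obtain ⟨p', ps', h1, h2, rfl⟩ := List.forall₂_cons_left_iff.1 h
    rw [rowSum, rowSum]
    refine Finset.sum_congr rfl fun k hk => ?_
    have hm : ∀ j ∈ s.erase k, j ∈ s := fun j hj => Finset.mem_of_mem_erase hj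
    rw [ih ps' (s.erase k) (fun j hj => hy j (hm j hj))
      (h2.imp fun a b hab j hj => hab j (hm j hj)), h1 k hk, hy k hk]
    congr 2
    exact Finset.prod_congr rfl fun j hj => by rw [hy j (hm j hj)]

theorem rowSum_terminal_linear (ps : List (K → K)) (s : Finset ι) (a b : K) :
    rowSum β y (fun t => a * T t + b * T' t) ps s =
      a * rowSum β y T ps s + b * rowSum β y T' ps s := by
  induction ps generalizing s with
  | nil => rfl
  | cons p ps ih =>
    simp only [rowSum, ih, Finset.mul_sum, ← Finset.sum_add_distrib]
    exact Finset.sum_congr rfl fun k _ => by ring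

theorem rowSum_map {κ : Type*} [DecidableEq κ] (e : κ ↪ ι) (ps : List (K → K)) (s : Finset κ) :
    rowSum β y T ps (s.map e) = rowSum β (y ∘ e) (fun t => T (t.map e)) ps s := by
  induction ps generalizing s with
  | nil => rfl
  | cons p ps ih =>
    simp only [rowSum, Finset.sum_map]
    refine Finset.sum_congr rfl fun k _ => ?_
    rw [← Finset.map_erase, ih, Finset.prod_map]
    rfl

/-- Variables on which every row vanishes, or whose factors cancel, may be dropped. -/
theorem rowSum_union (O : Finset ι) (ps ps' : List (K → K)) (s : Finset ι) (hd : Disjoint O s)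
    (h : List.Forall₂ (fun p p' : K → K =>
      (∀ o ∈ O, p' (y o) * ∏ j ∈ O.erase o, rowRatio β (y o) (y j) = 0) ∧
      ∀ k ∈ s, p' (y k) * ∏ j ∈ O, rowRatio β (y k) (y j) = p (y k)) ps ps') :
    rowSum β y T ps' (O ∪ s) = rowSum β y (fun t => T (O ∪ t)) ps s := by
  induction ps generalizing s ps' with
  | nil => cases h; rfl
  | cons p ps ih =>
    obtain ⟨p', ps', ⟨h1, h2⟩, h3, rfl⟩ := List.forall₂_cons_left_iff.1 h
    rw [rowSum, rowSum, Finset.sum_union hd]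
    have hO : ∀ o ∈ O, (O ∪ s).erase o = O.erase o ∪ s := fun o ho => by
      rw [Finset.erase_union_distrib, Finset.erase_eq_of_notMem (s := s)
        (Finset.disjoint_left.1 hd ho)]
    have hs : ∀ k ∈ s, (O ∪ s).erase k = O ∪ s.erase k := fun k hk => by
      rw [Finset.erase_union_distrib, Finset.erase_eq_of_notMem (s := O)
        (Finset.disjoint_right.1 hd hk)]
    rw [Finset.sum_eq_zero, zero_add]
    · refine Finset.sum_congr rfl fun k hk => ?_
      have hd' : Disjoint O (s.erase k) := hd.mono_right (Finset.erase_subset _ _)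
      rw [hs k hk, Finset.prod_union hd', ih _ _ hd', ← h2 k hk]
      · ring
      · exact h3.imp fun a b hab => ⟨hab.1, fun k hk => hab.2 k (Finset.mem_of_mem_erase hk)⟩
    · intro o ho
      rw [hO o ho, Finset.prod_union (hd.mono_left (Finset.erase_subset _ _)), ← mul_assoc,
        h1 o ho, zero_mul, zero_mul]

/-- Two consecutive rows enter only through the symmetrized product. -/
theorem rowSum_pair (p q p' q' : K → K) (ps : List (K → K)) (s : Finset ι)
    (h : ∀ k ∈ s, ∀ l ∈ s, k ≠ l →
      p (y k) * q (y l) * rowRatio β (y k) (y l) + p (y l) * q (y k) * rowRatio β (y l) (y k) =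
      p' (y k) * q' (y l) * rowRatio β (y k) (y l) +
        p' (y l) * q' (y k) * rowRatio β (y l) (y k)) :
    2 * rowSum β y T (p :: q :: ps) s = 2 * rowSum β y T (p' :: q' :: ps) s := by
  -- The sum over ordered pairs (k, l) is added to itself with k and l exchanged: the weights
  -- against the remaining variables are symmetric in k and l, so only the symmetrized product of
  -- the two rows is left.
  have key : ∀ p q : K → K, 2 * rowSum β y T (p :: q :: ps) s =
      ∑ k ∈ s, ∑ l ∈ s.erase k, (p (y k) * q (y l) * rowRatio β (y k) (y l) +
        p (y l) * q (y k) * rowRatio β (y l) (y k)) *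
        ((∏ j ∈ (s.erase k).erase l, rowRatio β (y k) (y j) * rowRatio β (y l) (y j)) *
        rowSum β y T ps ((s.erase k).erase l)) := by
    intro p q
    have e1 : rowSum β y T (p :: q :: ps) s =
      ∑ k ∈ s, ∑ l ∈ s.erase k, (p (y k) * q (y l) * rowRatio β (y k) (y l)) *
        ((∏ j ∈ (s.erase k).erase l, rowRatio β (y k) (y j) * rowRatio β (y l) (y j)) *
        rowSum β y T ps ((s.erase k).erase l)) := by
      simp only [rowSum]
      refine Finset.sum_congr rfl fun k hk => ?_
      rw [Finset.mul_sum]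
      refine Finset.sum_congr rfl fun l hl => ?_
      rw [← Finset.mul_prod_erase _ _ hl, Finset.prod_mul_distrib]
      ring
    have e2 : rowSum β y T (p :: q :: ps) s =
      ∑ k ∈ s, ∑ l ∈ s.erase k, (p (y l) * q (y k) * rowRatio β (y l) (y k)) *
        ((∏ j ∈ (s.erase k).erase l, rowRatio β (y k) (y j) * rowRatio β (y l) (y j)) *
        rowSum β y T ps ((s.erase k).erase l)) := by
      rw [e1, Finset.sum_comm' (t' := s) (s' := fun l => s.erase l)]
      · refine Finset.sum_congr rfl fun k hk => Finset.sum_congr rfl fun l hl => ?_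
        rw [Finset.erase_right_comm]
        simp only [mul_comm (rowRatio β (y l) _)]
      · intro k l
        simp only [Finset.mem_erase]
        tauto
    rw [two_mul]
    nth_rw 1 [e1]
    rw [e2, ← Finset.sum_add_distrib]
    refine Finset.sum_congr rfl fun k _ => ?_
    rw [← Finset.sum_add_distrib]
    exact Finset.sum_congr rfl fun l _ => by ring
  rw [key, key]
  refine Finset.sum_congr rfl fun k hk => Finset.sum_congr rfl fun l hl => ?_
  rw [h k hk l (Finset.mem_of_mem_erase hl) (Finset.ne_of_mem_erase hl).symm]

theorem rowSum_cons_linear (p q r : K → K) (ps : List (K → K)) (s : Finset ι) (a b : K)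
    (h : ∀ k ∈ s, p (y k) = a * q (y k) + b * r (y k)) :
    rowSum β y T (p :: ps) s = a * rowSum β y T (q :: ps) s + b * rowSum β y T (r :: ps) s := by
  simp only [rowSum, Finset.mul_sum, ← Finset.sum_add_distrib]
  exact Finset.sum_congr rfl fun k hk => by rw [h k hk]; ring

/-- Partial fraction identity for the nodes `S ∪ {0, 1, -1}`. -/
theorem sum_prod_mul_sub_one_div [DecidableEq K] [CharZero K] (S : Finset K) (h0 : (0 : K) ∉ S)
    (h1 : (1 : K) ∉ S) (h2 : (-1 : K) ∉ S) (a b c : K) :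
    ∑ k ∈ S, (a + b * k + c * k ^ 2) * ∏ j ∈ S.erase k, (k * j - 1) * j / (k - j) =
      c * (∏ j ∈ S, j) ^ 2 + a -
        (∏ j ∈ S, j) * ((-1) ^ S.card * (a + b + c) + (a - b + c)) / 2 := by
  set U := ∏ j ∈ S, j with hU
  have hU0 : U ≠ 0 := Finset.prod_ne_zero_iff.2 fun j hj h => h0 (h ▸ hj)
  -- The degree of P is at most |S| + 2 and there are |S| + 3 nodes, so the top coefficient U * c is
  -- the Lagrange sum of P. At a node k in S the factor k * k - 1 of P(k) cancels the differences to
  -- 1 and -1, and the difference to 0 turns U into the product over the other j.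
  set P : K[X] := (∏ j ∈ S, (C j * X - 1)) * (C c * X ^ 2 + C b * X + C a) with hP
  have hd1 : (∏ j ∈ S, (C j * X - 1) : K[X]).natDegree ≤ S.card := by
    refine (natDegree_prod_le _ _).trans ?_
    rw [Finset.card_eq_sum_ones]
    refine Finset.sum_le_sum fun j _ => ?_
    compute_degree
  have hd2 : (C c * X ^ 2 + C b * X + C a : K[X]).natDegree ≤ 2 := natDegree_quadratic_le
  have hn1 : (1 : K) ≠ 0 := one_ne_zero
  have hn2 : (-1 : K) ≠ 1 := by
    intro h
    have h3 : (2 : K) = 0 := by linear_combination -h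
    exact two_ne_zero h3
  set N : Finset K := insert 0 (insert 1 (insert (-1) S)) with hN
  have m1 : (-1 : K) ∉ S := h2
  have m2 : (1 : K) ∉ insert (-1) S := by
    simp only [Finset.mem_insert, not_or]; exact ⟨hn2.symm, h1⟩
  have m3 : (0 : K) ∉ insert 1 (insert (-1) S) := by
    simp only [Finset.mem_insert, not_or]
    exact ⟨hn1.symm, fun h => hn1 (by linear_combination h), h0⟩
  have hcard : N.card = S.card + 3 := by
    rw [hN, Finset.card_insert_of_notMem m3, Finset.card_insert_of_notMem m2,
      Finset.card_insert_of_notMem m1]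
  have hcoef : P.coeff (S.card + 2) = U * c := by
    rw [hP, coeff_mul_add_eq_of_natDegree_le hd1 hd2]
    congr 1
    · have := coeff_prod_of_natDegree_le (s := S) (f := fun j => C j * X - 1) 1
        (fun j _ => by compute_degree)
      rw [mul_one] at this
      rw [this, hU]
      exact Finset.prod_congr rfl fun j _ => by simp [coeff_one]
    · simp
  have hlag := Lagrange.coeff_eq_sum (s := N) (v := id) (Function.injective_id.injOn) (P := P) (by
    refine lt_of_le_of_lt degree_le_natDegree ?_
    rw [hcard]
    have : P.natDegree ≤ S.card + 2 := natDegree_mul_le.trans (add_le_add hd1 hd2)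
    exact_mod_cast (by omega : P.natDegree < S.card + 3))
  rw [hcard, show S.card + 3 - 1 = S.card + 2 from rfl, hcoef] at hlag
  have hev : ∀ x : K, P.eval x = (∏ j ∈ S, (j * x - 1)) * (c * x ^ 2 + b * x + a) := by
    intro x
    simp [hP, eval_prod]
  have hpos : ∏ j ∈ S, (1 - j) ≠ 0 :=
    Finset.prod_ne_zero_iff.2 fun j hj h => h1 (by rwa [sub_eq_zero.1 h])
  have hneg : ∏ j ∈ S, (-1 - j) ≠ 0 :=
    Finset.prod_ne_zero_iff.2 fun j hj h => h2 (by rwa [sub_eq_zero.1 h])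
  have e0 : N.erase 0 = insert 1 (insert (-1) S) := Finset.erase_insert m3
  have e1 : N.erase 1 = insert 0 (insert (-1) S) := by
    rw [hN, Finset.insert_comm, Finset.erase_insert]
    simp only [Finset.mem_insert, not_or]
    exact ⟨hn1, hn2.symm, h1⟩
  have e2 : N.erase (-1) = insert 0 (insert 1 S) := by
    rw [hN, Finset.insert_comm 1, Finset.insert_comm 0, Finset.erase_insert]
    simp only [Finset.mem_insert, not_or]
    exact ⟨fun h => hn1 (by linear_combination -h), hn2, h2⟩
  have hsum : ∑ k ∈ S, P.eval k / ∏ j ∈ N.erase k, (k - j) =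
      U⁻¹ * ∑ k ∈ S, (a + b * k + c * k ^ 2) * ∏ j ∈ S.erase k, (k * j - 1) * j / (k - j) := by
    rw [Finset.mul_sum]
    refine Finset.sum_congr rfl fun k hk => ?_
    have k0 : k ≠ 0 := fun h => h0 (h ▸ hk)
    have k1 : k ≠ 1 := fun h => h1 (h ▸ hk)
    have k2 : k ≠ -1 := fun h => h2 (h ▸ hk)
    have ek : N.erase k = insert 0 (insert 1 (insert (-1) (S.erase k))) := by
      rw [hN, Finset.erase_insert_of_ne k0.symm, Finset.erase_insert_of_ne k1.symm,
        Finset.erase_insert_of_ne k2.symm]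
    have hsub : S.erase k ⊆ S := Finset.erase_subset _ _
    have hmono : insert (-1) (S.erase k) ⊆ insert (-1) S := Finset.insert_subset_insert _ hsub
    rw [ek, Finset.prod_insert fun h => m3 (Finset.insert_subset_insert _ hmono h),
      Finset.prod_insert fun h => m2 (hmono h), Finset.prod_insert fun h => m1 (hsub h), hev,
      ← Finset.mul_prod_erase _ _ hk, hU, ← Finset.mul_prod_erase _ _ hk, Finset.prod_div_distrib,
      Finset.prod_mul_distrib]
    have hd : ∏ j ∈ S.erase k, (k - j) ≠ 0 :=
      Finset.prod_ne_zero_iff.2 fun j hj h => (Finset.ne_of_mem_erase hj) (sub_eq_zero.1 h).symm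
    have hp : ∏ j ∈ S.erase k, j ≠ 0 :=
      Finset.prod_ne_zero_iff.2 fun j hj h => h0 (h ▸ hsub hj)
    have k1' : k - 1 ≠ 0 := sub_ne_zero.2 k1
    have k2' : k - -1 ≠ 0 := sub_ne_zero.2 k2
    have k3' : k + 1 ≠ 0 := by rwa [sub_neg_eq_add] at k2'
    simp only [mul_comm _ k, sub_zero, sub_neg_eq_add]
    field_simp
    ring
  have f0 : P.eval 0 / ∏ j ∈ N.erase 0, (0 - j) = - (a / U) := by
    have : ∏ j ∈ S, (0 - j) = (-1) ^ S.card * U := by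
      rw [hU, ← Finset.prod_const, ← Finset.prod_mul_distrib]
      exact Finset.prod_congr rfl fun j _ => by ring
    rw [e0, Finset.prod_insert m2, Finset.prod_insert m1, this, hev]
    have h1 : ((-1 : K)) ^ S.card ≠ 0 := pow_ne_zero _ (by simp)
    simp only [mul_zero, zero_sub, Finset.prod_const]
    field_simp
    ring
  have f1 : P.eval 1 / ∏ j ∈ N.erase 1, (1 - j) = (-1) ^ S.card * (a + b + c) / 2 := by
    have : ∏ j ∈ S, (j * 1 - 1) = (-1) ^ S.card * ∏ j ∈ S, (1 - j) := by
      rw [← Finset.prod_const, ← Finset.prod_mul_distrib]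
      exact Finset.prod_congr rfl fun j _ => by ring
    rw [e1, Finset.prod_insert (by
      simp only [Finset.mem_insert, not_or]
      exact ⟨fun h => hn1 (by linear_combination h), h0⟩), Finset.prod_insert m1, hev, this]
    field_simp
    ring
  have f2 : P.eval (-1) / ∏ j ∈ N.erase (-1), (-1 - j) = (a - b + c) / 2 := by
    have : ∏ j ∈ S, (j * (-1) - 1) = ∏ j ∈ S, (-1 - j) :=
      Finset.prod_congr rfl fun j _ => by ring
    rw [e2, Finset.prod_insert (by
      simp only [Finset.mem_insert, not_or]
      exact ⟨hn1.symm, h0⟩), Finset.prod_insert h1, hev, this]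
    field_simp
    ring
  rw [hN, Finset.sum_insert m3, Finset.sum_insert m2, Finset.sum_insert m1, ← hN] at hlag
  simp only [id] at hlag
  rw [hsum, f0, f1, f2] at hlag
  field_simp at hlag ⊢
  linear_combination -hlag

/-- A single row `a + b u + c u²` with `u = 1 + β x`. -/
theorem rowSum_singleton [CharZero K] (s : Finset ι) (hβ : β ≠ 0) (hinj : Set.InjOn y s)
    (h0 : ∀ k ∈ s, 1 + β * y k ≠ 0) (h1 : ∀ k ∈ s, y k ≠ 0) (h2 : ∀ k ∈ s, 2 + β * y k ≠ 0)
    (p : K → K) (a b c : K)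
    (hp : ∀ k ∈ s, p (y k) = a + b * (1 + β * y k) + c * (1 + β * y k) ^ 2) :
    rowSum β y (fun _ => 1) [p] s = c * (∏ j ∈ s, (1 + β * y j)) ^ 2 + a -
        (∏ j ∈ s, (1 + β * y j)) * ((-1) ^ s.card * (a + b + c) + (a - b + c)) / 2 := by
  classical
  -- In these coordinates β(y_k ⊕ y_j) = u_k u_j - 1 and β(y_k - y_j) = u_k - u_j, so `rowRatio` is
  -- (u_k u_j - 1) u_j / (u_k - u_j). The hypotheses say that no u_k is 0, 1 or -1.
  set u : ι → K := fun k => 1 + β * y k with hu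
  have hui : Set.InjOn u s := fun i hi j hj h => hinj hi hj (by
    have : β * (y i - y j) = 0 := by simp only [hu] at h; linear_combination h
    exact sub_eq_zero.1 ((mul_eq_zero.1 this).resolve_left hβ))
  have := sum_prod_mul_sub_one_div (s.image u)
    (by simp only [Finset.mem_image, not_exists, not_and]; exact h0)
    (by
      simp only [Finset.mem_image, not_exists, not_and]
      intro k hk h
      have : β * y k = 0 := by simp only [hu] at h; linear_combination h
      exact h1 k hk ((mul_eq_zero.1 this).resolve_left hβ))
    (by
      simp only [Finset.mem_image, not_exists, not_and]
      intro k hk h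
      exact h2 k hk (by simp only [hu] at h; linear_combination h)) a b c
  rw [Finset.prod_image hui, Finset.card_image_of_injOn hui, Finset.sum_image hui] at this
  rw [← this]
  refine Finset.sum_congr rfl fun k hk => ?_
  rw [hp k hk, rowSum, mul_one]
  congr 1
  rw [show (s.image u).erase (u k) = (s.erase k).image u by
    ext x
    simp only [Finset.mem_erase, Finset.mem_image]
    constructor
    · rintro ⟨h, i, hi, rfl⟩
      exact ⟨i, ⟨fun h' => h (h' ▸ rfl), hi⟩, rfl⟩
    · rintro ⟨i, ⟨h, hi⟩, rfl⟩
      exact ⟨fun h' => h (hui hi hk h'), i, hi, rfl⟩,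
    Finset.prod_image (hui.mono (by simp))]
  refine Finset.prod_congr rfl fun j hj => ?_
  have hjk : y k - y j ≠ 0 := fun h => (Finset.ne_of_mem_erase hj)
    (hinj hk (Finset.mem_of_mem_erase hj) (sub_eq_zero.1 h)).symm
  rw [rowRatio, show u k - u j = β * (y k - y j) by simp only [hu]; ring,
    show u k * u j - 1 = β * (y k + y j + β * y k * y j) by simp only [hu]; ring, hu]
  field_simp

end RowSum

/-! ### Row sums of polynomial rows are polynomials. -/

section Polynomiality

open Polynomial

/-- This is ∏ (X - y_j) homogenized and evaluated at (a, -c). It expresses the numerators ∏ (y_k ⊕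
y_j) and ∏ (1 + β y_j) through coefficients of a product of linear factors. The case c = 0 is
separate because the argument evaluates at -a / c. -/
theorem prod_add_mul_eq_sum_coeff {K ι : Type*} [Field K] (y : ι → K) (s : Finset ι) (a c : K) :
    ∏ j ∈ s, (a + c * y j) = ∑ i ∈ Finset.range (s.card + 1),
      (∏ k ∈ s, (X - C (y k))).coeff i * a ^ i * (-c) ^ (s.card - i) := by
  have hdeg : (∏ k ∈ s, (X - C (y k))).natDegree = s.card := natDegree_finsetProd_X_sub_C_eq_card _ _
  have hmon : (∏ k ∈ s, (X - C (y k))).Monic := monic_prod_of_monic _ _ fun k _ => monic_X_sub_C _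
  rcases eq_or_ne c 0 with rfl | hc
  · rw [Finset.sum_range_succ, Finset.sum_eq_zero]
    · have : (∏ k ∈ s, (X - C (y k))).coeff s.card = 1 := by rw [← hdeg]; exact hmon
      rw [this]
      simp
    · intro i hi
      rw [neg_zero, zero_pow (by have := Finset.mem_range.1 hi; omega), mul_zero]
  · have h1 : ∏ j ∈ s, (a + c * y j) = (-c) ^ s.card * (∏ k ∈ s, (X - C (y k))).eval (-a / c) := by
      rw [eval_prod, ← Finset.prod_const, ← Finset.prod_mul_distrib]
      refine Finset.prod_congr rfl fun j _ => ?_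
      simp only [eval_sub, eval_X, eval_C]
      field_simp
      ring
    rw [h1, eval_eq_sum_range, hdeg, Finset.mul_sum]
    refine Finset.sum_congr rfl fun i hi => ?_
    have hi' : i ≤ s.card := Nat.lt_succ_iff.1 (Finset.mem_range.1 hi)
    rw [← Nat.sub_add_cancel hi', pow_add, Nat.add_sub_cancel, neg_div, ← div_neg, div_pow]
    have : (-c) ^ i ≠ 0 := pow_ne_zero _ (neg_ne_zero.2 hc)
    field_simp

/-- G and its remainder agree at the nodes, and the remainder has degree below |s|, so Lagrange
interpolation yields its top coefficient. Division by a monic polynomial needs no denominators: this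
is the source of polynomiality. -/
theorem sum_div_eq_coeff_modByMonic {K ι : Type*} [Field K] [DecidableEq ι] (y : ι → K)
    (s : Finset ι) (hy : Set.InjOn y s) (G : K[X]) :
    ∑ k ∈ s, G.eval (y k) / ∏ j ∈ s.erase k, (y k - y j) =
      (G %ₘ ∏ k ∈ s, (X - C (y k))).coeff (s.card - 1) := by
  have hdeg : (∏ k ∈ s, (X - C (y k))).natDegree = s.card := natDegree_finsetProd_X_sub_C_eq_card _ _
  have hmon : (∏ k ∈ s, (X - C (y k))).Monic := monic_prod_of_monic _ _ fun k _ => monic_X_sub_C _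
  rw [Lagrange.coeff_eq_sum hy]
  · refine Finset.sum_congr rfl fun k hk => ?_
    congr 1
    have h0 : (∏ k ∈ s, (X - C (y k))).eval (y k) = 0 := by
      rw [eval_prod]
      exact Finset.prod_eq_zero hk (by simp)
    conv_lhs => rw [← modByMonic_add_div G (∏ k ∈ s, (X - C (y k)))]
    rw [eval_add, eval_mul, h0, zero_mul, add_zero]
  · refine (degree_modByMonic_lt G hmon).trans_le ?_
    rw [degree_eq_natDegree hmon.ne_zero, hdeg]

/-- Synthetic division by X - y_k. In the induction it makes the contribution of the variables other
than y_k a polynomial in y_k and the coefficients of the full product. -/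
theorem coeff_prod_erase {K ι : Type*} [Field K] [DecidableEq ι] (y : ι → K)
    (s : Finset ι) {k : ι} (hk : k ∈ s) (j : ℕ) :
    (∏ l ∈ s.erase k, (X - C (y l))).coeff j = ∑ i ∈ Finset.Icc (j + 1) s.card,
      y k ^ (i - (j + 1)) * (∏ l ∈ s, (X - C (y l))).coeff i := by
  have hdeg : (∏ k ∈ s, (X - C (y k))).natDegree = s.card := natDegree_finsetProd_X_sub_C_eq_card _ _
  rw [← hdeg, ← coeff_divByMonic_X_sub_C, ← Finset.mul_prod_erase _ _ hk,
    mul_divByMonic_cancel_left _ (monic_X_sub_C _)]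

/-- A row sum of polynomial rows is a universal polynomial in the coefficients of
`∏ (X - y k)`. -/
theorem exists_rowSum_eq_eval₂_coeff (ps : List Zbeta[X]) (n : ℕ) :
    ∃ Φ : MvPolynomial ℕ Zbeta, ∀ (K : Type) [Field K] (f : Zbeta →+* K) (ι : Type)
      [DecidableEq ι] (y : ι → K) (s : Finset ι), Set.InjOn y s → s.card = n →
      rowSum (f X) y (fun _ => 1) (ps.map fun p a => p.eval₂ f a) s =
        Φ.eval₂ f fun j => (∏ k ∈ s, (X - C (y k))).coeff j := by
  induction ps generalizing n with
  | nil => exact ⟨1, fun K _ f ι _ y s _ _ => by simp [rowSum]⟩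
  | cons p ps ih =>
    cases n with
    | zero =>
      refine ⟨0, fun K _ f ι _ y s _ hs => ?_⟩
      rw [Finset.card_eq_zero.1 hs]
      simp [rowSum]
    | succ m =>
      obtain ⟨Φ, hΦ⟩ := ih m
      -- The polynomial variable stands for y_k, and the multivariate variables for the coefficients
      -- of the full product N. Then `c` gives the coefficients after deleting the factor of y_k,
      -- `b` is β, and `H` is the k-th summand without its denominator: the row, the two numerators
      -- of the ratios, and the inductive polynomial for the remaining rows.
      let c : ℕ → (MvPolynomial ℕ Zbeta)[X] := fun j =>
        ∑ i ∈ Finset.Icc (j + 1) (m + 1), X ^ (i - (j + 1)) * C (MvPolynomial.X i)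
      let b : (MvPolynomial ℕ Zbeta)[X] := C (MvPolynomial.C X)
      let H : (MvPolynomial ℕ Zbeta)[X] := p.map MvPolynomial.C *
        (∑ i ∈ Finset.range (m + 1), c i * X ^ i * (-(1 + b * X)) ^ (m - i)) *
        (∑ i ∈ Finset.range (m + 1), c i * 1 ^ i * (-b) ^ (m - i)) *
        Φ.eval₂ (C.comp MvPolynomial.C) c
      let N : (MvPolynomial ℕ Zbeta)[X] :=
        X ^ (m + 1) + ∑ i ∈ Finset.range (m + 1), C (MvPolynomial.X i) * X ^ i
      have hNmon : N.Monic := monic_X_pow_add (by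
        refine (degree_sum_le _ _).trans_lt ?_
        rw [Finset.sup_lt_iff (WithBot.bot_lt_coe _)]
        intro i hi
        refine (degree_C_mul_X_pow_le _ _).trans_lt ?_
        exact_mod_cast Finset.mem_range.1 hi)
      refine ⟨(H %ₘ N).coeff m, fun K _ f ι _ y s hy hs => ?_⟩
      have hdeg : (∏ k ∈ s, (X - C (y k))).natDegree = m + 1 :=
        (natDegree_finsetProd_X_sub_C_eq_card _ _).trans hs
      have hmon : (∏ k ∈ s, (X - C (y k))).Monic :=
        monic_prod_of_monic _ _ fun k _ => monic_X_sub_C _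
      set F := MvPolynomial.eval₂Hom f fun j => (∏ k ∈ s, (X - C (y k))).coeff j with hF
      have hFX : ∀ i, F (MvPolynomial.X i) = (∏ k ∈ s, (X - C (y k))).coeff i := fun i => by
        simp [hF]
      have hFC : ∀ i, F (MvPolynomial.C i) = f i := fun i => by simp [hF]
      have hN : N.map F = ∏ k ∈ s, (X - C (y k)) := by
        rw [hmon.as_sum, hdeg]
        simp [N, Polynomial.map_sum, hFX]
      change _ = F _
      rw [← coeff_map, map_modByMonic _ hNmon, hN]
      rw [show m = s.card - 1 by omega, ← sum_div_eq_coeff_modByMonic y s hy, List.map_cons,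
        rowSum]
      refine Finset.sum_congr rfl fun k hk => ?_
      have hk' : (s.erase k).card = m := by rw [Finset.card_erase_of_mem hk, hs]; rfl
      have hc : ∀ j, ((c j).map F).eval (y k) = (∏ l ∈ s.erase k, (X - C (y l))).coeff j := by
        intro j
        rw [coeff_prod_erase y s hk, hs]
        simp only [c, Polynomial.map_sum, eval_finsetSum, Polynomial.map_mul, eval_mul,
          Polynomial.map_pow, map_X, eval_pow, eval_X, map_C, eval_C, hFX]
      have hb : (b.map F).eval (y k) = f X := by simp [b, hFC]
      have e1 : (H.map F).eval (y k) = p.eval₂ f (y k) *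
          (∏ l ∈ s.erase k, (y k + (1 + f X * y k) * y l)) *
          (∏ l ∈ s.erase k, (1 + f X * y l)) *
          Φ.eval₂ f (fun j => (∏ l ∈ s.erase k, (X - C (y l))).coeff j) := by
        rw [prod_add_mul_eq_sum_coeff, prod_add_mul_eq_sum_coeff, hk']
        simp only [H, Polynomial.map_mul, eval_mul, Polynomial.map_sum, eval_finsetSum,
          Polynomial.map_pow, eval_pow, hc, hb, Polynomial.map_neg, Polynomial.map_add,
          eval_add, eval_neg, Polynomial.map_one, eval_one, map_X, eval_X]
        congr 1
        · congr 2
          rw [eval_map, eval₂_map]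
          congr 1
          ext <;> simp [hFC]
        · rw [← eval₂_eq_eval_map, ← coe_eval₂RingHom, MvPolynomial.hom_eval₂]
          congr 1
          · ext <;> simp [hFC]
          · funext j
            rw [← hc, coe_eval₂RingHom, eval₂_eq_eval_map]
      rw [e1, hΦ K f ι y (s.erase k) (hy.mono (by simp)) hk']
      simp only [rowRatio]
      rw [Finset.prod_div_distrib, Finset.prod_mul_distrib,
        Finset.prod_congr rfl fun l _ => show y k + y l + f X * y k * y l =
          y k + (1 + f X * y k) * y l by ring]
      ring

/-- The coefficients of ∏ (X - y_k) are polynomials in the y_k, so they can be substituted into the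
universal polynomial; the result does not depend on the field or the point. -/
theorem exists_rowSum_eq_eval₂ (ps : List Zbeta[X]) {ι : Type} [DecidableEq ι] (s : Finset ι) :
    ∃ P : MvPolynomial ι Zbeta, ∀ (K : Type) [Field K] (f : Zbeta →+* K) (y : ι → K),
      Set.InjOn y s →
      P.eval₂ f y = rowSum (f X) y (fun _ => 1) (ps.map fun p a => p.eval₂ f a) s := by
  obtain ⟨Φ, hΦ⟩ := exists_rowSum_eq_eval₂_coeff ps s.card
  refine ⟨Φ.eval₂ MvPolynomial.C
    fun j => (∏ k ∈ s, (X - C (MvPolynomial.X k : MvPolynomial ι Zbeta))).coeff j,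
    fun K _ f y hy => ?_⟩
  rw [hΦ K f ι y s hy rfl, ← MvPolynomial.coe_eval₂Hom, MvPolynomial.hom_eval₂]
  congr 1
  · ext <;> simp
  · funext j
    rw [← coeff_map, Polynomial.map_prod]
    simp

end Polynomiality

/-! ### The cancellation conditions tested by evaluation. -/

section Cancellation

/-- The properties defining `GΓ_n^X`, tested by evaluation in domains of characteristic zero. -/
def EvalCancels (X : LieType) (n : ℕ) (f : MvPolynomial (Fin n) Zbeta) : Prop :=
  f.IsSymmetric ∧
  (∀ (S : Type) [CommRing S] [IsDomain S] [CharZero S] (φ : Zbeta →+* S) (y : Fin n → S)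
    (i j : Fin n), i < j → ∀ a a' : S, a + a' + φ Polynomial.X * a * a' = 0 →
    f.eval₂ φ (Function.update (Function.update y i a) j a') =
      f.eval₂ φ (Function.update (Function.update y i 0) j 0)) ∧
  (X = LieType.C → ∀ (S : Type) [CommRing S] [IsDomain S] [CharZero S] (φ : Zbeta →+* S)
    (y : Fin n → S) (i : Fin n) (c : S), 2 + φ Polynomial.X * c = 0 →
    f.eval₂ φ (Function.update y i c) = f.eval₂ φ (Function.update y i 0))

theorem MvPolynomial.IsSymmetric.eval₂_comp {σ R S : Type*} [CommSemiring R] [CommSemiring S]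
    {f : MvPolynomial σ R} (hf : f.IsSymmetric) (φ : R →+* S) (y : σ → S) (e : Equiv.Perm σ) :
    f.eval₂ φ (y ∘ e) = f.eval₂ φ y := by
  rw [← MvPolynomial.eval₂_rename, hf e]

/-- A relation at the generic point `(t, ⊖ t)` specializes to every `(a, ⊖ a)`. -/
theorem eval₂_update_of_generic {σ B K S : Type*} [DecidableEq σ] [CommRing B] [IsDomain B]
    [Field K] [Algebra (Polynomial B) K] [IsFractionRing (Polynomial B) K] [CommRing S]
    (φ : Zbeta →+* B) (f : MvPolynomial σ Zbeta) (h : B) (x : σ → B) (i j : σ) (t' : K)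
    (ht' : t' * (1 + algebraMap (Polynomial B) K (Polynomial.C (φ Polynomial.X)) *
      algebraMap (Polynomial B) K Polynomial.X) = - algebraMap (Polynomial B) K Polynomial.X)
    (heq : f.eval₂ ((algebraMap (Polynomial B) K).comp (Polynomial.C.comp φ))
      (Function.update (Function.update (fun k => algebraMap (Polynomial B) K (Polynomial.C (x k))) i
        (algebraMap (Polynomial B) K Polynomial.X)) j t') =
      algebraMap (Polynomial B) K (Polynomial.C h))
    (π : B →+* S) (a a' : S) (ha : a + a' + π (φ Polynomial.X) * a * a' = 0) :
    f.eval₂ (π.comp φ) (Function.update (Function.update (fun k => π (x k)) i a) j a') = π h := by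
  -- The relation already lives in the localization of B[t] at 1 + βt, which contains ⊖t and embeds
  -- in K. The map t ↦ a extends to this localization because (1 + βa)(1 + βa') = 1.
  let d : Polynomial B := 1 + Polynomial.C (φ Polynomial.X) * Polynomial.X
  have hd0 : d ≠ 0 := fun h0 => by
    have := congrArg (Polynomial.eval 0) h0
    simp [d] at this
  let L := Localization.Away d
  have hKi : Function.Injective (algebraMap (Polynomial B) K) := IsFractionRing.injective _ _
  have hdu : IsUnit (algebraMap (Polynomial B) K d) :=
    isUnit_iff_ne_zero.2 ((map_ne_zero_iff _ hKi).2 hd0)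
  let ψ : L →+* K := IsLocalization.Away.lift d hdu
  have hψ : ∀ x, ψ (algebraMap _ L x) = algebraMap _ K x := fun x =>
    IsLocalization.Away.lift_eq d hdu x
  have hle : Submonoid.powers d ≤ nonZeroDivisors (Polynomial B) :=
    powers_le_nonZeroDivisors_of_noZeroDivisors hd0
  have hψi : Function.Injective ψ := by
    refine (IsLocalization.lift_injective_iff _).2 fun x z => ?_
    rw [(IsLocalization.injective (R := Polynomial B) (M := Submonoid.powers d) L hle).eq_iff,
      hKi.eq_iff]
  let u : L := -(algebraMap (Polynomial B) L Polynomial.X * IsLocalization.Away.invSelf d)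
  have hinv : algebraMap (Polynomial B) L d * IsLocalization.Away.invSelf d = 1 :=
    IsLocalization.Away.mul_invSelf d
  have hψu : ψ u = t' := by
    have h1 := congrArg ψ hinv
    rw [map_mul, hψ, map_one] at h1
    have h3 : ψ u = -(algebraMap (Polynomial B) K Polynomial.X *
        ψ (IsLocalization.Away.invSelf d)) := by
      rw [← hψ, ← map_mul, ← map_neg]
    rw [h3]
    have h2 : t' * algebraMap (Polynomial B) K d = - algebraMap (Polynomial B) K Polynomial.X := by
      rw [← ht']; simp [d]
    linear_combination -(ψ (IsLocalization.Away.invSelf d)) * h2 + t' * h1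
  have hg : f.eval₂ ((algebraMap (Polynomial B) L).comp (Polynomial.C.comp φ))
      (Function.update (Function.update (fun k => algebraMap (Polynomial B) L (Polynomial.C (x k))) i
        (algebraMap (Polynomial B) L Polynomial.X)) j u) =
      algebraMap (Polynomial B) L (Polynomial.C h) := by
    apply hψi
    rw [hψ, MvPolynomial.hom_eval₂, ← heq]
    congr 1
    · exact RingHom.ext fun z => hψ _
    · funext k
      simp only [Function.update_apply]
      split_ifs
      · exact hψu
      · exact hψ _
      · exact hψ _
  let ρ : Polynomial B →+* S := Polynomial.eval₂RingHom π a
  have hρd : ρ d = 1 + π (φ Polynomial.X) * a := by simp [ρ, d]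
  have hu : IsUnit (ρ d) := by
    refine IsUnit.of_mul_eq_one (1 + π (φ Polynomial.X) * a') ?_
    rw [hρd]
    linear_combination π (φ Polynomial.X) * ha
  let ρ' : L →+* S := IsLocalization.Away.lift d hu
  have hρ' : ∀ x, ρ' (algebraMap _ L x) = ρ x := fun x => IsLocalization.Away.lift_eq d hu x
  have := congrArg ρ' hg
  rw [hρ', MvPolynomial.hom_eval₂] at this
  have e2 : ρ (Polynomial.C h) = π h := by simp [ρ]
  rw [← e2, ← this]
  congr 1
  · refine RingHom.ext fun z => ?_
    simp only [RingHom.comp_apply, hρ', ρ, Polynomial.coe_eval₂RingHom, Polynomial.eval₂_C]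
  · funext k
    have h1 := congrArg ρ' hinv
    rw [map_mul, hρ', hρd, map_one] at h1
    simp only [Function.update_apply]
    split_ifs
    · have h3 : ρ' u = -(a * ρ' (IsLocalization.Away.invSelf d)) := by
        have : ρ Polynomial.X = a := by simp [ρ]
        nth_rw 1 [← this]
        rw [← hρ', ← map_mul, ← map_neg]
      rw [h3]
      linear_combination (ρ' (IsLocalization.Away.invSelf d)) * ha - a' * h1
    · simp [hρ', ρ]
    · simp [hρ', ρ]

/-- Row sums are meaningful only at distinct values, so the point where two variables become t and
⊖t has to be injective. That t ≠ ⊖t uses characteristic zero: the linear coefficient of t(1 + bt) +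
t is 2. -/
theorem generic_injective {σ B K : Type*} [DecidableEq σ] [CommRing B] [IsDomain B] [CharZero B]
    [Field K] [Algebra (Polynomial B) K] [IsFractionRing (Polynomial B) K]
    (b : B) (x : σ → B) (hx : Function.Injective x) (hx0 : ∀ k, x k ≠ 0) (i j : σ) (t' : K)
    (ht' : t' * (1 + algebraMap (Polynomial B) K (Polynomial.C b) *
      algebraMap (Polynomial B) K Polynomial.X) = - algebraMap (Polynomial B) K Polynomial.X) :
    Function.Injective (Function.update (Function.update
      (fun k => algebraMap (Polynomial B) K (Polynomial.C (x k))) i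
        (algebraMap (Polynomial B) K Polynomial.X)) j t') := by
  have hKi : Function.Injective (algebraMap (Polynomial B) K) := IsFractionRing.injective _ _
  let d : Polynomial B := 1 + Polynomial.C b * Polynomial.X
  have ht : t' * algebraMap (Polynomial B) K d = - algebraMap (Polynomial B) K Polynomial.X := by
    rw [← ht']; simp [d]
  let y : σ → K := fun k => algebraMap (Polynomial B) K (Polynomial.C (x k))
  have hy : Function.Injective y := fun k l hkl => hx (Polynomial.C_injective (hKi hkl))
  have hyt : ∀ k, y k ≠ algebraMap (Polynomial B) K Polynomial.X := fun k hk => by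
    have := congrArg (Polynomial.eval 0) (hKi hk)
    simp [hx0] at this
  have hlift : ∀ p : Polynomial B, algebraMap (Polynomial B) K p = t' →
      p * d + Polynomial.X = 0 := fun p hp => hKi (by
    rw [map_add, map_mul, map_zero, hp, ht, neg_add_cancel])
  have hyt' : ∀ k, y k ≠ t' := fun k hk => by
    have := congrArg (Polynomial.eval 0) (hlift _ hk)
    simp [d, hx0] at this
  have htt' : algebraMap (Polynomial B) K Polynomial.X ≠ t' := fun hk => by
    have h3 := congrArg (fun p => Polynomial.coeff p 1) (hlift _ hk)
    simp only [Polynomial.coeff_add, Polynomial.coeff_X_mul, Polynomial.coeff_X_one,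
      Polynomial.coeff_zero, d, Polynomial.coeff_one_zero, Polynomial.mul_coeff_zero,
      Polynomial.coeff_X_zero, mul_zero, add_zero] at h3
    exact two_ne_zero (α := B) (by rw [← h3]; norm_num)
  change Function.Injective (Function.update (Function.update y i _) j t')
  intro k l hkl
  by_contra hne
  simp only [Function.update_apply] at hkl
  split_ifs at hkl
  all_goals first
    | exact hne (hy hkl)
    | exact htt' hkl
    | exact htt' hkl.symm
    | exact hyt' _ hkl
    | exact hyt' _ hkl.symm
    | exact hyt _ hkl
    | exact hyt _ hkl.symm
    | (subst_vars; exact hne rfl)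

theorem ominus_generic {B K : Type*} [CommRing B] [IsDomain B] [Algebra Zbeta B]
    [Field K] [Algebra Zbeta K] [Algebra (Polynomial B) K] [IsFractionRing (Polynomial B) K] (b : B)
    (hb : betaIn K = algebraMap (Polynomial B) K (Polynomial.C b)) :
    ominus 0 (algebraMap (Polynomial B) K Polynomial.X) *
      (1 + algebraMap (Polynomial B) K (Polynomial.C b) *
      algebraMap (Polynomial B) K Polynomial.X) = - algebraMap (Polynomial B) K Polynomial.X := by
  have hd : (1 + algebraMap (Polynomial B) K (Polynomial.C b) *
      algebraMap (Polynomial B) K Polynomial.X) ≠ 0 := by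
    rw [← map_mul, ← map_one (algebraMap (Polynomial B) K), ← map_add]
    refine (map_ne_zero_iff _ (IsFractionRing.injective _ _)).2 fun h0 => ?_
    have := congrArg (Polynomial.eval 0) h0
    simp at this
  rw [ominus, Ring.inverse_eq_inv', hb, mul_assoc, inv_mul_cancel₀ hd, mul_one, zero_sub]

theorem ite_eq_update {σ K : Type*} [DecidableEq σ] (y : σ → K) {i j : σ} (hij : i ≠ j) (a b : K) :
    (fun k => if k = i then a else if k = j then b else y k) =
      Function.update (Function.update y i a) j b := by
  funext k
  rcases eq_or_ne k j with rfl | hkj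
  · simp [hij.symm]
  · rcases eq_or_ne k i with rfl | hki
    · simp [hkj]
    · simp [hkj, hki]

theorem isGGamma_iff_generic {n : ℕ} {f : MvPolynomial (Fin n) Zbeta} :
    IsGGamma n f ↔ f.IsSymmetric ∧ ∀ i j : Fin n, i < j →
      ∃ h : MvPolynomial (Fin n) Zbeta,
        f.eval₂ ((algebraMap (Polynomial (MvPolynomial (Fin n) Zbeta))
            (FractionRing (Polynomial (MvPolynomial (Fin n) Zbeta)))).comp
              (Polynomial.C.comp MvPolynomial.C))
          (Function.update (Function.update
            (fun k => algebraMap (Polynomial (MvPolynomial (Fin n) Zbeta))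
              (FractionRing (Polynomial (MvPolynomial (Fin n) Zbeta)))
              (Polynomial.C (MvPolynomial.X k))) i
            (algebraMap (Polynomial (MvPolynomial (Fin n) Zbeta))
              (FractionRing (Polynomial (MvPolynomial (Fin n) Zbeta))) Polynomial.X)) j
            (ominus 0 (algebraMap (Polynomial (MvPolynomial (Fin n) Zbeta))
              (FractionRing (Polynomial (MvPolynomial (Fin n) Zbeta))) Polynomial.X))) =
        algebraMap (Polynomial (MvPolynomial (Fin n) Zbeta))
          (FractionRing (Polynomial (MvPolynomial (Fin n) Zbeta))) (Polynomial.C h) := by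
  refine and_congr_right fun _ => forall_congr' fun i => forall_congr' fun j =>
    forall_congr' fun hij => exists_congr fun h => ?_
  rw [MvPolynomial.aeval_def, ite_eq_update _ hij.ne]
  rfl

theorem ominus_generic_X (n : ℕ) :
    ominus 0 (algebraMap (Polynomial (MvPolynomial (Fin n) Zbeta))
        (FractionRing (Polynomial (MvPolynomial (Fin n) Zbeta))) Polynomial.X) *
      (1 + algebraMap (Polynomial (MvPolynomial (Fin n) Zbeta))
        (FractionRing (Polynomial (MvPolynomial (Fin n) Zbeta)))
          (Polynomial.C (MvPolynomial.C Polynomial.X)) *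
      algebraMap (Polynomial (MvPolynomial (Fin n) Zbeta))
        (FractionRing (Polynomial (MvPolynomial (Fin n) Zbeta))) Polynomial.X) =
      - algebraMap (Polynomial (MvPolynomial (Fin n) Zbeta))
        (FractionRing (Polynomial (MvPolynomial (Fin n) Zbeta))) Polynomial.X :=
  ominus_generic (MvPolynomial.C Polynomial.X) rfl

/-- All pairs with a ⊕ a' = 0 give the value of one polynomial h at y, and (0, 0) is such a pair. -/
theorem IsGGamma.eval₂_update {n : ℕ} {f : MvPolynomial (Fin n) Zbeta} (hf : IsGGamma n f)
    {S : Type*} [CommRing S] (φ : Zbeta →+* S) (y : Fin n → S) {i j : Fin n} (hij : i < j)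
    {a a' : S} (ha : a + a' + φ Polynomial.X * a * a' = 0) :
    f.eval₂ φ (Function.update (Function.update y i a) j a') =
      f.eval₂ φ (Function.update (Function.update y i 0) j 0) := by
  obtain ⟨h, hh⟩ := (isGGamma_iff_generic.1 hf).2 i j hij
  have hφ : φ = (MvPolynomial.eval₂Hom φ y).comp MvPolynomial.C :=
    RingHom.ext fun r => by simp
  have hy : y = fun k => MvPolynomial.eval₂Hom φ y (MvPolynomial.X k) := by funext k; simp
  have key : ∀ a a' : S, a + a' + φ Polynomial.X * a * a' = 0 →
      f.eval₂ φ (Function.update (Function.update y i a) j a') =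
        MvPolynomial.eval₂Hom φ y h := by
    intro a a' ha
    have key := eval₂_update_of_generic
      (K := FractionRing (Polynomial (MvPolynomial (Fin n) Zbeta))) MvPolynomial.C f h
      MvPolynomial.X i j _ (ominus_generic_X n) hh (MvPolynomial.eval₂Hom φ y) a a'
      (by rw [MvPolynomial.eval₂Hom_C]; exact ha)
    rwa [← hφ, ← hy] at key
  rw [key a a' ha, key 0 0 (by simp)]

/-- The generic point (t, ⊖t) is itself a point over a field of characteristic zero with distinct
coordinates, so such points suffice as tests. -/
theorem isGGamma_of_eval {n : ℕ} {f : MvPolynomial (Fin n) Zbeta} (hs : f.IsSymmetric)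
    (h : ∀ i j : Fin n, i < j → ∃ h : MvPolynomial (Fin n) Zbeta,
      ∀ (K : Type) [Field K] [CharZero K] (φ : Zbeta →+* K) (y : Fin n → K) (a a' : K),
      Function.Injective (Function.update (Function.update y i a) j a') →
      Function.Injective y →
      a + a' + φ Polynomial.X * a * a' = 0 →
      f.eval₂ φ (Function.update (Function.update y i a) j a') = h.eval₂ φ y) :
    IsGGamma n f := by
  refine isGGamma_iff_generic.2 ⟨hs, fun i j hij => ?_⟩
  obtain ⟨h, hh⟩ := h i j hij
  refine ⟨h, ?_⟩
  have ht := ominus_generic_X n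
  have hKi : Function.Injective (algebraMap (Polynomial (MvPolynomial (Fin n) Zbeta))
    (FractionRing (Polynomial (MvPolynomial (Fin n) Zbeta)))) :=
    IsFractionRing.injective (Polynomial (MvPolynomial (Fin n) Zbeta)) _
  have := charZero_of_injective_algebraMap hKi
  have hinj := generic_injective _ _ MvPolynomial.X_injective
    (fun k : Fin n => MvPolynomial.X_ne_zero (R := Zbeta) k) i j _ ht
  rw [hh _ _ _ _ _ hinj (fun k l hkl =>
    MvPolynomial.X_injective (Polynomial.C_injective (hKi hkl)))]
  · change _ = ((algebraMap (Polynomial (MvPolynomial (Fin n) Zbeta)) _).comp Polynomial.C) h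
    rw [← MvPolynomial.coe_eval₂Hom]
    refine DFunLike.congr_fun ?_ h
    refine MvPolynomial.ringHom_ext (fun r => ?_) (fun k => ?_)
    · rw [MvPolynomial.eval₂Hom_C]; rfl
    · rw [MvPolynomial.eval₂Hom_X']; rfl
  · simp only [RingHom.comp_apply]
    linear_combination ht

/-- A factor theorem for the root -2/β. Multiplying g by a power of β allows β x_i to be replaced by
-2 modulo 2 + β x_i; vanishing at the root then makes 2 + β x_i divide β^N g. The power of β is
removed because β is prime and does not divide 2. -/
theorem two_add_mul_dvd {n : ℕ} {K : Type*} [Field K] [Algebra (MvPolynomial (Fin n) Zbeta) K]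
    [IsFractionRing (MvPolynomial (Fin n) Zbeta) K] (i : Fin n) (g : MvPolynomial (Fin n) Zbeta)
    (c : K) (hc : 2 + algebraMap (MvPolynomial (Fin n) Zbeta) K (MvPolynomial.C Polynomial.X) * c
      = 0)
    (hg : g.eval₂ ((algebraMap (MvPolynomial (Fin n) Zbeta) K).comp MvPolynomial.C)
      (Function.update (fun k => algebraMap (MvPolynomial (Fin n) Zbeta) K
      (MvPolynomial.X k)) i c) = 0) :
    2 + MvPolynomial.C Polynomial.X * MvPolynomial.X i ∣ g := by
  set b : MvPolynomial (Fin n) Zbeta := MvPolynomial.C Polynomial.X with hb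
  set y := Function.update (fun k => algebraMap
      (MvPolynomial (Fin n) Zbeta) K (MvPolynomial.X k)) i c with hy
  set φ : Zbeta →+* K := (algebraMap (MvPolynomial (Fin n) Zbeta) K).comp MvPolynomial.C with hφ
  have key : ∀ g : MvPolynomial (Fin n) Zbeta, ∃ (N : ℕ) (g₀ : MvPolynomial (Fin n) Zbeta),
      2 + b * MvPolynomial.X i ∣ b ^ N * g - g₀ ∧
      algebraMap _ K g₀ = algebraMap _ K b ^ N * g.eval₂ φ y := by
    intro g
    induction g using MvPolynomial.induction_on with
    | C a => exact ⟨0, MvPolynomial.C a, by simp, by simp [hφ]⟩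
    | add p q hp hq =>
      obtain ⟨N, p₀, hp1, hp2⟩ := hp
      obtain ⟨M, q₀, hq1, hq2⟩ := hq
      refine ⟨N + M, b ^ M * p₀ + b ^ N * q₀, ?_, ?_⟩
      · have := (hp1.mul_left (b ^ M)).add (hq1.mul_left (b ^ N))
        convert this using 1
        ring
      · rw [MvPolynomial.eval₂_add, map_add, map_mul, map_mul, hp2, hq2, map_pow, map_pow]
        ring
    | mul_X p k hp =>
      obtain ⟨N, p₀, hp1, hp2⟩ := hp
      rcases eq_or_ne k i with rfl | hk
      · refine ⟨N + 1, -2 * p₀, ?_, ?_⟩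
        · have := (hp1.mul_left (b * MvPolynomial.X k)).add (Dvd.intro_left p₀ rfl :
            2 + b * MvPolynomial.X k ∣ p₀ * (2 + b * MvPolynomial.X k))
          convert this using 1
          ring
        · rw [MvPolynomial.eval₂_mul, MvPolynomial.eval₂_X, hy, Function.update_self, ← hy,
            map_mul, hp2, pow_succ, map_neg, map_ofNat]
          linear_combination -(algebraMap _ K b ^ N * MvPolynomial.eval₂ φ y p) * hc
      · refine ⟨N, p₀ * MvPolynomial.X k, ?_, ?_⟩
        · have := hp1.mul_right (MvPolynomial.X k)
          convert this using 1
          ring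
        · rw [MvPolynomial.eval₂_mul, MvPolynomial.eval₂_X, hy, Function.update_of_ne hk, ← hy,
            map_mul, hp2]
          ring
  obtain ⟨N, g₀, h1, h2⟩ := key g
  rw [hg, mul_zero, map_eq_zero_iff _ (IsFractionRing.injective _ K)] at h2
  rw [h2, sub_zero] at h1
  have hprime : Prime b := by
    rw [hb, MvPolynomial.prime_C_iff]
    exact Polynomial.prime_X
  refine IsRelPrime.dvd_of_dvd_mul_left ?_ h1
  refine IsRelPrime.pow_right ?_
  refine IsRelPrime.symm (hprime.irreducible.isRelPrime_iff_not_dvd.2 fun hdv => ?_)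
  have h2' : b ∣ 2 := (dvd_add_left (dvd_mul_right b _)).1 hdv
  obtain ⟨q, hq⟩ := h2'
  have := congrArg (MvPolynomial.eval₂ (Polynomial.evalRingHom (0 : ℤ)) 0) hq
  rw [MvPolynomial.eval₂_mul, hb, MvPolynomial.eval₂_C] at this
  simp at this

theorem eval₂_aeval_Zbeta {σ τ S : Type*} [CommRing S] (φ : Zbeta →+* S)
    (y : τ → S) (z : σ → MvPolynomial τ Zbeta) (f : MvPolynomial σ Zbeta) :
    (MvPolynomial.aeval z f).eval₂ φ y = f.eval₂ φ fun k => (z k).eval₂ φ y := by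
  rw [MvPolynomial.aeval_def, ← MvPolynomial.coe_eval₂Hom φ y, MvPolynomial.hom_eval₂]
  congr 1
  exact RingHom.ext fun r => by simp [MvPolynomial.algebraMap_eq]

theorem eval₂_aeval_ite {n : ℕ} {S : Type*} [CommRing S] (φ : Zbeta →+* S) (y : Fin n → S)
    (i : Fin n) (c : S) (f : MvPolynomial (Fin n) Zbeta) :
    (MvPolynomial.aeval (fun k : Fin n => if k = i then 0 else MvPolynomial.X k) f).eval₂ φ
      (Function.update y i c) = f.eval₂ φ (Function.update y i 0) := by
  rw [eval₂_aeval_Zbeta]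
  congr 1
  funext k
  rcases eq_or_ne k i with rfl | hk
  · simp
  · simp [hk]

theorem X_dvd_sub_aeval {n : ℕ} (i : Fin n) (f : MvPolynomial (Fin n) Zbeta) :
    MvPolynomial.X i ∣
      f - MvPolynomial.aeval (fun k : Fin n => if k = i then 0 else MvPolynomial.X k) f := by
  rw [← Ideal.mem_span_singleton, ← Ideal.Quotient.eq]
  have h : (Ideal.Quotient.mkₐ Zbeta (Ideal.span {MvPolynomial.X i})) =
      (Ideal.Quotient.mkₐ Zbeta (Ideal.span {MvPolynomial.X i})).comp
        (MvPolynomial.aeval (fun k : Fin n => if k = i then 0 else MvPolynomial.X k)) := by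
    refine MvPolynomial.algHom_ext fun k => ?_
    rw [AlgHom.comp_apply, MvPolynomial.aeval_X]
    split_ifs with hk
    · rw [map_zero, hk]
      exact Ideal.Quotient.eq_zero_iff_mem.2 (Ideal.mem_span_singleton_self _)
    · rfl
  exact DFunLike.congr_fun h f

theorem oplus_X_self {n : ℕ} (i : Fin n) :
    oplus (MvPolynomial.X i : MvPolynomial (Fin n) Zbeta) (MvPolynomial.X i) =
      MvPolynomial.X i * (2 + MvPolynomial.C Polynomial.X * MvPolynomial.X i) := by
  change MvPolynomial.X i + MvPolynomial.X i + MvPolynomial.C Polynomial.X * MvPolynomial.X i *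
    MvPolynomial.X i = _
  ring

theorem not_X_dvd_two {n : ℕ} (i : Fin n) : ¬ (MvPolynomial.X i : MvPolynomial (Fin n) Zbeta) ∣ 2 := by
  rintro ⟨q, hq⟩
  have := congrArg (MvPolynomial.eval 0) hq
  rw [map_mul, map_ofNat, MvPolynomial.eval_X, Pi.zero_apply, zero_mul] at this
  exact two_ne_zero (α := Zbeta) this

/-- Since x ⊕ x = x(2 + βx) has coprime factors, divisibility can be tested on each. Divisibility by
x is automatic for f(x, …) - f(0, …), and divisibility by 2 + βx is equality of the values at -2/β
and 0. -/
theorem isGGammaPlus_of_eval {n : ℕ} {f : MvPolynomial (Fin n) Zbeta} (hf : IsGGamma n f)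
    (h : ∀ (K : Type) [Field K] [CharZero K] (φ : Zbeta →+* K) (y : Fin n → K) (i : Fin n)
      (c : K), Function.Injective (Function.update y i c) →
      Function.Injective (Function.update y i 0) → 2 + φ Polynomial.X * c = 0 →
      f.eval₂ φ (Function.update y i c) = f.eval₂ φ (Function.update y i 0)) :
    IsGGammaPlus n f := by
  refine ⟨hf, fun i _ => ?_⟩
  have hKi : Function.Injective (algebraMap (MvPolynomial (Fin n) Zbeta)
    (FractionRing (MvPolynomial (Fin n) Zbeta))) := IsFractionRing.injective _ _
  have := charZero_of_injective_algebraMap hKi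
  obtain ⟨y, hyd⟩ : ∃ y : Fin n → FractionRing (MvPolynomial (Fin n) Zbeta),
    y = fun k => algebraMap (MvPolynomial (Fin n) Zbeta) _ (MvPolynomial.X k) := ⟨_, rfl⟩
  obtain ⟨φ, hφ⟩ : ∃ φ : Zbeta →+* FractionRing (MvPolynomial (Fin n) Zbeta),
    φ = (algebraMap (MvPolynomial (Fin n) Zbeta) _).comp MvPolynomial.C := ⟨_, rfl⟩
  have hb : φ Polynomial.X ≠ 0 := by
    rw [hφ]
    exact (map_ne_zero_iff _ hKi).2 (MvPolynomial.C_ne_zero.2 Polynomial.X_ne_zero)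
  obtain ⟨c, hc⟩ : ∃ c, 2 + φ Polynomial.X * c = 0 :=
    ⟨-2 / φ Polynomial.X, by rw [mul_div_cancel₀ _ hb]; ring⟩
  have hy : Function.Injective y := fun k l hkl =>
    MvPolynomial.X_injective (hKi (by simpa only [hyd] using hkl))
  have hinj : ∀ v, (∀ k, y k ≠ v) → Function.Injective (Function.update y i v) := by
    intro v hv k l hkl
    by_contra hne
    simp only [Function.update_apply] at hkl
    split_ifs at hkl with h1 h2 h2
    · exact hne (h1.trans h2.symm)
    · exact hv _ hkl.symm
    · exact hv _ hkl
    · exact hne (hy hkl)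
  have hyc : ∀ k, y k ≠ c := fun k hk => by
    rw [← hk, hφ, hyd] at hc
    have h1 : algebraMap (MvPolynomial (Fin n) Zbeta) (FractionRing (MvPolynomial (Fin n) Zbeta))
        (2 + MvPolynomial.C Polynomial.X * MvPolynomial.X k) =
        algebraMap (MvPolynomial (Fin n) Zbeta) (FractionRing (MvPolynomial (Fin n) Zbeta)) 0 := by
      rw [map_add, map_mul, map_zero, map_ofNat]
      exact hc
    have := congrArg (MvPolynomial.eval 0) (hKi h1)
    rw [map_add, map_mul, map_ofNat, MvPolynomial.eval_X, Pi.zero_apply, mul_zero, add_zero] at this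
    exact two_ne_zero (α := Zbeta) (this.trans (map_zero _))
  have hy0 : ∀ k, y k ≠ 0 := fun k hk => by
    rw [hyd] at hk
    exact MvPolynomial.X_ne_zero (R := Zbeta) k (hKi (hk.trans (map_zero _).symm))
  have key := h _ φ y i c (hinj c hyc) (hinj 0 hy0) hc
  have hd1 : 2 + MvPolynomial.C Polynomial.X * MvPolynomial.X i ∣ f -
      MvPolynomial.aeval (fun k : Fin n => if k = i then 0 else MvPolynomial.X k) f := by
    refine two_add_mul_dvd (K := FractionRing (MvPolynomial (Fin n) Zbeta)) i _ c
      (by rw [hφ] at hc; exact hc) ?_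
    rw [← hφ, ← hyd, MvPolynomial.eval₂_sub, eval₂_aeval_ite, key, sub_self]
  have hrel : IsRelPrime (MvPolynomial.X i : MvPolynomial (Fin n) Zbeta)
      (2 + MvPolynomial.C Polynomial.X * MvPolynomial.X i) :=
    MvPolynomial.X_prime.irreducible.isRelPrime_iff_not_dvd.2 fun hdv =>
      not_X_dvd_two i ((dvd_add_left (dvd_mul_left _ _)).1 hdv)
  rw [oplus_X_self]
  exact hrel.mul_dvd (X_dvd_sub_aeval i f) hd1

theorem IsGGammaOfType.evalCancels {X : LieType} {n : ℕ} {f : MvPolynomial (Fin n) Zbeta}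
    (hf : IsGGammaOfType X n f) : EvalCancels X n f := by
  have hg : IsGGamma n f := by cases X <;> first | exact hf | exact hf.1
  refine ⟨hg.1, fun S _ _ _ φ y i j hij a a' ha => hg.eval₂_update φ y hij ha, ?_⟩
  rintro rfl S _ _ _ φ y i c hc
  have hi : 0 < n := i.pos
  -- The definition constrains the first variable only; symmetry transports the condition to every
  -- i.
  suffices H : ∀ y : Fin n → S, f.eval₂ φ (Function.update y ⟨0, hi⟩ c) =
      f.eval₂ φ (Function.update y ⟨0, hi⟩ 0) by
    have hu : ∀ w : S, Function.update y i w ∘ Equiv.swap ⟨0, hi⟩ i =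
        Function.update (y ∘ Equiv.swap ⟨0, hi⟩ i) ⟨0, hi⟩ w := fun w => by
      have := Function.update_comp_equiv y (Equiv.swap ⟨0, hi⟩ i) i w
      rw [this]; simp
    rw [← hg.1.eval₂_comp φ _ (Equiv.swap ⟨0, hi⟩ i), hu, H,
      ← hg.1.eval₂_comp φ (Function.update y i 0) (Equiv.swap ⟨0, hi⟩ i), hu]
  intro y
  obtain ⟨q, hq⟩ := hf.2 ⟨0, hi⟩ rfl
  have h1 := congrArg (MvPolynomial.eval₂ φ (Function.update y ⟨0, hi⟩ c)) hq
  rw [MvPolynomial.eval₂_mul, MvPolynomial.eval₂_sub] at h1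
  have h2 : MvPolynomial.eval₂ φ (Function.update y ⟨0, hi⟩ c)
      (oplus (MvPolynomial.X ⟨0, hi⟩) (MvPolynomial.X ⟨0, hi⟩)) = 0 := by
    rw [oplus_X_self, ← MvPolynomial.coe_eval₂Hom]
    simp only [map_mul, map_add, map_ofNat, MvPolynomial.eval₂Hom_X', MvPolynomial.eval₂Hom_C,
      Function.update_self]
    rw [hc, mul_zero]
  rw [h2, zero_mul, sub_eq_zero] at h1
  rw [h1, eval₂_aeval_ite]

theorem EvalCancels.isGGammaOfType {X : LieType} {n : ℕ} {f : MvPolynomial (Fin n) Zbeta}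
    (hf : EvalCancels X n f) : IsGGammaOfType X n f := by
  have hg : IsGGamma n f := by
    -- The value independent of t has to be the one at t = 0, so the witness is f with x_i = x_j =
    -- 0.
    refine isGGamma_of_eval hf.1 fun i j hij => ⟨MvPolynomial.aeval (Function.update
      (Function.update MvPolynomial.X i 0) j 0) f, fun K _ _ φ y a a' _ _ ha => ?_⟩
    rw [hf.2.1 K φ y i j hij a a' ha, eval₂_aeval_Zbeta]
    congr 1
    funext k
    simp only [Function.update_apply]
    split_ifs <;> simp
  cases X
  · exact hg
  · exact isGGammaPlus_of_eval hg fun K _ _ φ y i c _ _ hc => hf.2.2 rfl K φ y i c hc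
  · exact hg

end Cancellation

/-! ### Points in general position. -/

section Generic

/-- A sequence of elements of `K` in general position over the image of `f`. -/
structure IsGenericSeq {A K : Type*} [CommRing A] [Field K] (f : A →+* K) (b : A) (y : ℕ → K) :
    Prop where
  injective : Function.Injective y
  ne_map : ∀ k c, y k ≠ f c
  one_add_ne : ∀ k, 1 + f b * y k ≠ 0
  two_add_ne : ∀ k, 2 + f b * y k ≠ 0
  oplus_ne : ∀ k l, y k + y l + f b * y k * y l ≠ 0

theorem IsGenericSeq.ne_zero {A K : Type*} [CommRing A] [Field K] {f : A →+* K} {b : A}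
    {y : ℕ → K} (h : IsGenericSeq f b y) (k : ℕ) : y k ≠ 0 := by
  have := h.ne_map k 0
  rwa [map_zero] at this

theorem isGenericSeq_X {A K : Type*} [CommRing A] [IsDomain A] [CharZero A] [Field K]
    [Algebra (MvPolynomial ℕ A) K] [IsFractionRing (MvPolynomial ℕ A) K] (b : A) :
    IsGenericSeq ((algebraMap (MvPolynomial ℕ A) K).comp MvPolynomial.C) b
      (fun k => algebraMap (MvPolynomial ℕ A) K (MvPolynomial.X k)) := by
  have hKi : Function.Injective (algebraMap (MvPolynomial ℕ A) K) := IsFractionRing.injective _ _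
  -- Nonvanishing is tested after identifying all variables with a single one, where a low
  -- coefficient is visible.
  have hne : ∀ p : MvPolynomial ℕ A, MvPolynomial.eval₂ Polynomial.C (fun _ => Polynomial.X) p ≠ 0 →
      algebraMap (MvPolynomial ℕ A) K p ≠ 0 := fun p hp h => by
    rw [map_eq_zero_iff _ hKi] at h
    simp [h] at hp
  refine ⟨fun k l h => MvPolynomial.X_injective (hKi h), fun k c => ?_, fun k => ?_, fun k => ?_,
    fun k l => ?_⟩
  · rw [RingHom.comp_apply, ← sub_ne_zero, ← map_sub]
    refine hne _ fun h => ?_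
    have := congrArg (fun p => Polynomial.coeff p 1) h
    simp at this
  · have := hne (1 + MvPolynomial.C b * MvPolynomial.X k) fun h => by
      have := congrArg (fun p => Polynomial.coeff p 0) h
      simp at this
    simpa using this
  · have := hne (MvPolynomial.C 2 + MvPolynomial.C b * MvPolynomial.X k) fun h => by
      have := congrArg (fun p => Polynomial.coeff p 0) h
      simp at this
    rw [map_add, map_mul, map_ofNat MvPolynomial.C, map_ofNat] at this
    exact this
  · have := hne (MvPolynomial.X k + MvPolynomial.X l +
        MvPolynomial.C b * MvPolynomial.X k * MvPolynomial.X l) fun h => by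
      have := congrArg (fun p => Polynomial.coeff p 1) h
      simp [mul_assoc] at this
    simpa using this

/-- The variables x_0, x_1, … are a generic sequence in the fraction field of A[x_0, x_1, …], so
polynomial identities may be checked where no denominator of a row sum vanishes. Infinitely many
variables leave spare generic values beyond the first n. -/
theorem eq_of_generic {A : Type} [CommRing A] [IsDomain A] [CharZero A] (b : A) {n : ℕ}
    {P Q : MvPolynomial (Fin n) A}
    (h : ∀ (K : Type) [Field K] [CharZero K] (f : A →+* K) (y : ℕ → K), Function.Injective f →
      IsGenericSeq f b y → P.eval₂ f (fun i : Fin n => y i) = Q.eval₂ f (fun i : Fin n => y i)) : P = Q := by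
  have hKi : Function.Injective (algebraMap (MvPolynomial ℕ A) (FractionRing (MvPolynomial ℕ A))) :=
    IsFractionRing.injective _ _
  have := charZero_of_injective_algebraMap hKi
  have key := h (FractionRing (MvPolynomial ℕ A)) _ _
    (hKi.comp (MvPolynomial.C_injective ℕ A)) (isGenericSeq_X b)
  have e : ∀ P : MvPolynomial (Fin n) A, P.eval₂
      ((algebraMap (MvPolynomial ℕ A) (FractionRing (MvPolynomial ℕ A))).comp MvPolynomial.C)
      (fun i : Fin n => algebraMap (MvPolynomial ℕ A) (FractionRing (MvPolynomial ℕ A))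
        (MvPolynomial.X (i : ℕ))) =
      algebraMap (MvPolynomial ℕ A) _ (MvPolynomial.rename (fun i : Fin n => (i : ℕ)) P) := by
    intro P
    rw [MvPolynomial.rename_eq_aeval, MvPolynomial.aeval_def, MvPolynomial.hom_eval₂]
    rfl
  rw [e, e] at key
  exact MvPolynomial.rename_injective _ Fin.val_injective (hKi key)

end Generic

/-! ### Coefficients with respect to the first variable. -/

section Coefficients

theorem map_finSuccEquiv {n : ℕ} {A S : Type*} [CommRing A] [CommRing S] (φ : A →+* S)
    (y : Fin n → S) (f : MvPolynomial (Fin (n + 1)) A) :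
    (MvPolynomial.finSuccEquiv A n f).map (MvPolynomial.eval₂Hom φ y) =
      f.eval₂ (Polynomial.C.comp φ) (Fin.cons Polynomial.X fun i => Polynomial.C (y i)) := by
  change ((Polynomial.mapRingHom (MvPolynomial.eval₂Hom φ y)).comp
    (MvPolynomial.finSuccEquiv A n : _ →+* _)) f = MvPolynomial.eval₂Hom _ _ f
  refine DFunLike.congr_fun (MvPolynomial.ringHom_ext (fun r => ?_) (fun k => ?_)) f
  · simp [MvPolynomial.finSuccEquiv_apply]
  · refine Fin.cases ?_ (fun i => ?_) k
    · simp [MvPolynomial.finSuccEquiv_X_zero]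
    · simp [MvPolynomial.finSuccEquiv_X_succ]

/-- Evaluating f at (T, y) over S[T] evaluates all its coefficients in x_1 at y at once. -/
theorem eval₂_coeff_finSuccEquiv {n : ℕ} {A S : Type*} [CommRing A] [CommRing S] (φ : A →+* S)
    (y : Fin n → S) (f : MvPolynomial (Fin (n + 1)) A) (k : ℕ) :
    ((MvPolynomial.finSuccEquiv A n f).coeff k).eval₂ φ y =
      (f.eval₂ (Polynomial.C.comp φ)
        (Fin.cons Polynomial.X fun i => Polynomial.C (y i)) : Polynomial S).coeff k := by
  rw [← map_finSuccEquiv, Polynomial.coeff_map]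
  rfl

theorem cons_update_C {n : ℕ} {S : Type*} [CommRing S] (y : Fin n → S) (i : Fin n) (a : S) :
    (Fin.cons Polynomial.X fun k => Polynomial.C (Function.update y i a k) :
      Fin (n + 1) → Polynomial S) =
    Function.update (Fin.cons Polynomial.X fun k => Polynomial.C (y k)) i.succ
      (Polynomial.C a) := by
  rw [← Fin.cons_update]
  congr 1
  funext k
  simp only [Function.update_apply]
  split_ifs <;> rfl

theorem MvPolynomial.IsSymmetric.coeff_finSuccEquiv {n : ℕ} {A : Type*} [CommRing A]
    {f : MvPolynomial (Fin (n + 1)) A} (hf : f.IsSymmetric) (k : ℕ) :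
    ((MvPolynomial.finSuccEquiv A n f).coeff k).IsSymmetric := by
  intro e
  have h1 := eval₂_coeff_finSuccEquiv MvPolynomial.C
    (MvPolynomial.X : Fin n → MvPolynomial (Fin n) A) f k
  have h2 := eval₂_coeff_finSuccEquiv MvPolynomial.C
    ((MvPolynomial.X : Fin n → MvPolynomial (Fin n) A) ∘ e) f k
  have h3 := hf.eval₂_comp (Polynomial.C.comp MvPolynomial.C)
    (Fin.cons Polynomial.X fun i : Fin n => Polynomial.C (MvPolynomial.X i : MvPolynomial (Fin n) A))
    (Equiv.Perm.decomposeFin.symm (0, e))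
  rw [MvPolynomial.eval₂_eta] at h1
  rw [MvPolynomial.rename_eq_aeval, MvPolynomial.aeval_def, MvPolynomial.algebraMap_eq]
  refine h2.trans (Eq.trans ?_ h1.symm)
  rw [← h3]
  congr 2
  funext l
  refine Fin.cases ?_ (fun i => ?_) l <;> simp

/-- If S is a domain of characteristic zero, so is S[T], and the conditions for f at (T, y) can be
compared coefficient by coefficient. This is why `EvalCancels` quantifies over domains and not only
fields. As a consequence, f(a, x_1, …) is a combination of elements of the ring in one variable
fewer. -/
theorem EvalCancels.coeff {X : LieType} {n : ℕ} {f : MvPolynomial (Fin (n + 1)) Zbeta}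
    (hf : EvalCancels X (n + 1) f) (k : ℕ) :
    EvalCancels X n ((MvPolynomial.finSuccEquiv Zbeta n f).coeff k) := by
  refine ⟨hf.1.coeff_finSuccEquiv k, fun S _ _ _ φ y i j hij a a' ha => ?_,
    fun hX S _ _ _ φ y i c hc => ?_⟩
  · have key := hf.2.1 (Polynomial S) (Polynomial.C.comp φ)
      (Fin.cons Polynomial.X fun k => Polynomial.C (y k)) i.succ j.succ
      (Fin.succ_lt_succ_iff.2 hij) (Polynomial.C a) (Polynomial.C a') (by
        rw [RingHom.comp_apply, ← Polynomial.C_mul, ← Polynomial.C_mul, ← Polynomial.C_add,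
          ← Polynomial.C_add, ha, Polynomial.C_0])
    rw [← Polynomial.C_0, ← cons_update_C, ← cons_update_C, ← cons_update_C,
      ← cons_update_C] at key
    rw [eval₂_coeff_finSuccEquiv, eval₂_coeff_finSuccEquiv, key]
  · have key := hf.2.2 hX (Polynomial S) (Polynomial.C.comp φ)
      (Fin.cons Polynomial.X fun k => Polynomial.C (y k)) i.succ (Polynomial.C c) (by
        rw [RingHom.comp_apply, ← Polynomial.C_mul, ← Polynomial.C_ofNat, ← Polynomial.C_add, hc,
          Polynomial.C_0])
    rw [← Polynomial.C_0, ← cons_update_C, ← cons_update_C] at key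
    rw [eval₂_coeff_finSuccEquiv, eval₂_coeff_finSuccEquiv, key]

theorem setFirst_eq_eval {n : ℕ} {A : Type*} [CommRing A] (a : A)
    (f : MvPolynomial (Fin (n + 1)) A) :
    setFirst n a f = (MvPolynomial.finSuccEquiv A n f).eval (MvPolynomial.C a) := by
  rw [MvPolynomial.finSuccEquiv_apply, ← Polynomial.coe_evalRingHom, MvPolynomial.coe_eval₂Hom,
    MvPolynomial.hom_eval₂, setFirst, MvPolynomial.aeval_def]
  congr 1
  · exact RingHom.ext fun r => by simp [MvPolynomial.algebraMap_eq]
  · funext k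
    refine Fin.cases ?_ (fun i => ?_) k <;> simp

theorem finSuccEquiv_map {n : ℕ} {A S : Type*} [CommRing A] [CommRing S] (φ : A →+* S)
    (f : MvPolynomial (Fin (n + 1)) A) :
    MvPolynomial.finSuccEquiv S n (MvPolynomial.map φ f) =
      (MvPolynomial.finSuccEquiv A n f).map (MvPolynomial.map φ) := by
  have : MvPolynomial.map φ = MvPolynomial.eval₂Hom ((MvPolynomial.C : S →+* MvPolynomial (Fin n) S).comp φ)
      MvPolynomial.X := by
    refine MvPolynomial.ringHom_ext (fun r => ?_) (fun k => ?_) <;> simp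
  rw [this, map_finSuccEquiv]
  rw [MvPolynomial.finSuccEquiv_apply, MvPolynomial.coe_eval₂Hom, MvPolynomial.eval₂_map]
  rfl

theorem setFirst_zero {n : ℕ} {A : Type*} [CommRing A] (f : MvPolynomial (Fin (n + 1)) A) :
    setFirst n 0 f = (MvPolynomial.finSuccEquiv A n f).coeff 0 := by
  rw [setFirst_eq_eval, map_zero, ← Polynomial.coeff_zero_eq_eval_zero]

theorem eval₂_setFirst {n : ℕ} {A S : Type*} [CommRing A] [CommRing S] (φ : A →+* S)
    (y : Fin n → S) (a : A) (f : MvPolynomial (Fin (n + 1)) A) :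
    (setFirst n a f).eval₂ φ y = f.eval₂ φ (Fin.cons (φ a) y) := by
  rw [setFirst, MvPolynomial.aeval_def, ← MvPolynomial.coe_eval₂Hom φ y, MvPolynomial.hom_eval₂]
  congr 1
  · exact RingHom.ext fun r => by simp [MvPolynomial.algebraMap_eq]
  · funext k
    refine Fin.cases ?_ (fun i => ?_) k <;> simp

theorem eval₂_setLastZero {n : ℕ} {A S : Type*} [CommRing A] [CommRing S] (φ : A →+* S)
    (y : Fin n → S) (f : MvPolynomial (Fin (n + 1)) A) :
    (setLastZero A n f).eval₂ φ y = f.eval₂ φ (Fin.snoc y 0) := by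
  rw [setLastZero, MvPolynomial.aeval_def, ← MvPolynomial.coe_eval₂Hom φ y, MvPolynomial.hom_eval₂]
  congr 1
  · exact RingHom.ext fun r => by simp [MvPolynomial.algebraMap_eq]
  · funext k
    refine Fin.lastCases ?_ (fun i => ?_) k <;> simp

theorem MvPolynomial.IsSymmetric.setLastZero_eq {n : ℕ} {A : Type*} [CommRing A]
    {f : MvPolynomial (Fin (n + 1)) A} (hf : f.IsSymmetric) : setLastZero A n f = setFirst n 0 f := by
  rw [← MvPolynomial.eval₂_eta (setLastZero A n f), ← MvPolynomial.eval₂_eta (setFirst n 0 f),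
    eval₂_setLastZero, eval₂_setFirst, ← hf.eval₂_comp _ (Fin.cons _ _) (finRotate (n + 1)),
    Fin.snoc_eq_cons_rotate, map_zero]
  rfl

theorem EvalCancels.setLastZero {X : LieType} {n : ℕ} {f : MvPolynomial (Fin (n + 1)) Zbeta}
    (hf : EvalCancels X (n + 1) f) : EvalCancels X n (setLastZero Zbeta n f) := by
  rw [hf.1.setLastZero_eq, setFirst_zero]
  exact hf.coeff 0

end Coefficients

/-! ### Row sums over ℤ[β]: cancellation and stability. -/

section RowPolynomials

theorem rowRatio_zero {K : Type*} [Field K] (β : K) {a : K} (ha : a ≠ 0) :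
    rowRatio β a 0 = 1 := by
  rw [rowRatio]; field_simp; ring

/-- As 1 + βc = -1, one has a ⊕ c = c - a. Thus c = -2/β, the nonzero solution of c ⊕ c = 0, is as
invisible to the other variables as 0 is. -/
theorem rowRatio_of_two_add {K : Type*} [Field K] {β a c : K} (hc : 2 + β * c = 0) (ha : a ≠ c) :
    rowRatio β a c = 1 := by
  rw [rowRatio, div_eq_one_iff_eq (sub_ne_zero.2 ha)]
  linear_combination (c - a + a * (1 + β * c)) * hc

theorem rowRatio_of_oplus {K : Type*} [Field K] {β a a' : K} (h : a + a' + β * a * a' = 0) :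
    rowRatio β a a' = 0 := by
  rw [rowRatio, h, zero_mul, zero_div]

/-- With a' = ⊖a, x ⊕ a is x - a' up to the unit 1 + βa, and symmetrically, so each numerator
cancels the denominator of the other ratio. -/
theorem rowRatio_mul_of_oplus {K : Type*} [Field K] {β a a' x : K}
    (h : a + a' + β * a * a' = 0) (hx : x ≠ a) (hx' : x ≠ a') :
    rowRatio β x a * rowRatio β x a' = 1 := by
  have e1 : x + a + β * x * a = (x - a') * (1 + β * a) := by linear_combination h
  have e2 : x + a' + β * x * a' = (x - a) * (1 + β * a') := by linear_combination h
  have e3 : (1 + β * a) * (1 + β * a') = 1 := by linear_combination β * h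
  have h1 := sub_ne_zero.2 hx
  have h2 := sub_ne_zero.2 hx'
  rw [rowRatio, rowRatio, e1, e2, div_mul_div_comm, div_eq_one_iff_eq (mul_ne_zero h1 h2)]
  linear_combination (x - a) * (x - a') * ((1 + β * a) * (1 + β * a') + 1) * e3

/-- The rows given by polynomials, as functions on `K`. -/
def evalRows {A K : Type*} [CommRing A] [CommRing K] (f : A →+* K) (ps : List (Polynomial A)) :
    List (K → K) :=
  ps.map fun p a => p.eval₂ f a

/-- The polynomial in the variables of `s` that represents a row sum. -/
noncomputable def rowPoly (ps : List (Polynomial Zbeta)) {ι : Type} [DecidableEq ι]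
    (s : Finset ι) : MvPolynomial ι Zbeta :=
  Classical.choose (exists_rowSum_eq_eval₂ ps s)

theorem eval₂_rowPoly (ps : List (Polynomial Zbeta)) {ι : Type} [DecidableEq ι] (s : Finset ι)
    {K : Type} [Field K] (f : Zbeta →+* K) (y : ι → K) (hy : Set.InjOn y s) :
    (rowPoly ps s).eval₂ f y = rowSum (f Polynomial.X) y (fun _ => 1) (evalRows f ps) s :=
  Classical.choose_spec (exists_rowSum_eq_eval₂ ps s) K f y hy

theorem rowSum_univ_comp {K ι : Type*} [Field K] [Fintype ι] [DecidableEq ι] (β : K) (y : ι → K)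
    (ps : List (K → K)) (e : Equiv.Perm ι) :
    rowSum β (y ∘ e) (fun _ => 1) ps Finset.univ = rowSum β y (fun _ => 1) ps Finset.univ := by
  have := rowSum_map (β := β) (y := y) (T := fun _ => 1) e.toEmbedding ps Finset.univ
  rw [Finset.map_univ_equiv] at this
  exact this.symm

theorem rowPoly_isSymmetric (ps : List (Polynomial Zbeta)) (n : ℕ) :
    (rowPoly ps (Finset.univ : Finset (Fin n))).IsSymmetric := by
  intro e
  refine eq_of_generic Polynomial.X fun K _ _ f y _ hy => ?_
  have hinj : Function.Injective fun i : Fin n => y i := hy.injective.comp Fin.val_injective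
  rw [MvPolynomial.eval₂_rename, eval₂_rowPoly _ _ _ _ (hinj.comp e.injective).injOn,
    eval₂_rowPoly _ _ _ _ hinj.injOn]
  exact rowSum_univ_comp _ (fun i : Fin n => y i) _ e

/-- A row placed on one of i, j meets the zero ratio against the other, and a row placed elsewhere
sees the two with product one. No condition on the rows is needed. -/
theorem rowSum_cancel {K ι : Type*} [Field K] [DecidableEq ι] {β a a' : K} (y : ι → K) {i j : ι}
    (hij : i ≠ j) (s : Finset ι) (hi : i ∉ s) (hj : j ∉ s) (hyi : y i = a) (hyj : y j = a')
    (ha : a + a' + β * a * a' = 0) (hne : ∀ k ∈ s, y k ≠ a ∧ y k ≠ a')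
    (ps : List (K → K)) :
    rowSum β y (fun _ => 1) ps ({i, j} ∪ s) = rowSum β y (fun _ => 1) ps s := by
  refine rowSum_union _ _ _ _ ?_ (List.forall₂_same.2 fun p _ => ⟨?_, fun k hk => ?_⟩)
  · rw [Finset.disjoint_left]
    intro k hk
    rcases Finset.mem_insert.1 hk with rfl | hk
    · exact hi
    · rwa [Finset.mem_singleton.1 hk]
  · intro o ho
    rcases Finset.mem_insert.1 ho with rfl | ho
    · rw [Finset.erase_insert (by simpa using hij), Finset.prod_singleton, hyi, hyj,
        rowRatio_of_oplus ha, mul_zero]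
    · rw [Finset.mem_singleton.1 ho, Finset.pair_comm, Finset.erase_insert (by simpa using hij.symm),
        Finset.prod_singleton, hyi, hyj, rowRatio_of_oplus (by linear_combination ha), mul_zero]
  · rw [Finset.prod_pair hij, hyi, hyj, rowRatio_mul_of_oplus ha (hne k hk).1 (hne k hk).2, mul_one]

theorem rowPoly_isGGamma (ps : List (Polynomial Zbeta)) (n : ℕ) :
    IsGGamma n (rowPoly ps (Finset.univ : Finset (Fin n))) := by
  refine isGGamma_of_eval (rowPoly_isSymmetric ps n) fun i j hij => ?_
  obtain ⟨t, ht⟩ : ∃ t : Finset (Fin n), ∀ k, k ∈ t ↔ k ≠ i ∧ k ≠ j :=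
    ⟨(Finset.univ.erase i).erase j, fun k => by simp [and_comm]⟩
  -- The value free of t is the same row sum in the remaining variables.
  refine ⟨rowPoly ps t, fun K _ _ φ y a a' hinj hy ha => ?_⟩
  have hu : (Finset.univ : Finset (Fin n)) = {i, j} ∪ t := by
    ext k
    simp only [Finset.mem_univ, Finset.mem_union, Finset.mem_insert, Finset.mem_singleton,
      ht, true_iff]
    tauto
  rw [eval₂_rowPoly _ _ _ _ hinj.injOn, eval₂_rowPoly _ _ _ _ hy.injOn, hu]
  set z := Function.update (Function.update y i a) j a' with hz
  have hzi : z i = a := by simp [hz, hij.ne]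
  have hzj : z j = a' := by simp [hz]
  rw [rowSum_cancel z hij.ne _ (by simp [ht]) (by simp [ht]) hzi hzj ha]
  · refine rowSum_congr _ _ _ (fun k hk => ?_) (List.forall₂_same.2 fun _ _ _ _ => rfl)
    rw [ht] at hk
    simp [hz, hk.1, hk.2]
  · intro k hk
    rw [ht] at hk
    rw [← hzi, ← hzj]
    exact ⟨hinj.ne hk.1, hinj.ne hk.2⟩

/-- The factor common to all rows in the functions of type `X`. -/
noncomputable def rowDivisor : LieType → Polynomial Zbeta
  | LieType.B => Polynomial.X
  | LieType.C => Polynomial.X * (2 + Polynomial.C Polynomial.X * Polynomial.X)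
  | LieType.D => 1

theorem rowSum_insert_of_vanish {K ι : Type*} [Field K] [DecidableEq ι] {β : K} (y : ι → K)
    {o : ι} {s : Finset ι} (ho : o ∉ s) (ps : List (K → K)) (h0 : ∀ p ∈ ps, p (y o) = 0)
    (h1 : ∀ k ∈ s, rowRatio β (y k) (y o) = 1) :
    rowSum β y (fun _ => 1) ps (insert o s) = rowSum β y (fun _ => 1) ps s := by
  rw [Finset.insert_eq]
  refine rowSum_union _ _ _ _ (by simpa using ho) (List.forall₂_same.2 fun p hp => ⟨?_, fun k hk => ?_⟩)
  · simp [h0 p hp]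
  · simp [h1 k hk]

theorem evalRows_eq_zero {A K : Type*} [CommRing A] [CommRing K] (f : A →+* K)
    {ps : List (Polynomial A)} {d : Polynomial A} (hps : ∀ p ∈ ps, d ∣ p) {a : K}
    (hd : d.eval₂ f a = 0) : ∀ p ∈ evalRows f ps, p a = 0 := by
  intro q hq
  obtain ⟨p, hp, rfl⟩ := List.mem_map.1 hq
  obtain ⟨r, rfl⟩ := hps p hp
  simp [Polynomial.eval₂_mul, hd]

/-- Only type C asks for more than the cancellation property. There the rows are divisible by x ⊕ x,
hence vanish at 0 and at -2/β, and the ratios against both values are one; either value of x_i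
therefore gives the row sum of the other variables. -/
theorem rowPoly_evalCancels (X : LieType) (ps : List (Polynomial Zbeta))
    (hps : ∀ p ∈ ps, rowDivisor X ∣ p) (n : ℕ) :
    EvalCancels X n (rowPoly ps (Finset.univ : Finset (Fin n))) := by
  refine IsGGammaOfType.evalCancels ?_
  cases X
  · exact rowPoly_isGGamma ps n
  · refine isGGammaPlus_of_eval (rowPoly_isGGamma ps n) fun K _ _ φ y i c hi hi0 hc => ?_
    rw [eval₂_rowPoly _ _ _ _ hi.injOn, eval₂_rowPoly _ _ _ _ hi0.injOn]
    have hu : (Finset.univ : Finset (Fin n)) = insert i (Finset.univ.erase i) :=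
      (Finset.insert_erase (Finset.mem_univ i)).symm
    have hne : ∀ (w : K), Function.Injective (Function.update y i w) → ∀ k ∈ Finset.univ.erase i,
        Function.update y i w k ≠ w := fun w hw k hk => by
      have := hw.ne (Finset.ne_of_mem_erase hk)
      rwa [Function.update_self] at this
    rw [hu, rowSum_insert_of_vanish _ (by simp), rowSum_insert_of_vanish _ (by simp)]
    · refine rowSum_congr _ _ _ (fun k hk => ?_) (List.forall₂_same.2 fun _ _ _ _ => rfl)
      simp [Finset.ne_of_mem_erase hk]
    · rw [Function.update_self]
      exact evalRows_eq_zero φ hps (by simp [rowDivisor])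
    · intro k hk
      rw [Function.update_self]
      exact rowRatio_zero _ (hne 0 hi0 k hk)
    · rw [Function.update_self]
      refine evalRows_eq_zero φ hps ?_
      have : (2 + Polynomial.C Polynomial.X * Polynomial.X : Polynomial Zbeta).eval₂ φ c = 0 := by
        rw [Polynomial.eval₂_add, Polynomial.eval₂_mul, Polynomial.eval₂_C, Polynomial.eval₂_X,
          Polynomial.eval₂_ofNat, hc]
      rw [rowDivisor, Polynomial.eval₂_mul, this, mul_zero]
    · intro k hk
      rw [Function.update_self]
      exact rowRatio_of_two_add hc (hne c hi k hk)
  · exact rowPoly_isGGamma ps n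

theorem univ_fin_succ_eq (n : ℕ) : (Finset.univ : Finset (Fin (n + 1))) =
    insert (Fin.last n) (Finset.univ.map Fin.castSuccEmb) := by
  ext k
  refine Fin.lastCases ?_ (fun i => ?_) k <;> simp

theorem snoc_injective {K : Type*} {n : ℕ} {y : Fin n → K} (hy : Function.Injective y) {a : K}
    (ha : ∀ k, y k ≠ a) : Function.Injective (Fin.snoc y a : Fin (n + 1) → K) := by
  refine Fin.snoc_injective_iff.2 ⟨hy, ?_⟩
  rintro ⟨k, hk⟩
  exact ha k hk

theorem rowPoly_stable (ps : List (Polynomial Zbeta))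
    (hps : ∀ p ∈ ps, Polynomial.X ∣ p) (n : ℕ) :
    setLastZero Zbeta n (rowPoly ps Finset.univ) = rowPoly ps Finset.univ := by
  refine eq_of_generic Polynomial.X fun K _ _ f y _ hy => ?_
  have hinj : Function.Injective fun i : Fin n => y i := hy.injective.comp Fin.val_injective
  rw [eval₂_setLastZero, eval₂_rowPoly _ _ _ _ (snoc_injective hinj fun k => hy.ne_zero k).injOn,
    eval₂_rowPoly _ _ _ _ hinj.injOn, univ_fin_succ_eq, rowSum_insert_of_vanish _ (by simp),
    rowSum_map]
  · refine rowSum_congr _ _ _ (fun k hk => ?_) (List.forall₂_same.2 fun _ _ _ _ => rfl)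
    simp
  · rw [Fin.snoc_last]
    exact evalRows_eq_zero f hps (by simp)
  · intro k hk
    obtain ⟨i, -, rfl⟩ := Finset.mem_map.1 hk
    rw [Fin.snoc_last]
    simpa using rowRatio_zero _ (hy.ne_zero i)

/-- The rows of type D need not vanish at 0, so a single zero variable cannot be dropped. A pair of
zeros can: by the cancellation property it has the same effect as a generic pair t, ⊖t, which drops
out of the row sum. -/
theorem rowPoly_stable_two (ps : List (Polynomial Zbeta)) (n : ℕ) :
    setLastZero Zbeta n (setLastZero Zbeta (n + 1) (rowPoly ps Finset.univ)) =
      rowPoly ps Finset.univ := by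
  refine eq_of_generic Polynomial.X fun K _ _ f y _ hy => ?_
  have hinj : Function.Injective fun i : Fin n => y i := hy.injective.comp Fin.val_injective
  let b := f Polynomial.X
  -- The first generic value not among the n variables.
  let a := y n
  let a' := -a / (1 + b * a)
  have h1 : 1 + b * a ≠ 0 := hy.one_add_ne n
  have ha : a + a' + b * a * a' = 0 := by
    have : a' * (1 + b * a) = -a := div_mul_cancel₀ _ h1
    linear_combination this
  have hya : ∀ k : Fin n, y k ≠ a := fun k => hy.injective.ne k.2.ne
  have hya' : ∀ k, y k ≠ a' := fun k hk => by
    refine hy.oplus_ne k n ?_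
    have : y n = a := rfl
    rw [hk, this]
    linear_combination ha
  let z : Fin (n + 2) → K := Fin.snoc (Fin.snoc (fun i : Fin n => y i) a : Fin (n + 1) → K) a'
  have hz : Function.Injective z := snoc_injective (snoc_injective hinj hya) fun k => by
    refine Fin.lastCases ?_ (fun i => ?_) k
    · simpa using hya' n
    · simpa using hya' i
  have hupd : ∀ u v : K, (Fin.snoc (Fin.snoc (fun i : Fin n => y i) u : Fin (n + 1) → K) v :
      Fin (n + 2) → K) = Function.update (Function.update z (Fin.last n).castSucc u)
        (Fin.last (n + 1)) v := by
    intro u v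
    rw [← Fin.snoc_update, Fin.update_snoc_last, Fin.update_snoc_last]
  rw [eval₂_setLastZero, eval₂_setLastZero, hupd,
    ← (rowPoly_isGGamma ps (n + 2)).eval₂_update f z (Fin.castSucc_lt_last _) ha, ← hupd,
    eval₂_rowPoly _ _ _ _ hz.injOn, eval₂_rowPoly _ _ _ _ hinj.injOn]
  have hu : (Finset.univ : Finset (Fin (n + 2))) = {(Fin.last n).castSucc, Fin.last (n + 1)} ∪
      Finset.univ.map (Fin.castSuccEmb.trans Fin.castSuccEmb) := by
    rw [univ_fin_succ_eq, univ_fin_succ_eq, Finset.map_insert, Finset.map_map]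
    ext k
    simp only [Finset.mem_insert, Finset.mem_union, Finset.mem_singleton, Fin.castSuccEmb_apply]
    tauto
  rw [hu, rowSum_cancel (a := a) (a' := a') z (Fin.castSucc_lt_last _).ne _ _ _ (by simp [z]) (by simp [z]) ha, rowSum_map]
  · refine rowSum_congr _ _ _ (fun k hk => ?_) (List.forall₂_same.2 fun _ _ _ _ => rfl)
    simp [z]
  · intro k hk
    obtain ⟨i, -, rfl⟩ := Finset.mem_map.1 hk
    exact ⟨by simpa [z] using hya i, by simpa [z] using hya' i⟩
  · intro h
    obtain ⟨i, -, h⟩ := Finset.mem_map.1 h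
    exact (Fin.castSucc_lt_last i).ne (Fin.castSucc_injective _ h)
  · intro h
    obtain ⟨i, -, h⟩ := Finset.mem_map.1 h
    exact (Fin.castSucc_lt_last _).ne h

/-- The compatible sequence attached to a list of rows; in type `D` the components in an odd
number of variables are specializations of the next ones. -/
noncomputable def rowFamily (X : LieType) (ps : List (Polynomial Zbeta)) (n : ℕ) :
    MvPolynomial (Fin n) Zbeta :=
  open Classical in
  if X = LieType.D ∧ ¬ Even n then setLastZero Zbeta n (rowPoly ps Finset.univ)
  else rowPoly ps Finset.univ

theorem rowFamily_mem (X : LieType) (ps : List (Polynomial Zbeta))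
    (hps : ∀ p ∈ ps, rowDivisor X ∣ p) (n : ℕ) : IsGGammaOfType X n (rowFamily X ps n) := by
  refine EvalCancels.isGGammaOfType ?_
  rw [rowFamily]
  split_ifs
  · exact (rowPoly_evalCancels X ps hps (n + 1)).setLastZero
  · exact rowPoly_evalCancels X ps hps n

/-- In type D, passing from an even level to the odd one below holds by definition, and passing from
an odd level down is the two-step stability. In types B and C all rows vanish at 0. -/
theorem rowFamily_stable (X : LieType) (ps : List (Polynomial Zbeta))
    (hps : ∀ p ∈ ps, rowDivisor X ∣ p) (n : ℕ) :
    setLastZero Zbeta n (rowFamily X ps (n + 1)) = rowFamily X ps n := by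
  rw [rowFamily, rowFamily]
  by_cases hX : X = LieType.D
  · by_cases hn : Even n
    · rw [if_pos ⟨hX, by simpa [Nat.even_add_one] using hn⟩, if_neg (by simp [hn]),
        rowPoly_stable_two]
    · rw [if_neg (by simp [Nat.even_add_one, hn]), if_pos ⟨hX, hn⟩]
  · rw [if_neg (fun h => hX h.1), if_neg (fun h => hX h.1)]
    refine rowPoly_stable ps (fun p hp => ?_) n
    cases X
    · exact hps p hp
    · exact (dvd_mul_right _ _).trans (hps p hp)
    · exact absurd rfl hX

end RowPolynomials

/-! ### Compatible families of row sums with rows over R. -/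

section RowFamilies

theorem rowSum_mid_linear {K ι : Type*} [Field K] [DecidableEq ι] {β : K} {y : ι → K}
    {T : Finset ι → K} (pre post : List (K → K)) (p q r : K → K) (s : Finset ι) (a b : K)
    (h : ∀ k ∈ s, p (y k) = a * q (y k) + b * r (y k)) :
    rowSum β y T (pre ++ p :: post) s =
      a * rowSum β y T (pre ++ q :: post) s + b * rowSum β y T (pre ++ r :: post) s := by
  rw [rowSum_append, rowSum_append, rowSum_append, ← rowSum_terminal_linear]
  exact rowSum_congr_terminal _ _ fun t ht _ =>
    rowSum_cons_linear _ _ _ _ _ _ _ fun k hk => h k (ht hk)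

/-- `F` is the family of row sums of `ps` (in type `D`, in even numbers of variables). -/
def IsRowFamily (X : LieType) (ps : List (Polynomial CoeffRing)) (F : Family) : Prop :=
  ∀ n, (X = LieType.D → Even n) → ∀ (K : Type) [Field K] [CharZero K] (f : CoeffRing →+* K)
    (y : Fin n → K), Function.Injective y →
    (F n).eval₂ f y = rowSum (f (betaIn CoeffRing)) y (fun _ => 1) (evalRows f ps) Finset.univ

theorem evalRows_append {A K : Type*} [CommRing A] [CommRing K] (f : A →+* K)
    (ps qs : List (Polynomial A)) : evalRows f (ps ++ qs) = evalRows f ps ++ evalRows f qs :=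
  List.map_append

theorem evalRows_cons {A K : Type*} [CommRing A] [CommRing K] (f : A →+* K) (p : Polynomial A)
    (ps : List (Polynomial A)) :
    evalRows f (p :: ps) = (fun a => p.eval₂ f a) :: evalRows f ps := rfl

/-- Multilinearity in the rows: they are expanded one at a time into monomials, whose coefficients
leave the sum as scalars. The list `qs` holds the rows already reduced to ℤ[β]. The expansion is
finite, so the result lies in the span of the limit and not merely in its completion. -/
theorem exists_rowFamily_aux (X : LieType) (ps : List (Polynomial CoeffRing))
    (hps : ∀ p ∈ ps, (rowDivisor X).map (algebraMap Zbeta CoeffRing) ∣ p)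
    (qs : List (Polynomial Zbeta)) (hqs : ∀ q ∈ qs, rowDivisor X ∣ q) :
    ∃ F ∈ GGammaR X,
      IsRowFamily X (qs.map (Polynomial.map (algebraMap Zbeta CoeffRing)) ++ ps) F := by
  induction ps generalizing qs with
  | nil =>
    refine ⟨fun n => MvPolynomial.map (algebraMap Zbeta CoeffRing) (rowFamily X qs n),
      Submodule.subset_span ⟨rowFamily X qs, fun n => ⟨rowFamily_mem X qs hqs n,
        rowFamily_stable X qs hqs n⟩, fun _ => rfl⟩, fun n hn K _ _ f y hy => ?_⟩
    rw [MvPolynomial.eval₂_map, rowFamily, if_neg fun h => h.2 (hn h.1),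
      eval₂_rowPoly _ _ _ _ hy.injOn, List.append_nil]
    congr 1
    rw [evalRows, evalRows, List.map_map]
    refine List.map_congr_left fun q _ => ?_
    funext a
    simp [Polynomial.eval₂_map]
  | cons p ps ih =>
    obtain ⟨r, rfl⟩ := hps p (by simp)
    have ih' := ih fun p hp => hps p (by simp [hp])
    induction r using Polynomial.induction_on' with
    | add r r' hr hr' =>
      obtain ⟨F, hF, h1⟩ := hr fun p hp => by
        rcases List.mem_cons.1 hp with rfl | hp
        · exact dvd_mul_right _ _
        · exact hps p (by simp [hp])
      obtain ⟨F', hF', h1'⟩ := hr' fun p hp => by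
        rcases List.mem_cons.1 hp with rfl | hp
        · exact dvd_mul_right _ _
        · exact hps p (by simp [hp])
      refine ⟨F + F', add_mem hF hF', fun n hn K _ _ f y hy => ?_⟩
      rw [Pi.add_apply, MvPolynomial.eval₂_add, h1 n hn K f y hy, h1' n hn K f y hy]
      simp only [evalRows_append, evalRows_cons]
      have h := rowSum_mid_linear (β := f (betaIn CoeffRing)) (y := y) (T := fun _ => 1)
        (evalRows f (qs.map (Polynomial.map (algebraMap Zbeta CoeffRing)))) (evalRows f ps)
        (fun a => ((rowDivisor X).map (algebraMap Zbeta CoeffRing) * (r + r')).eval₂ f a)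
        (fun a => ((rowDivisor X).map (algebraMap Zbeta CoeffRing) * r).eval₂ f a)
        (fun a => ((rowDivisor X).map (algebraMap Zbeta CoeffRing) * r').eval₂ f a)
        Finset.univ 1 1 fun k _ => by
          simp only [Polynomial.eval₂_mul, Polynomial.eval₂_add]
          ring
      rw [one_mul, one_mul] at h
      exact h.symm
    | monomial k c =>
      -- The scalar `c` is split off and the remaining row, now over ℤ[β], joins the reduced ones
      -- without changing the order of the rows.
      obtain ⟨F, hF, h1⟩ := ih' (qs ++ [rowDivisor X * Polynomial.X ^ k]) fun q hq => by
        rcases List.mem_append.1 hq with hq | hq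
        · exact hqs q hq
        · rw [List.mem_singleton.1 hq]
          exact dvd_mul_right _ _
      refine ⟨c • F, Submodule.smul_mem _ _ hF, fun n hn K _ _ f y hy => ?_⟩
      rw [Pi.smul_apply, MvPolynomial.smul_eq_C_mul, MvPolynomial.eval₂_mul, MvPolynomial.eval₂_C,
        h1 n hn K f y hy, List.map_append, List.append_assoc]
      simp only [evalRows_append, evalRows_cons, List.map_cons, List.map_nil, List.singleton_append]
      have h := rowSum_mid_linear (β := f (betaIn CoeffRing)) (y := y) (T := fun _ => 1)
        (evalRows f (qs.map (Polynomial.map (algebraMap Zbeta CoeffRing)))) (evalRows f ps)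
        (fun a => ((rowDivisor X).map (algebraMap Zbeta CoeffRing) *
          Polynomial.monomial k c).eval₂ f a)
        (fun a => ((rowDivisor X * Polynomial.X ^ k).map (algebraMap Zbeta CoeffRing)).eval₂ f a)
        (fun _ => 0) Finset.univ (f c) 0 fun k _ => by
          simp only [Polynomial.eval₂_mul, Polynomial.map_mul, Polynomial.map_pow, Polynomial.map_X,
            Polynomial.eval₂_pow, Polynomial.eval₂_X, Polynomial.eval₂_monomial]
          ring
      rw [zero_mul, add_zero] at h
      exact h.symm

theorem exists_rowFamily (X : LieType) (ps : List (Polynomial CoeffRing))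
    (hps : ∀ p ∈ ps, (rowDivisor X).map (algebraMap Zbeta CoeffRing) ∣ p) :
    ∃ F ∈ GGammaR X, IsRowFamily X ps F :=
  exists_rowFamily_aux X ps hps [] (by simp)

end RowFamilies

/-! ### The symmetric group sum as a row sum. -/

section Symmetrization

/-- Permutations are grouped by the image k of the first index; what remains is a permutation of the
other variables. After all rows are placed, the (n - r)! orderings of the unused variables
contribute equally. -/
theorem sum_perm_prod_eq_rowSum {K : Type*} [Field K] (β : K) (g : ℕ → K → K) (l : List ℕ) (n : ℕ)
    (hn : l.length ≤ n) (y : Fin n → K) :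
    ∑ w : Equiv.Perm (Fin n), ∏ i : Fin n with i.val < l.length,
      (g (l.getD i 0) (y (w i)) * ∏ j : Fin n with i < j, rowRatio β (y (w i)) (y (w j))) =
    ((n - l.length).factorial : K) *
      rowSum β y (fun _ => 1) (l.map g) Finset.univ := by
  induction l generalizing n with
  | nil => simp [rowSum, Fintype.card_perm]
  | cons a l ih =>
    obtain ⟨m, rfl⟩ : ∃ m, n = m + 1 := ⟨n - 1, by simp at hn; omega⟩
    have hm : l.length ≤ m := by simpa using hn
    rw [← Equiv.sum_comp Equiv.Perm.decomposeFin.symm, Fintype.sum_prod_type, List.map_cons, rowSum,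
      Finset.mul_sum]
    refine Finset.sum_congr rfl fun k _ => ?_
    -- The enumeration of the variables other than k that `Equiv.Perm.decomposeFin` induces.
    let e : Fin m ↪ Fin (m + 1) := (Fin.succEmb m).trans (Equiv.swap 0 k).toEmbedding
    have he : Finset.univ.map e = Finset.univ.erase k := by
      ext x
      simp only [Finset.mem_map, Finset.mem_univ, true_and, Finset.mem_erase, and_true]
      constructor
      · rintro ⟨i, rfl⟩ h
        refine (Fin.succ_ne_zero i) ((Equiv.swap 0 k).injective (Eq.trans h ?_))
        rw [Equiv.swap_apply_left]
      · intro hx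
        obtain ⟨i, hi⟩ := Fin.exists_succ_eq.2 (show Equiv.swap 0 k x ≠ 0 from fun h => hx (by
          have := congrArg (Equiv.swap 0 k) h
          rwa [Equiv.swap_apply_self, Equiv.swap_apply_left] at this))
        refine ⟨i, ?_⟩
        change Equiv.swap 0 k i.succ = x
        rw [hi, Equiv.swap_apply_self]
    have h0 : ∀ σ : Equiv.Perm (Fin m), ∏ j : Fin m,
        rowRatio β (y k) (y (Equiv.swap 0 k (σ j).succ)) =
        ∏ j ∈ Finset.univ.erase k, rowRatio β (y k) (y j) := fun σ => by
      rw [← he, Finset.prod_map, Equiv.prod_comp σ fun j => rowRatio β (y k) (y (Equiv.swap 0 k j.succ))]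
      rfl
    have key := ih m hm (y ∘ e)
    have hT := rowSum_map (β := β) (y := y) (T := fun _ => 1) e (l.map g) Finset.univ
    rw [he] at hT
    rw [← hT] at key
    simp only [List.length_cons, Nat.add_sub_add_right]
    rw [mul_left_comm, ← key, Finset.mul_sum]
    refine Finset.sum_congr rfl fun σ _ => ?_
    rw [Finset.prod_filter, Fin.prod_univ_succ]
    simp only [Fin.val_zero, Nat.zero_lt_succ, if_true, Fin.val_succ, Nat.succ_lt_succ_iff,
      List.getD_cons_zero, List.getD_cons_succ, Equiv.Perm.decomposeFin_symm_apply_zero,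
      Equiv.Perm.decomposeFin_symm_apply_succ, Finset.prod_filter, Fin.prod_univ_succ,
      Fin.succ_lt_succ_iff, Fin.succ_pos, lt_irrefl, if_false, one_mul, Fin.not_lt_zero]
    rw [h0 σ]
    rfl

theorem oplus_div_ominus {K : Type*} [Field K] [Algebra Zbeta K] (a b : K) :
    oplus a b / ominus a b = rowRatio (betaIn K) a b := by
  rw [oplus, ominus, rowRatio, Ring.inverse_eq_inv', div_mul_eq_div_div_swap, div_inv_eq_mul]

theorem algebraMap_coeffRing_injective :
    Function.Injective (algebraMap (MvPolynomial ℕ Zbeta) CoeffRing) :=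
  IsLocalization.injective CoeffRing coeffSubmonoid_le

instance charZero_coeffRing : CharZero CoeffRing :=
  charZero_of_injective_algebraMap algebraMap_coeffRing_injective

theorem algebraMap_ratField_injective (n : ℕ) :
    Function.Injective (algebraMap (MvPolynomial (Fin n) CoeffRing) (RatField n)) :=
  IsFractionRing.injective _ _

instance charZero_ratField (n : ℕ) : CharZero (RatField n) :=
  charZero_of_injective_algebraMap (algebraMap_ratField_injective n)

theorem symmetrization_eq_rowSum (n : ℕ) (l : StrictPartition) (hl : l.length ≤ n)
    (p : RatField n → ℕ → RatField n) :
    symmetrization n l p = rowSum (betaIn (RatField n)) ratX (fun _ => 1)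
      (l.parts.map fun k x => p x k) Finset.univ := by
  have h := sum_perm_prod_eq_rowSum (betaIn (RatField n)) (fun k x => p x k) l.parts n hl ratX
  rw [symmetrization]
  simp only [oplus_div_ominus]
  rw [inv_mul_eq_iff_eq_mul₀]
  · exact h
  · exact Nat.cast_ne_zero.2 (Nat.factorial_ne_zero _)

end Symmetrization

/-! ### Existence and uniqueness of GX_λ. -/

section GXFamilies

theorem setLastZero_map {A S : Type*} [CommRing A] [CommRing S] (φ : A →+* S) (n : ℕ)
    (f : MvPolynomial (Fin (n + 1)) A) :
    setLastZero S n (MvPolynomial.map φ f) = MvPolynomial.map φ (setLastZero A n f) := by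
  rw [← MvPolynomial.eval₂_eta (setLastZero S n _), eval₂_setLastZero, MvPolynomial.eval₂_map,
    setLastZero, MvPolynomial.aeval_def, MvPolynomial.hom_eval₂]
  congr 1
  · exact RingHom.ext fun r => by simp [MvPolynomial.algebraMap_eq]
  · funext k
    refine Fin.lastCases ?_ (fun i => ?_) k <;> simp

theorem GGammaR_le_GGammaRHat (X : LieType) : GGammaR X ≤ GGammaRHat X := by
  refine Submodule.span_le.2 ?_
  rintro F ⟨φ, hφ, hF⟩ n
  refine ⟨?_, Submodule.subset_span ⟨φ n, (hφ n).1, hF n⟩⟩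
  rw [hF, hF, setLastZero_map, (hφ n).2]

/-- Each component is a specialization of the later ones, so agreement at cofinally many levels
suffices; type D uses the even levels. -/
theorem eq_of_stable {F G : Family} (hF : ∀ n, setLastZero CoeffRing n (F (n + 1)) = F n)
    (hG : ∀ n, setLastZero CoeffRing n (G (n + 1)) = G n) (h : ∀ n, ∃ N ≥ n, F N = G N) :
    F = G := by
  funext n
  obtain ⟨N, hN, hFG⟩ := h n
  induction N, hN using Nat.le_induction with
  | base => exact hFG
  | succ m hm ih => exact ih (by rw [← hF, ← hG, hFG])

theorem IsGXLimit.unique {X : LieType} {l : StrictPartition} {F G : Family}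
    (hF : IsGXLimit X l F) (hG : IsGXLimit X l G) : F = G := by
  refine eq_of_stable (fun n => (GGammaR_le_GGammaRHat X hF.1 n).1)
    (fun n => (GGammaR_le_GGammaRHat X hG.1 n).1) fun n => ?_
  -- This level is at least n, at least the length of λ, and even.
  refine ⟨2 * (n + l.length), by omega, algebraMap_ratField_injective _ ?_⟩
  have h1 := hF.2 (2 * (n + l.length)) (by omega)
  have h2 := hG.2 (2 * (n + l.length)) (by omega)
  cases X
  · exact h1.trans h2.symm
  · exact h1.trans h2.symm
  · exact (h1.1 (even_two_mul _)).trans (h2.1 (even_two_mul _)).symm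

/-- The number of factors in a row of length `k` is `k - rowShift`, besides `rowDivisor`. -/
def rowShift : LieType → ℕ
  | LieType.D => 0
  | _ => 1

/-- The row `p(x, k)` of `GX_λ` as a polynomial in `x` over `R`. -/
noncomputable def gxRow (X : LieType) (k : ℕ) : Polynomial CoeffRing :=
  (rowDivisor X).map (algebraMap Zbeta CoeffRing) * ∏ m ∈ Finset.range (k - rowShift X),
    (Polynomial.X + Polynomial.C (bInt ((m : ℤ) + 1)) +
      Polynomial.C (betaIn CoeffRing) * Polynomial.X * Polynomial.C (bInt ((m : ℤ) + 1)))

theorem eval₂_gxRow {K : Type*} [CommRing K] (f : CoeffRing →+* K) (X : LieType) (k : ℕ) (a : K) :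
    (gxRow X k).eval₂ f a = ((rowDivisor X).map (algebraMap Zbeta CoeffRing)).eval₂ f a *
      ∏ m ∈ Finset.range (k - rowShift X), (a + f (bInt ((m : ℤ) + 1)) +
        f (betaIn CoeffRing) * a * f (bInt ((m : ℤ) + 1))) := by
  rw [gxRow, Polynomial.eval₂_mul, Polynomial.eval₂_finsetProd]
  simp

theorem eval₂_rowDivisor_B {K : Type*} [CommRing K] (f : CoeffRing →+* K) (a : K) :
    ((rowDivisor LieType.B).map (algebraMap Zbeta CoeffRing)).eval₂ f a = a := by
  simp [rowDivisor]

theorem eval₂_rowDivisor_C {K : Type*} [CommRing K] (f : CoeffRing →+* K) (a : K) :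
    ((rowDivisor LieType.C).map (algebraMap Zbeta CoeffRing)).eval₂ f a =
      a + a + f (betaIn CoeffRing) * a * a := by
  have : ((rowDivisor LieType.C).map (algebraMap Zbeta CoeffRing)) = Polynomial.X *
      (2 + Polynomial.C (betaIn CoeffRing) * Polynomial.X) := by
    rw [rowDivisor, Polynomial.map_mul, Polynomial.map_add, Polynomial.map_mul, Polynomial.map_X,
      Polynomial.map_C, Polynomial.map_ofNat]
    rfl
  rw [this, Polynomial.eval₂_mul, Polynomial.eval₂_add, Polynomial.eval₂_mul, Polynomial.eval₂_X,
    Polynomial.eval₂_C, Polynomial.eval₂_ofNat]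
  ring

theorem eval₂_rowDivisor_D {K : Type*} [CommRing K] (f : CoeffRing →+* K) (a : K) :
    ((rowDivisor LieType.D).map (algebraMap Zbeta CoeffRing)).eval₂ f a = 1 := by
  simp [rowDivisor]

/-- The rows of `GX_λ`. -/
noncomputable def gxRows (X : LieType) (l : List ℕ) : List (Polynomial CoeffRing) :=
  l.map (gxRow X)

theorem ratX_injective (n : ℕ) : Function.Injective (ratX : Fin n → RatField n) :=
  (algebraMap_ratField_injective n).comp MvPolynomial.X_injective

theorem algebraMap_ratField_eq_eval₂ {n : ℕ} (P : MvPolynomial (Fin n) CoeffRing) :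
    algebraMap (MvPolynomial (Fin n) CoeffRing) (RatField n) P =
      P.eval₂ ((algebraMap (MvPolynomial (Fin n) CoeffRing) (RatField n)).comp MvPolynomial.C)
        ratX := by
  nth_rw 1 [← MvPolynomial.eval₂_eta P]
  rw [MvPolynomial.hom_eval₂]
  rfl

theorem evalRows_gxRows {n : ℕ} {X : LieType} (l : StrictPartition)
    (p : RatField n → ℕ → RatField n)
    (h : ∀ k, 0 < k → ∀ a, (gxRow X k).eval₂ ((algebraMap (MvPolynomial (Fin n) CoeffRing)
      (RatField n)).comp MvPolynomial.C) a = p a k) :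
    evalRows ((algebraMap (MvPolynomial (Fin n) CoeffRing) (RatField n)).comp MvPolynomial.C)
      (gxRows X l.parts) = l.parts.map fun k x => p x k := by
  rw [evalRows, gxRows, List.map_map]
  refine List.map_congr_left fun k hk => ?_
  funext a
  exact h k (l.pos k hk) a

theorem IsRowFamily.representsRat {X : LieType} {l : StrictPartition} {F : Family}
    (hF : IsRowFamily X (gxRows X l.parts) F) {n : ℕ} (hn : X = LieType.D → Even n)
    (hl : l.length ≤ n) (p : RatField n → ℕ → RatField n)
    (h : ∀ k, 0 < k → ∀ a, (gxRow X k).eval₂ ((algebraMap (MvPolynomial (Fin n) CoeffRing)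
      (RatField n)).comp MvPolynomial.C) a = p a k) :
    RepresentsRat (F n) (symmetrization n l p) := by
  rw [RepresentsRat, algebraMap_ratField_eq_eval₂, hF n hn _ _ _ (ratX_injective n),
    evalRows_gxRows l p h, symmetrization_eq_rowSum n l hl]
  rfl

theorem IsRowFamily.isGXLimit {X : LieType} {l : StrictPartition} {F : Family}
    (hF : F ∈ GGammaR X) (hF' : IsRowFamily X (gxRows X l.parts) F) : IsGXLimit X l F := by
  refine ⟨hF, fun n hn => ?_⟩
  cases X
  · refine hF'.representsRat (fun h => by cases h) hn _ fun k hk a => ?_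
    obtain ⟨k, rfl⟩ : ∃ j, k = j + 1 := ⟨k - 1, by omega⟩
    -- In type B the first parameter is 0, so the first factor x ⊕ 0 = x is the divisor, and k - 1
    -- factors with b_1, …, b_{k-1} are left.
    rw [eval₂_gxRow, eval₂_rowDivisor_B, factorialPow, Finset.prod_range_succ', mul_comm]
    congr 1
    simp [oplus, ratBShift]
  · refine hF'.representsRat (fun h => by cases h) hn _ fun k hk a => ?_
    rw [eval₂_gxRow, eval₂_rowDivisor_C, factorialPow']
    rfl
  · have key : ∀ m, l.length ≤ m → Even m → RepresentsRat (F m) (ratGP m l (ratB m)) := by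
      intro m hm he
      refine hF'.representsRat (fun _ => he) hm _ fun k hk a => ?_
      rw [eval₂_gxRow, eval₂_rowDivisor_D, factorialPow, one_mul]
      rfl
    refine ⟨key n hn, fun ho => ⟨F (n + 1), key _ (by omega) ho.add_one, ?_⟩⟩
    exact ((GGammaR_le_GGammaRHat _ hF n).1).symm

theorem exists_isGXLimit (X : LieType) (l : StrictPartition) :
    ∃ F, IsGXLimit X l F ∧ IsRowFamily X (gxRows X l.parts) F := by
  obtain ⟨F, h1, h2⟩ := exists_rowFamily X (gxRows X l.parts) fun p hp => by
    obtain ⟨k, -, rfl⟩ := List.mem_map.1 hp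
    exact dvd_mul_right _ _
  exact ⟨F, h2.isGXLimit h1, h2⟩

theorem isGXLimit_GX (X : LieType) (l : StrictPartition) : IsGXLimit X l (GX X l) :=
  Classical.epsilon_spec ((exists_isGXLimit X l).imp fun _ h => h.1)

theorem isRowFamily_GX (X : LieType) (l : StrictPartition) :
    IsRowFamily X (gxRows X l.parts) (GX X l) := by
  obtain ⟨F, h1, h2⟩ := exists_isGXLimit X l
  rwa [(isGXLimit_GX X l).unique h1]

theorem GX_mem_GGammaRHat (X : LieType) (l : StrictPartition) : GX X l ∈ GGammaRHat X :=
  GGammaR_le_GGammaRHat X (isGXLimit_GX X l).1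

end GXFamilies

/-! ### The action on R is trivial modulo e(α_i). -/

section CoefficientAction

theorem bInt_natCast_succ (m : ℕ) : bInt ((m : ℤ) + 1) =
    algebraMap (MvPolynomial ℕ Zbeta) CoeffRing (MvPolynomial.X m) := rfl

theorem bInt_oplus_neg (k : ℤ) :
    bInt k + bInt (-k) + betaIn CoeffRing * bInt k * bInt (-k) = 0 := by
  have key : ∀ m : ℕ, bInt ((m : ℤ) + 1) + bInt (Int.negSucc m) +
      betaIn CoeffRing * bInt ((m : ℤ) + 1) * bInt (Int.negSucc m) = 0 := by
    intro m
    have h2 := Ring.inverse_mul_cancel _ (isUnit_one_add_gen m)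
    rw [bInt_natCast_succ]
    simp only [bInt, ominus]
    linear_combination
      (-(algebraMap (MvPolynomial ℕ Zbeta) CoeffRing (MvPolynomial.X m))) * h2
  match k with
  | Int.ofNat 0 => simp [bInt]
  | Int.ofNat (m + 1) => exact key m
  | Int.negSucc m =>
    have := key m
    rw [Int.neg_negSucc]
    push_cast
    linear_combination this

theorem eq_of_oplus_eq_zero {A : Type*} [CommRing A] {β a x x' : A} (hu : IsUnit (1 + β * a))
    (h : a + x + β * a * x = 0) (h' : a + x' + β * a * x' = 0) : x = x' :=
  hu.mul_left_cancel (by linear_combination h - h')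

theorem weylCoeff_algebraMap (w : Equiv.Perm ℤ) (r : Zbeta) :
    weylCoeff w (algebraMap Zbeta CoeffRing r) = algebraMap Zbeta CoeffRing r := by
  change weylCoeff w (algebraMap (MvPolynomial ℕ Zbeta) CoeffRing (MvPolynomial.C r)) = _
  rw [weylCoeff, IsLocalization.lift_eq]
  simp

theorem weylCoeff_beta (w : Equiv.Perm ℤ) :
    weylCoeff w (betaIn CoeffRing) = betaIn CoeffRing := weylCoeff_algebraMap w _

theorem weylCoeff_bInt_pos (w : Equiv.Perm ℤ) (m : ℕ) :
    weylCoeff w (bInt ((m : ℤ) + 1)) = bInt (w ((m : ℤ) + 1)) := by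
  rw [bInt_natCast_succ, weylCoeff, IsLocalization.lift_eq]
  simp

theorem weylCoeff_bInt {w : Equiv.Perm ℤ} (hw : ∀ k, w (-k) = -w k) (k : ℤ) :
    weylCoeff w (bInt k) = bInt (w k) := by
  match k with
  | Int.ofNat 0 =>
    have : w 0 = 0 := by have := hw 0; simp at this; omega
    change weylCoeff w 0 = bInt (w 0)
    rw [this, map_zero]
    rfl
  | Int.ofNat (m + 1) => exact weylCoeff_bInt_pos w m
  | Int.negSucc m =>
    have h1 := congrArg (weylCoeff w) (bInt_oplus_neg ((m : ℤ) + 1))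
    simp only [map_add, map_mul, map_zero, weylCoeff_beta, weylCoeff_bInt_pos] at h1
    have h2 := bInt_oplus_neg (w ((m : ℤ) + 1))
    rw [← hw] at h2
    rw [show Int.negSucc m = -((m : ℤ) + 1) by omega]
    exact eq_of_oplus_eq_zero (isUnit_one_add_bInt _) h1 h2

/-- Modulo I, the map ψ and the identity are two ring homomorphisms out of a localization of a
polynomial ring, so they coincide once they agree on scalars and variables. -/
theorem ringHom_sub_mem {I : Ideal CoeffRing} {ψ : CoeffRing →+* CoeffRing}
    (h0 : ∀ r, ψ (algebraMap Zbeta CoeffRing r) = algebraMap Zbeta CoeffRing r)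
    (h : ∀ m : ℕ, ψ (bInt ((m : ℤ) + 1)) - bInt ((m : ℤ) + 1) ∈ I) (c : CoeffRing) :
    ψ c - c ∈ I := by
  rw [← Ideal.Quotient.eq]
  have : (Ideal.Quotient.mk I).comp ψ = Ideal.Quotient.mk I := by
    refine IsLocalization.ringHom_ext coeffSubmonoid (MvPolynomial.ringHom_ext (fun r => ?_)
      fun m => ?_)
    · exact congrArg _ (h0 r)
    · exact Ideal.Quotient.eq.2 (h m)
  exact DFunLike.congr_fun this c

theorem signedGen_zero_apply (k : ℤ) :
    signedGen 0 k = if k = 1 then -1 else if k = -1 then 1 else k := by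
  rw [signedGen, Equiv.swap_apply_def]

theorem signedGen_succ_apply (i : ℕ) (k : ℤ) :
    signedGen (i + 1) k = if k = i + 1 then (i : ℤ) + 2 else if k = i + 2 then (i : ℤ) + 1 else
      if k = -(i + 1) then -((i : ℤ) + 2) else if k = -(i + 2) then -((i : ℤ) + 1) else k := by
  rw [signedGen, Equiv.Perm.mul_apply, Equiv.swap_apply_def, Equiv.swap_apply_def]
  split_ifs <;> omega

theorem signedGen_neg (i : ℕ) (k : ℤ) : signedGen i (-k) = -signedGen i k := by
  cases i with
  | zero => rw [signedGen_zero_apply, signedGen_zero_apply]; split_ifs <;> omega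
  | succ i => rw [signedGen_succ_apply, signedGen_succ_apply]; split_ifs <;> omega

/-- The action of `s_i` of type `X` on the coefficients. -/
noncomputable def coeffAct : LieType → ℕ → (CoeffRing →+* CoeffRing)
  | LieType.D, 0 => (weylCoeff (signedGen 0)).comp
      ((weylCoeff (signedGen 1)).comp (weylCoeff (signedGen 0)))
  | _, i => weylCoeff (signedGen i)

theorem coeffAct_algebraMap (X : LieType) (i : ℕ) (r : Zbeta) :
    coeffAct X i (algebraMap Zbeta CoeffRing r) = algebraMap Zbeta CoeffRing r := by
  cases X <;> cases i <;> simp [coeffAct, weylCoeff_algebraMap]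

theorem coeffAct_succ (X : LieType) (i : ℕ) :
    coeffAct X (i + 1) = weylCoeff (signedGen (i + 1)) := by
  cases X <;> rfl

theorem coeffAct_D_zero_bInt (k : ℤ) :
    coeffAct LieType.D 0 (bInt k) = bInt (simpleRefl LieType.D 0 k) := by
  simp only [coeffAct, RingHom.comp_apply, weylCoeff_bInt (signedGen_neg _)]
  rfl

theorem simpleRefl_D_zero_apply (k : ℤ) : simpleRefl LieType.D 0 k =
    if k = 1 then -2 else if k = 2 then -1 else if k = -1 then 2 else if k = -2 then 1 else k := by
  change signedGen 0 (signedGen (0 + 1) (signedGen 0 k)) = _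
  rw [signedGen_zero_apply, signedGen_succ_apply, signedGen_zero_apply]
  split_ifs <;> simp at * <;> omega

theorem coeffAct_bInt (X : LieType) (i : ℕ) (k : ℤ) :
    coeffAct X i (bInt k) = bInt (simpleRefl X i k) := by
  cases i with
  | succ i =>
    rw [coeffAct_succ, weylCoeff_bInt (signedGen_neg _)]
    cases X <;> rfl
  | zero =>
    cases X
    · exact (weylCoeff_bInt (signedGen_neg 0) k :)
    · exact (weylCoeff_bInt (signedGen_neg 0) k :)
    · exact coeffAct_D_zero_bInt k

theorem eRoot_succ_mul (X : LieType) (i : ℕ) :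
    eRoot X (i + 1) * (1 + betaIn CoeffRing * bInt ((i : ℤ) + 1)) =
      bInt ((i : ℤ) + 2) - bInt ((i : ℤ) + 1) := by
  have : eRoot X (i + 1) = ominus (bInt ((i : ℤ) + 2)) (bInt ((i : ℤ) + 1)) := by cases X <;> rfl
  rw [this, ominus, mul_assoc, Ring.inverse_mul_cancel _ (isUnit_one_add_bInt _), mul_one]

theorem eRoot_D_zero : eRoot LieType.D 0 =
    bInt 1 + bInt 2 + betaIn CoeffRing * bInt 1 * bInt 2 := rfl

theorem eRoot_C_zero : eRoot LieType.C 0 =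
    bInt 1 + bInt 1 + betaIn CoeffRing * bInt 1 * bInt 1 := rfl

theorem eRoot_ne_zero (X : LieType) (i : ℕ) : eRoot X i ≠ 0 := by
  have hb : ∀ m : ℕ, bInt ((m : ℤ) + 1) ≠ 0 := fun m => by
    rw [bInt_natCast_succ]
    exact (map_ne_zero_iff _ algebraMap_coeffRing_injective).2 (MvPolynomial.X_ne_zero m)
  have key : ∀ k l : ℕ, bInt ((k : ℤ) + 1) + bInt ((l : ℤ) + 1) +
      betaIn CoeffRing * bInt ((k : ℤ) + 1) * bInt ((l : ℤ) + 1) ≠ 0 := fun k l h => by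
    have h1 : algebraMap (MvPolynomial ℕ Zbeta) CoeffRing (MvPolynomial.X k + MvPolynomial.X l +
        MvPolynomial.C Polynomial.X * MvPolynomial.X k * MvPolynomial.X l) = 0 := by
      rw [map_add, map_add, map_mul, map_mul]
      exact h
    rw [map_eq_zero_iff _ algebraMap_coeffRing_injective] at h1
    have h2 := congrArg (MvPolynomial.eval₂ (Polynomial.evalRingHom (0 : ℤ)) fun _ => 1) h1
    simp at h2
  cases i with
  | succ i =>
    intro h
    have h1 := eRoot_succ_mul X i
    rw [h, zero_mul] at h1
    have h2 : bInt (((i + 1 : ℕ) : ℤ) + 1) = bInt ((i : ℤ) + 1) := by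
      rw [show (((i + 1 : ℕ) : ℤ) + 1) = (i : ℤ) + 2 by push_cast; ring]
      exact sub_eq_zero.1 h1.symm
    have h3 := MvPolynomial.X_injective (R := Zbeta) (algebraMap_coeffRing_injective h2)
    omega
  | zero =>
    cases X
    · exact hb 0
    · exact key 0 0
    · exact key 0 1

theorem mem_span_of_mul_unit {A : Type*} [CommRing A] {e x u : A} (hu : IsUnit u)
    (h : x * u ∈ Ideal.span {e}) : x ∈ Ideal.span {e} :=
  (Ideal.unit_mul_mem_iff_mem _ hu).1 (by rwa [mul_comm])

/-- Only the parameters b_m need checking. The ones moved by s_i change by e(α_i) up to sign and a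
unit factor 1 + β b_k, except in type B for i = 0, where b_1 and ⊖b_1 are both multiples of e(α_0) =
b_1. -/
theorem coeffAct_sub_mem (X : LieType) (i : ℕ) (c : CoeffRing) :
    coeffAct X i c - c ∈ Ideal.span {eRoot X i} := by
  refine ringHom_sub_mem (coeffAct_algebraMap X i) (fun m => ?_) c
  rw [coeffAct_bInt]
  have hmem : eRoot X i ∈ Ideal.span {eRoot X i} := Ideal.mem_span_singleton_self _
  cases i with
  | succ i =>
    have hs : simpleRefl X (i + 1) ((m : ℤ) + 1) = signedGen (i + 1) ((m : ℤ) + 1) := by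
      cases X <;> rfl
    have hd : bInt ((i : ℤ) + 2) - bInt ((i : ℤ) + 1) ∈ Ideal.span {eRoot X (i + 1)} := by
      rw [← eRoot_succ_mul]
      exact Ideal.mul_mem_right _ _ hmem
    rw [hs, signedGen_succ_apply]
    split_ifs with h1 h2 h3 h4
    · rwa [h1]
    · rw [h2, ← neg_sub]
      exact neg_mem hd
    · omega
    · omega
    · rw [sub_self]
      exact zero_mem _
  | zero =>
    cases X
    · change bInt (signedGen 0 _) - _ ∈ _
      rw [signedGen_zero_apply]
      split_ifs with h1 h2
      · rw [h1]
        refine sub_mem (mem_span_of_mul_unit (isUnit_one_add_bInt 1) ?_) hmem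
        have := bInt_oplus_neg 1
        rw [show bInt (-1) * (1 + betaIn CoeffRing * bInt 1) = -bInt 1 by
          linear_combination this]
        exact neg_mem hmem
      · omega
      · rw [sub_self]
        exact zero_mem _
    · change bInt (signedGen 0 _) - _ ∈ _
      rw [signedGen_zero_apply]
      split_ifs with h1 h2
      · rw [h1]
        refine mem_span_of_mul_unit (isUnit_one_add_bInt 1) ?_
        have := bInt_oplus_neg 1
        rw [show (bInt (-1) - bInt 1) * (1 + betaIn CoeffRing * bInt 1) = -eRoot LieType.C 0 by
          rw [eRoot_C_zero]; linear_combination this]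
        exact neg_mem hmem
      · omega
      · rw [sub_self]
        exact zero_mem _
    · rw [simpleRefl_D_zero_apply]
      split_ifs with h1 h2 h3 h4
      · rw [h1]
        refine mem_span_of_mul_unit (isUnit_one_add_bInt 2) ?_
        have := bInt_oplus_neg 2
        rw [show (bInt (-2) - bInt 1) * (1 + betaIn CoeffRing * bInt 2) = -eRoot LieType.D 0 by
          rw [eRoot_D_zero]; linear_combination this]
        exact neg_mem hmem
      · rw [h2]
        refine mem_span_of_mul_unit (isUnit_one_add_bInt 1) ?_
        have := bInt_oplus_neg 1
        rw [show (bInt (-1) - bInt 2) * (1 + betaIn CoeffRing * bInt 1) = -eRoot LieType.D 0 by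
          rw [eRoot_D_zero]; linear_combination this]
        exact neg_mem hmem
      · omega
      · omega
      · rw [sub_self]
        exact zero_mem _

end CoefficientAction

/-! ### The divided differences are well defined. -/

section DividedDifferences

open MvPolynomial

/-- The span of `GΓ_n` over the coefficient ring. -/
noncomputable def levelSpan (X : LieType) (n : ℕ) : Submodule CoeffRing (MvPolynomial (Fin n) CoeffRing) :=
  Submodule.span CoeffRing {f | ∃ φ : MvPolynomial (Fin n) Zbeta, IsGGammaOfType X n φ ∧
    f = MvPolynomial.map (algebraMap Zbeta CoeffRing) φ}

theorem mem_GGammaRHat {X : LieType} {F : Family} : F ∈ GGammaRHat X ↔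
    ∀ n, setLastZero CoeffRing n (F (n + 1)) = F n ∧ F n ∈ levelSpan X n := Iff.rfl

theorem EvalCancels.map_mem_levelSpan {X : LieType} {n : ℕ} {φ : MvPolynomial (Fin n) Zbeta}
    (h : EvalCancels X n φ) : MvPolynomial.map (algebraMap Zbeta CoeffRing) φ ∈ levelSpan X n :=
  Submodule.subset_span ⟨φ, h.isGGammaOfType, rfl⟩

theorem isSymmetric_of_mem_levelSpan {X : LieType} {n : ℕ} {f : MvPolynomial (Fin n) CoeffRing}
    (hf : f ∈ levelSpan X n) : f.IsSymmetric := by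
  refine Submodule.span_induction ?_ (MvPolynomial.IsSymmetric.zero) (fun _ _ _ _ => .add)
    (fun c _ _ h => h.smul c) hf
  rintro _ ⟨φ, hφ, rfl⟩
  exact hφ.evalCancels.1.map _

theorem EvalCancels.sub {X : LieType} {n : ℕ} {f g : MvPolynomial (Fin n) Zbeta}
    (hf : EvalCancels X n f) (hg : EvalCancels X n g) : EvalCancels X n (f - g) := by
  refine ⟨hf.1.sub hg.1, fun S _ _ _ φ y i j hij a a' ha => ?_, fun hX S _ _ _ φ y i c hc => ?_⟩
  · rw [eval₂_sub, eval₂_sub, hf.2.1 S φ y i j hij a a' ha, hg.2.1 S φ y i j hij a a' ha]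
  · rw [eval₂_sub, eval₂_sub, hf.2.2 hX S φ y i c hc, hg.2.2 hX S φ y i c hc]

theorem EvalCancels.C_mul {X : LieType} {n : ℕ} {f : MvPolynomial (Fin n) Zbeta}
    (hf : EvalCancels X n f) (r : Zbeta) : EvalCancels X n (C r * f) := by
  refine ⟨(MvPolynomial.IsSymmetric.C r).mul hf.1, fun S _ _ _ φ y i j hij a a' ha => ?_,
    fun hX S _ _ _ φ y i c hc => ?_⟩
  · rw [eval₂_mul, eval₂_mul, hf.2.1 S φ y i j hij a a' ha, eval₂_C, eval₂_C]
  · rw [eval₂_mul, eval₂_mul, hf.2.2 hX S φ y i c hc, eval₂_C, eval₂_C]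

/-- The conditions compare values in domains of characteristic zero, where the factor 2 cancels. -/
theorem EvalCancels.of_two_mul {X : LieType} {n : ℕ} {f : MvPolynomial (Fin n) Zbeta}
    (hf : EvalCancels X n (2 * f)) : EvalCancels X n f := by
  have h2 : ∀ (S : Type) [CommRing S] [IsDomain S] [CharZero S] (φ : Zbeta →+* S) (y z : Fin n → S),
      (2 * f).eval₂ φ y = (2 * f).eval₂ φ z → f.eval₂ φ y = f.eval₂ φ z := by
    intro S _ _ _ φ y z h
    rw [two_mul, eval₂_add, eval₂_add, ← two_mul, ← two_mul] at h
    exact mul_left_cancel₀ two_ne_zero h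
  refine ⟨fun e => ?_, fun S _ _ _ φ y i j hij a a' ha => h2 S φ _ _ (hf.2.1 S φ y i j hij a a' ha),
    fun hX S _ _ _ φ y i c hc => h2 S φ _ _ (hf.2.2 hX S φ y i c hc)⟩
  have := hf.1 e
  rw [map_mul, map_ofNat] at this
  exact mul_left_cancel₀ two_ne_zero this

theorem eval_mem_levelSpan {X : LieType} {n : ℕ} (q : Polynomial (MvPolynomial (Fin n) Zbeta))
    (hq : ∀ k, EvalCancels X n (q.coeff k)) (a : CoeffRing) :
    (q.map (MvPolynomial.map (algebraMap Zbeta CoeffRing))).eval (C a) ∈ levelSpan X n := by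
  rw [Polynomial.eval_eq_sum_range]
  refine Submodule.sum_mem _ fun k _ => ?_
  rw [Polynomial.coeff_map, ← map_pow, mul_comm, ← MvPolynomial.smul_eq_C_mul]
  exact Submodule.smul_mem _ _ (hq k).map_mem_levelSpan

theorem setFirst_map_eq_eval {n : ℕ} (a : CoeffRing) (φ : MvPolynomial (Fin (n + 1)) Zbeta) :
    setFirst n a (MvPolynomial.map (algebraMap Zbeta CoeffRing) φ) =
      ((finSuccEquiv Zbeta n φ).map (MvPolynomial.map (algebraMap Zbeta CoeffRing))).eval (C a) := by
  rw [setFirst_eq_eval, finSuccEquiv_map]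

theorem setFirst_zero_map {n : ℕ} (φ : MvPolynomial (Fin (n + 1)) Zbeta) :
    setFirst n 0 (MvPolynomial.map (algebraMap Zbeta CoeffRing) φ) =
      MvPolynomial.map (algebraMap Zbeta CoeffRing) ((finSuccEquiv Zbeta n φ).coeff 0) := by
  rw [setFirst_zero, finSuccEquiv_map, Polynomial.coeff_map]

theorem setFirst_mem_levelSpan {X : LieType} {n : ℕ} {φ : MvPolynomial (Fin (n + 1)) Zbeta}
    (hφ : EvalCancels X (n + 1) φ) (a : CoeffRing) :
    setFirst n a (MvPolynomial.map (algebraMap Zbeta CoeffRing) φ) ∈ levelSpan X n := by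
  rw [setFirst_map_eq_eval]
  exact eval_mem_levelSpan _ hφ.coeff a

/-- As a polynomial in the first variable, f(t) - f(0) is t times a polynomial whose coefficients
are coefficients of f, and these satisfy the cancellation conditions. -/
theorem exists_smul_eq_setFirst_sub_B {n : ℕ} {φ : MvPolynomial (Fin (n + 1)) Zbeta}
    (hφ : EvalCancels LieType.B (n + 1) φ) (a : CoeffRing) :
    ∃ g ∈ levelSpan LieType.B n, a • g = setFirst n a (MvPolynomial.map (algebraMap Zbeta CoeffRing) φ)
      - setFirst n 0 (MvPolynomial.map (algebraMap Zbeta CoeffRing) φ) := by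
  refine ⟨_, eval_mem_levelSpan (finSuccEquiv Zbeta n φ).divX (fun k => ?_) a, ?_⟩
  · rw [Polynomial.coeff_divX]
    exact hφ.coeff _
  · rw [setFirst_map_eq_eval, setFirst_zero_map, MvPolynomial.smul_eq_C_mul, eq_sub_iff_add_eq]
    have h := congrArg (fun p => (p.map (MvPolynomial.map (algebraMap Zbeta CoeffRing))).eval (C a))
      (Polynomial.divX_mul_X_add (finSuccEquiv Zbeta n φ))
    simp only [Polynomial.map_add, Polynomial.map_mul, Polynomial.map_C, Polynomial.map_X,
      Polynomial.eval_add, Polynomial.eval_mul, Polynomial.eval_C, Polynomial.eval_X] at h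
    rw [← h, mul_comm]

theorem finSuccEquiv_eq_of_isGGammaPlus {n : ℕ} {φ : MvPolynomial (Fin (n + 1)) Zbeta}
    (hφ : IsGGammaPlus (n + 1) φ) : ∃ q : Polynomial (MvPolynomial (Fin n) Zbeta),
      finSuccEquiv Zbeta n φ = Polynomial.C ((finSuccEquiv Zbeta n φ).coeff 0) +
        (2 * Polynomial.X + Polynomial.C (C Polynomial.X) * Polynomial.X * Polynomial.X) * q := by
  obtain ⟨q, hq⟩ := hφ.2 0 rfl
  refine ⟨finSuccEquiv Zbeta n q, ?_⟩
  have h1 : aeval (fun k : Fin (n + 1) => if k = 0 then 0 else MvPolynomial.X k) φ =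
      rename Fin.succ (setFirst n (0 : Zbeta) φ) := by
    rw [← AlgHom.comp_apply]
    congr 1
    refine MvPolynomial.algHom_ext fun k => ?_
    refine Fin.cases ?_ (fun i => ?_) k <;> simp [setFirst]
  have h2 : ∀ p : MvPolynomial (Fin n) Zbeta, finSuccEquiv Zbeta n (rename Fin.succ p) =
      Polynomial.C p := fun p => by
    rw [finSuccEquiv_apply, coe_eval₂Hom, eval₂_rename, ← coe_eval₂Hom]
    refine DFunLike.congr_fun (f := eval₂Hom _ _) (g := Polynomial.C) ?_ p
    refine MvPolynomial.ringHom_ext (fun r => ?_) (fun k => ?_) <;> simp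
  have h3 := congrArg (finSuccEquiv Zbeta n) hq
  rw [h1, map_sub, h2, setFirst_zero, map_mul] at h3
  have h4 : finSuccEquiv Zbeta n (oplus (X 0) (X 0)) =
      2 * Polynomial.X + Polynomial.C (C Polynomial.X) * Polynomial.X * Polynomial.X := by
    rw [oplus, betaIn, algebraMap_eq]
    simp only [map_add, map_mul, finSuccEquiv_X_zero]
    rw [two_mul]
    congr 3
    simp [finSuccEquiv_apply]
  rw [h4] at h3
  rw [← h3]
  ring

/-- Write f(t) - f(0) = (t ⊕ t) q(t). Comparing coefficients gives 2 q_0 = f_1 and 2 q_{k+1} =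
f_{k+2} - β q_k, so the coefficients of q lie in the ring by recursion, the factor 2 being harmless.
-/
theorem exists_smul_eq_setFirst_sub_C {n : ℕ} {φ : MvPolynomial (Fin (n + 1)) Zbeta}
    (hφ : IsGGammaOfType LieType.C (n + 1) φ) (a : CoeffRing) :
    ∃ g ∈ levelSpan LieType.C n, (a + a + betaIn CoeffRing * a * a) • g =
      setFirst n a (MvPolynomial.map (algebraMap Zbeta CoeffRing) φ)
      - setFirst n 0 (MvPolynomial.map (algebraMap Zbeta CoeffRing) φ) := by
  obtain ⟨q, hq⟩ := finSuccEquiv_eq_of_isGGammaPlus hφ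
  have hP := hφ.evalCancels.coeff
  have hrec : ∀ k, EvalCancels LieType.C n (q.coeff k) := by
    intro k
    refine EvalCancels.of_two_mul ?_
    induction k with
    | zero =>
      have h0 := congrArg (fun p => p.coeff 1) hq
      have : 2 * q.coeff 0 = (finSuccEquiv Zbeta n φ).coeff 1 := by
        rw [h0, show (2 * Polynomial.X + Polynomial.C (C Polynomial.X) * Polynomial.X * Polynomial.X) * q
          = (Polynomial.C 2 * q + (Polynomial.C (C Polynomial.X) * q) * Polynomial.X) * Polynomial.X by
            rw [Polynomial.C_ofNat]; ring, Polynomial.coeff_add, Polynomial.coeff_mul_X]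
        simp [Polynomial.coeff_C]
      rw [this]
      exact hP 1
    | succ k ih =>
      have h0 := congrArg (fun p => p.coeff (k + 2)) hq
      have : 2 * q.coeff (k + 1) = (finSuccEquiv Zbeta n φ).coeff (k + 2) -
          C Polynomial.X * q.coeff k := by
        rw [h0, show (2 * Polynomial.X + Polynomial.C (C Polynomial.X) * Polynomial.X * Polynomial.X) * q
          = (Polynomial.C 2 * q + (Polynomial.C (C Polynomial.X) * q) * Polynomial.X) * Polynomial.X by
            rw [Polynomial.C_ofNat]; ring, Polynomial.coeff_add, Polynomial.coeff_mul_X,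
            Polynomial.coeff_add, Polynomial.coeff_mul_X, Polynomial.coeff_C_mul,
            Polynomial.coeff_C_mul, Polynomial.coeff_C]
        simp
      rw [this]
      exact (hP _).sub (ih.of_two_mul.C_mul _)
  refine ⟨_, eval_mem_levelSpan q hrec a, ?_⟩
  rw [setFirst_map_eq_eval, setFirst_zero_map, MvPolynomial.smul_eq_C_mul, eq_sub_iff_add_eq]
  conv_rhs => rw [hq]
  simp only [betaIn, Polynomial.map_add, Polynomial.map_mul, Polynomial.map_C, Polynomial.map_X,
    Polynomial.eval_add, Polynomial.eval_mul, Polynomial.eval_C, Polynomial.eval_X, map_C, C_add,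
    C_mul, Polynomial.map_ofNat, Polynomial.eval_ofNat]
  ring

theorem setFirst_setFirst_of_oplus {X : LieType} {n : ℕ} {φ : MvPolynomial (Fin (n + 2)) Zbeta}
    (hφ : EvalCancels X (n + 2) φ) {a c : CoeffRing} (h : c + a + betaIn CoeffRing * c * a = 0) :
    setFirst n a (setFirst (n + 1) c (MvPolynomial.map (algebraMap Zbeta CoeffRing) φ)) =
      setFirst n 0 (setFirst (n + 1) 0 (MvPolynomial.map (algebraMap Zbeta CoeffRing) φ)) := by
  have := charZero_coeffRing
  rw [← eval₂_eta (setFirst n a _), ← eval₂_eta (setFirst n 0 _)]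
  simp only [eval₂_setFirst, eval₂_map]
  have key := hφ.2.1 (MvPolynomial (Fin n) CoeffRing) (C.comp (algebraMap Zbeta CoeffRing))
    (Fin.cons 0 (Fin.cons 0 MvPolynomial.X)) 0 1 (by simp) (C c) (C a) (by
      rw [RingHom.comp_apply, ← C_mul, ← C_mul, ← C_add, ← C_add, ← C_0]
      exact congrArg _ h)
  have hu : ∀ u v : MvPolynomial (Fin n) CoeffRing,
      Function.update (Function.update (Fin.cons 0 (Fin.cons 0 MvPolynomial.X) :
        Fin (n + 2) → MvPolynomial (Fin n) CoeffRing) 0 u) 1 v = Fin.cons u (Fin.cons v MvPolynomial.X) := by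
    intro u v
    rw [Fin.update_cons_zero, show (1 : Fin (n + 2)) = Fin.succ 0 from rfl, ← Fin.cons_update,
      Fin.update_cons_zero]
  rw [hu, hu] at key
  simpa using key

/-- By cancellation f(0, 0, …) = f(c, a, …) with c = ⊖a, so only the variable carrying b varies. Its
powers change by multiples of b - c, and (b - c)(1 + βa) = a ⊕ b. -/
theorem exists_smul_eq_setFirst_sub_D {X : LieType} {n : ℕ} {φ : MvPolynomial (Fin (n + 2)) Zbeta}
    (hφ : EvalCancels X (n + 2) φ) {a b : CoeffRing} (hu : IsUnit (1 + betaIn CoeffRing * a))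
    {c : CoeffRing} (h : c + a + betaIn CoeffRing * c * a = 0) :
    ∃ g ∈ levelSpan X n, (a + b + betaIn CoeffRing * a * b) • g =
      setFirst n a (setFirst (n + 1) b (MvPolynomial.map (algebraMap Zbeta CoeffRing) φ))
      - setFirst n 0 (setFirst (n + 1) 0 (MvPolynomial.map (algebraMap Zbeta CoeffRing) φ)) := by
  obtain ⟨u, hu'⟩ := hu.exists_right_inv
  have hk : ∀ k : ℕ, ∃ d, b ^ k - c ^ k = (a + b + betaIn CoeffRing * a * b) * d := fun k => by
    obtain ⟨d, hd⟩ := sub_dvd_pow_sub_pow b c k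
    refine ⟨u * d, ?_⟩
    rw [hd]
    linear_combination (-(b - c) * d) * hu' - h * u * d
  choose d hd using hk
  set P := finSuccEquiv Zbeta (n + 1) φ with hP
  have hexp : ∀ x : CoeffRing,
      setFirst n a (setFirst (n + 1) x (MvPolynomial.map (algebraMap Zbeta CoeffRing) φ)) =
      ∑ k ∈ Finset.range (P.natDegree + 1),
        x ^ k • setFirst n a (MvPolynomial.map (algebraMap Zbeta CoeffRing) (P.coeff k)) := fun x => by
    rw [setFirst_map_eq_eval, Polynomial.eval_map, Polynomial.eval₂_eq_sum_range, map_sum]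
    refine Finset.sum_congr rfl fun k _ => ?_
    rw [← map_pow, mul_comm, ← MvPolynomial.smul_eq_C_mul, map_smul]
  refine ⟨∑ k ∈ Finset.range (P.natDegree + 1),
    d k • setFirst n a (MvPolynomial.map (algebraMap Zbeta CoeffRing) (P.coeff k)),
    Submodule.sum_mem _ fun k _ => Submodule.smul_mem _ _ (setFirst_mem_levelSpan (hφ.coeff k) a), ?_⟩
  rw [← setFirst_setFirst_of_oplus hφ h, hexp, hexp, ← Finset.sum_sub_distrib, Finset.smul_sum]
  refine Finset.sum_congr rfl fun k _ => ?_
  rw [smul_smul, ← hd, sub_smul]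

theorem coeffAct_comp_algebraMap (X : LieType) (i : ℕ) :
    (coeffAct X i).comp (algebraMap Zbeta CoeffRing) = algebraMap Zbeta CoeffRing :=
  RingHom.ext fun r => coeffAct_algebraMap X i r

/-- Twisted Leibniz rule: T(cf) - Z(cf) = s_i(c)(T f - Z f) + (s_i(c) - c) Z f. Both terms are
divisible by e(α_i), so divisibility passes from elements over ℤ[β] to their R-span. Here T is the
action of s_i and Z puts zeros where T substitutes parameters. -/
theorem exists_smul_eq_of_generators (X : LieType) (i : ℕ) {N n : ℕ}
    (T : MvPolynomial (Fin N) CoeffRing →+* MvPolynomial (Fin n) CoeffRing)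
    (hT : ∀ c, T (C c) = C (coeffAct X i c))
    (Z : MvPolynomial (Fin N) CoeffRing →ₐ[CoeffRing] MvPolynomial (Fin n) CoeffRing)
    (h : ∀ φ, IsGGammaOfType X N φ →
      Z (MvPolynomial.map (algebraMap Zbeta CoeffRing) φ) ∈ levelSpan X n ∧
      ∃ g ∈ levelSpan X n, eRoot X i • g = T (MvPolynomial.map (algebraMap Zbeta CoeffRing) φ) -
        Z (MvPolynomial.map (algebraMap Zbeta CoeffRing) φ))
    {f : MvPolynomial (Fin N) CoeffRing} (hf : f ∈ levelSpan X N) :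
    ∃ g ∈ levelSpan X n, eRoot X i • g = T f - Z f := by
  refine (Submodule.span_induction (p := fun f _ => Z f ∈ levelSpan X n ∧
    ∃ g ∈ levelSpan X n, eRoot X i • g = T f - Z f) ?_ ?_ ?_ ?_ hf).2
  · rintro _ ⟨φ, hφ, rfl⟩
    exact h φ hφ
  · exact ⟨by rw [map_zero]; exact zero_mem _, 0, zero_mem _, by simp⟩
  · rintro f f' _ _ ⟨h1, g, hg, he⟩ ⟨h1', g', hg', he'⟩
    refine ⟨by rw [map_add]; exact add_mem h1 h1', g + g', add_mem hg hg', ?_⟩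
    rw [smul_add, he, he', map_add, map_add]
    ring
  · rintro c f _ ⟨h1, g, hg, he⟩
    refine ⟨by rw [map_smul]; exact Submodule.smul_mem _ c h1, ?_⟩
    obtain ⟨d, hd⟩ := Ideal.mem_span_singleton.1 (coeffAct_sub_mem X i c)
    refine ⟨coeffAct X i c • g + d • Z f,
      add_mem (Submodule.smul_mem _ _ hg) (Submodule.smul_mem _ _ h1), ?_⟩
    rw [smul_add, smul_comm, he, smul_smul, ← hd, map_smul Z,
      MvPolynomial.smul_eq_C_mul f, map_mul, hT, MvPolynomial.smul_eq_C_mul,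
      MvPolynomial.smul_eq_C_mul, MvPolynomial.smul_eq_C_mul, C_sub]
    ring

theorem map_setFirst {n : ℕ} (ψ : CoeffRing →+* CoeffRing) (a : CoeffRing)
    (f : MvPolynomial (Fin (n + 1)) CoeffRing) :
    MvPolynomial.map ψ (setFirst n a f) = setFirst n (ψ a) (MvPolynomial.map ψ f) := by
  rw [← eval₂_eta (MvPolynomial.map ψ (setFirst n a f)), ← eval₂_eta (setFirst n (ψ a) _),
    eval₂_map, eval₂_setFirst, eval₂_setFirst, eval₂_map]
  rfl

theorem setLastZero_setFirst {n : ℕ} (a : CoeffRing) (f : MvPolynomial (Fin (n + 2)) CoeffRing) :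
    setLastZero CoeffRing n (setFirst (n + 1) a f) = setFirst n a (setLastZero CoeffRing (n + 1) f) := by
  rw [← eval₂_eta (setLastZero CoeffRing n _), ← eval₂_eta (setFirst n a _),
    eval₂_setLastZero, eval₂_setFirst, eval₂_setFirst, eval₂_setLastZero]
  congr 1
  exact Fin.cons_snoc_eq_snoc_cons _ _ _

theorem simpleReflAct_succ (X : LieType) (i : ℕ) (F : Family) (n : ℕ) :
    simpleReflAct X (i + 1) F n = MvPolynomial.map (coeffAct X (i + 1)) (F n) := by
  cases X <;> rfl

theorem simpleReflAct_B_zero (F : Family) (n : ℕ) : simpleReflAct LieType.B 0 F n =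
    setFirst n (bInt 1) (MvPolynomial.map (coeffAct LieType.B 0) (F (n + 1))) := rfl

theorem simpleReflAct_C_zero (F : Family) (n : ℕ) : simpleReflAct LieType.C 0 F n =
    setFirst n (bInt 1) (MvPolynomial.map (coeffAct LieType.C 0) (F (n + 1))) := rfl

theorem simpleReflAct_D_zero (F : Family) (n : ℕ) : simpleReflAct LieType.D 0 F n =
    setFirst n (bInt 1) (setFirst (n + 1) (bInt 2)
      (MvPolynomial.map (coeffAct LieType.D 0) (F (n + 2)))) := by
  have h : simpleReflAct LieType.D 0 F n = setFirst n (bInt 1)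
      (MvPolynomial.map (weylCoeff (signedGen 0)) (MvPolynomial.map (weylCoeff (signedGen 1))
        (setFirst (n + 1) (bInt 1) (MvPolynomial.map (weylCoeff (signedGen 0)) (F (n + 2)))))) := rfl
  -- The b_1 inserted by the inner s_0 becomes b_2 under s_1 and is fixed by the outer s_0, which
  -- inserts a new b_1.
  rw [h, map_setFirst, map_setFirst, MvPolynomial.map_map, MvPolynomial.map_map,
    weylCoeff_bInt (signedGen_neg 1), weylCoeff_bInt (signedGen_neg 0)]
  rfl

theorem setLastZero_signedGenAct {F : Family} (hF : ∀ n, setLastZero CoeffRing n (F (n + 1)) = F n)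
    (i n : ℕ) : setLastZero CoeffRing n (signedGenAct i F (n + 1)) = signedGenAct i F n := by
  cases i with
  | zero =>
    change setLastZero CoeffRing n (setFirst (n + 1) _ _) = setFirst n _ _
    rw [setLastZero_setFirst, setLastZero_map, hF]
  | succ i =>
    change setLastZero CoeffRing n (MvPolynomial.map _ _) = MvPolynomial.map _ _
    rw [setLastZero_map, hF]

theorem setLastZero_simpleReflAct {F : Family} (hF : ∀ n, setLastZero CoeffRing n (F (n + 1)) = F n)
    (X : LieType) (i n : ℕ) :
    setLastZero CoeffRing n (simpleReflAct X i F (n + 1)) = simpleReflAct X i F n := by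
  cases i with
  | succ i => cases X <;> exact setLastZero_signedGenAct hF (i + 1) n
  | zero =>
    cases X
    · exact setLastZero_signedGenAct hF 0 n
    · exact setLastZero_signedGenAct hF 0 n
    · exact setLastZero_signedGenAct (setLastZero_signedGenAct (setLastZero_signedGenAct hF 0) 1) 0 n

theorem exists_smul_eq_simpleReflAct_sub {X : LieType} {F : Family} (hF : F ∈ GGammaRHat X)
    (i n : ℕ) : ∃ g ∈ levelSpan X n, eRoot X i • g = simpleReflAct X i F n - F n := by
  have hF' := mem_GGammaRHat.1 hF
  -- By symmetry the last variable, set to zero by stability, may be taken to be the first, where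
  -- s_0 substitutes.
  have h1 : F n = setFirst n 0 (F (n + 1)) := by
    rw [← (hF' n).1, (isSymmetric_of_mem_levelSpan (hF' (n + 1)).2).setLastZero_eq]
  have h2 : F n = setFirst n 0 (setFirst (n + 1) 0 (F (n + 2))) := by
    rw [h1, ← (hF' (n + 1)).1, (isSymmetric_of_mem_levelSpan (hF' (n + 2)).2).setLastZero_eq]
  cases i with
  | succ i =>
    rw [simpleReflAct_succ]
    refine exists_smul_eq_of_generators X (i + 1) (MvPolynomial.map (coeffAct X (i + 1)))
      (MvPolynomial.map_C _) (AlgHom.id _ _) (fun φ hφ => ⟨hφ.evalCancels.map_mem_levelSpan, 0,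
        zero_mem _, ?_⟩) (hF' n).2
    rw [MvPolynomial.map_map, coeffAct_comp_algebraMap]
    simp
  | zero =>
    cases X
    · rw [simpleReflAct_B_zero]
      conv => enter [1, g, 2]; rw [h1]
      refine exists_smul_eq_of_generators LieType.B 0 ((setFirst n (bInt 1)).toRingHom.comp
        (MvPolynomial.map (coeffAct LieType.B 0))) (fun c => by simp [setFirst, algebraMap_eq])
        (setFirst n 0) (fun φ hφ => ⟨setFirst_mem_levelSpan hφ.evalCancels 0, ?_⟩) (hF' (n + 1)).2
      obtain ⟨g, hg, he⟩ := exists_smul_eq_setFirst_sub_B hφ.evalCancels (bInt 1)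
      refine ⟨g, hg, he.trans ?_⟩
      rw [RingHom.comp_apply, MvPolynomial.map_map,
        coeffAct_comp_algebraMap]
      rfl
    · rw [simpleReflAct_C_zero]
      conv => enter [1, g, 2]; rw [h1]
      refine exists_smul_eq_of_generators LieType.C 0 ((setFirst n (bInt 1)).toRingHom.comp
        (MvPolynomial.map (coeffAct LieType.C 0))) (fun c => by simp [setFirst, algebraMap_eq])
        (setFirst n 0) (fun φ hφ => ⟨setFirst_mem_levelSpan hφ.evalCancels 0, ?_⟩) (hF' (n + 1)).2
      obtain ⟨g, hg, he⟩ := exists_smul_eq_setFirst_sub_C hφ (bInt 1)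
      refine ⟨g, hg, he.trans ?_⟩
      rw [RingHom.comp_apply, MvPolynomial.map_map,
        coeffAct_comp_algebraMap]
      rfl
    · rw [simpleReflAct_D_zero]
      conv => enter [1, g, 2]; rw [h2]
      refine exists_smul_eq_of_generators LieType.D 0 ((setFirst n (bInt 1)).toRingHom.comp
        ((setFirst (n + 1) (bInt 2)).toRingHom.comp (MvPolynomial.map (coeffAct LieType.D 0))))
        (fun c => by simp [setFirst, algebraMap_eq])
        ((setFirst n 0).comp (setFirst (n + 1) 0)) (fun φ hφ => ?_) (hF' (n + 2)).2
      obtain ⟨g, hg, he⟩ := exists_smul_eq_setFirst_sub_D (b := bInt 2) hφ.evalCancels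
        (isUnit_one_add_bInt 1) (c := bInt (-1)) (by linear_combination bInt_oplus_neg 1)
      refine ⟨?_, g, hg, he.trans ?_⟩
      · rw [AlgHom.comp_apply, setFirst_zero (MvPolynomial.map _ φ), finSuccEquiv_map,
          Polynomial.coeff_map]
        exact setFirst_mem_levelSpan (hφ.evalCancels.coeff 0) 0
      · rw [RingHom.comp_apply, RingHom.comp_apply, MvPolynomial.map_map,
          coeffAct_comp_algebraMap]
        rfl

theorem family_smul_cancel {c : CoeffRing} (hc : c ≠ 0) {F G : Family} (h : c • F = c • G) :
    F = G := by
  funext n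
  have h1 := congrFun h n
  rw [Pi.smul_apply, Pi.smul_apply, MvPolynomial.smul_eq_C_mul, MvPolynomial.smul_eq_C_mul] at h1
  exact mul_left_cancel₀ (fun h0 => hc (C_eq_zero.1 h0)) h1

theorem exists_isDividedDifference {X : LieType} {F : Family} (hF : F ∈ GGammaRHat X) (i : ℕ) :
    ∃ G ∈ GGammaRHat X, IsDividedDifference X i F G := by
  choose g hg he using exists_smul_eq_simpleReflAct_sub hF i
  have hF' := mem_GGammaRHat.1 hF
  have heq : eRoot X i • (fun n => g n : Family) = simpleReflAct X i F - F := funext he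
  -- The operator is (s_i F - F)/e(α_i) - βF.
  refine ⟨(fun n => g n) - betaIn CoeffRing • F, sub_mem (mem_GGammaRHat.2 fun n => ⟨?_, hg n⟩)
    (Submodule.smul_mem _ _ hF), ?_⟩
  · have h1 := he (n + 1)
    have h2 := congrArg (setLastZero CoeffRing n) h1
    rw [map_smul, map_sub, setLastZero_simpleReflAct (fun n => (hF' n).1), (hF' n).1, ← he n,
      MvPolynomial.smul_eq_C_mul, MvPolynomial.smul_eq_C_mul] at h2
    exact mul_left_cancel₀ (fun h0 => eRoot_ne_zero X i (C_eq_zero.1 h0)) h2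
  · rw [IsDividedDifference, smul_sub, heq, add_smul, one_smul, smul_smul, mul_comm (betaIn _)]
    abel

theorem dividedDiff_spec {X : LieType} {F : Family} (hF : F ∈ GGammaRHat X) (i : ℕ) :
    dividedDiff X i F ∈ GGammaRHat X ∧ IsDividedDifference X i F (dividedDiff X i F) :=
  Classical.epsilon_spec (exists_isDividedDifference hF i)

theorem dividedDiff_eq {X : LieType} {F G : Family} (hF : F ∈ GGammaRHat X) {i : ℕ}
    (h : IsDividedDifference X i F G) : dividedDiff X i F = G :=
  family_smul_cancel (eRoot_ne_zero X i) ((dividedDiff_spec hF i).2.trans h.symm)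

end DividedDifferences

/-! ### Closed forms for one row, and the effect of s_i for i ≥ 1 on rows. -/

section RowIdentities

theorem StrictPartition.exists_append (l : StrictPartition) {k : ℕ} (hk : k ∈ l.parts) :
    ∃ pre post, l.parts = pre ++ k :: post ∧ (∀ j ∈ pre, k < j) ∧ ∀ j ∈ post, j < k := by
  obtain ⟨pre, post, h⟩ := List.append_of_mem hk
  have hd := l.decreasing
  rw [h, List.pairwise_append, List.pairwise_cons] at hd
  exact ⟨pre, post, h, fun j hj => hd.2.2 j hj k (by simp), hd.2.1.1⟩

theorem StrictPartition.exists_append_one (l : StrictPartition) (hk : 1 ∈ l.parts) :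
    ∃ pre, l.parts = pre ++ [1] ∧ ∀ j ∈ pre, 2 ≤ j := by
  obtain ⟨pre, post, h, h1, h2⟩ := l.exists_append hk
  refine ⟨pre, ?_, h1⟩
  rcases post with _ | ⟨a, post⟩
  · exact h
  · have := l.pos a (by simp [h])
    have := h2 a (by simp)
    omega

theorem StrictPartition.exists_append_pair (l : StrictPartition) {k : ℕ} (hk : k + 1 ∈ l.parts)
    (hk' : k ∈ l.parts) : ∃ pre post, l.parts = pre ++ (k + 1) :: k :: post ∧
      (∀ j ∈ pre, k + 1 < j) ∧ ∀ j ∈ post, j < k := by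
  obtain ⟨pre, post, h, h1, h2⟩ := l.exists_append hk
  have hd := l.decreasing
  rw [h, List.pairwise_append, List.pairwise_cons] at hd
  rw [h, List.mem_append, List.mem_cons] at hk'
  have hkp : k ∈ post := by
    rcases hk' with hk' | hk' | hk'
    · have := h1 k hk'
      omega
    · omega
    · exact hk'
  rcases post with _ | ⟨a, post⟩
  · simp at hkp
  · have ha := h2 a (by simp)
    have hp := (List.pairwise_cons.1 hd.2.1.2).1
    obtain rfl : a = k := by
      rcases List.mem_cons.1 hkp with rfl | hkp
      · rfl
      · have := hp k hkp
        omega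
    exact ⟨pre, post, h, h1, hp⟩

/-- The variables are distinct and avoid the zeros of the denominators. -/
structure IsGeneralPoint {K ι : Type*} [Field K] (β : K) (y : ι → K) : Prop where
  injective : Function.Injective y
  one_add_ne : ∀ k, 1 + β * y k ≠ 0
  ne_zero : ∀ k, y k ≠ 0
  two_add_ne : ∀ k, 2 + β * y k ≠ 0

theorem IsGenericSeq.isGeneralPoint {A K : Type*} [CommRing A] [Field K] {f : A →+* K} {b : A}
    {y : ℕ → K} (h : IsGenericSeq f b y) (n : ℕ) :
    IsGeneralPoint (f b) (fun i : Fin n => y i) :=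
  ⟨h.injective.comp Fin.val_injective, fun k => h.one_add_ne k, fun k => h.ne_zero k,
    fun k => h.two_add_ne k⟩

theorem IsGeneralPoint.cons {K : Type*} [Field K] {β : K} {n : ℕ} {y : Fin n → K}
    (h : IsGeneralPoint β y) {a : K} (ha : ∀ k, y k ≠ a) (h1 : 1 + β * a ≠ 0) (h0 : a ≠ 0)
    (h2 : 2 + β * a ≠ 0) : IsGeneralPoint β (Fin.cons a y : Fin (n + 1) → K) := by
  refine ⟨Fin.cons_injective_iff.2 ⟨?_, h.injective⟩, Fin.cases h1 h.one_add_ne,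
    Fin.cases h0 h.ne_zero, Fin.cases h2 h.two_add_ne⟩
  rintro ⟨k, hk⟩
  exact ha k hk

section Singleton

variable {K ι : Type*} [Field K] [CharZero K] [DecidableEq ι] {β : K} {y : ι → K}

theorem IsGeneralPoint.rowSum_one (h : IsGeneralPoint β y) (hβ : β ≠ 0) {s : Finset ι}
    (hs : Odd s.card) : rowSum β y (fun _ => 1) [fun _ => 1] s = 1 := by
  rw [rowSum_singleton s hβ h.injective.injOn (fun k _ => h.one_add_ne k) (fun k _ => h.ne_zero k)
    (fun k _ => h.two_add_ne k) (fun _ => 1) 1 0 0 (fun k _ => by ring), hs.neg_one_pow]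
  ring

theorem IsGeneralPoint.rowSum_id (h : IsGeneralPoint β y) (hβ : β ≠ 0) (s : Finset ι) :
    β * rowSum β y (fun _ => 1) [fun x => x] s = ∏ j ∈ s, (1 + β * y j) - 1 := by
  rw [rowSum_singleton s hβ h.injective.injOn (fun k _ => h.one_add_ne k) (fun k _ => h.ne_zero k)
    (fun k _ => h.two_add_ne k) (fun x => x) (-1 / β) (1 / β) 0 (fun k _ => by field_simp; ring)]
  field_simp
  ring

theorem IsGeneralPoint.rowSum_double (h : IsGeneralPoint β y) (hβ : β ≠ 0) (s : Finset ι) :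
    β * rowSum β y (fun _ => 1) [fun x => x + x + β * x * x] s =
      (∏ j ∈ s, (1 + β * y j)) ^ 2 - 1 := by
  rw [rowSum_singleton s hβ h.injective.injOn (fun k _ => h.one_add_ne k) (fun k _ => h.ne_zero k)
    (fun k _ => h.two_add_ne k) _ (-1 / β) 0 (1 / β) (fun k _ => by field_simp; ring)]
  field_simp
  ring

/-- In u = 1 + βx the row is ((1 + βc)u - 1)/β. For an even number of variables the parameter c
disappears from the closed form; for an odd number it stays as the factor 1 + βc. All the parity
phenomena of type D come from this. -/
theorem IsGeneralPoint.rowSum_oplus_even (h : IsGeneralPoint β y) (hβ : β ≠ 0) {s : Finset ι}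
    (hs : Even s.card) (c : K) : β * rowSum β y (fun _ => 1) [fun x => x + c + β * x * c] s =
      ∏ j ∈ s, (1 + β * y j) - 1 := by
  rw [rowSum_singleton s hβ h.injective.injOn (fun k _ => h.one_add_ne k) (fun k _ => h.ne_zero k)
    (fun k _ => h.two_add_ne k) _ (-1 / β) ((1 + β * c) / β) 0 (fun k _ => by field_simp; ring),
    hs.neg_one_pow]
  field_simp
  ring

theorem IsGeneralPoint.rowSum_oplus_odd (h : IsGeneralPoint β y) (hβ : β ≠ 0) {s : Finset ι}
    (hs : Odd s.card) (c : K) : β * rowSum β y (fun _ => 1) [fun x => x + c + β * x * c] s =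
      (1 + β * c) * ∏ j ∈ s, (1 + β * y j) - 1 := by
  rw [rowSum_singleton s hβ h.injective.injOn (fun k _ => h.one_add_ne k) (fun k _ => h.ne_zero k)
    (fun k _ => h.two_add_ne k) _ (-1 / β) ((1 + β * c) / β) 0 (fun k _ => by field_simp; ring),
    hs.neg_one_pow]
  field_simp
  ring

end Singleton

variable {K : Type*} [Field K] {ι : Type*} [DecidableEq ι]

theorem evalRows_gxRows_append (f : CoeffRing →+* K) (X : LieType) (l l' : List ℕ) :
    evalRows f (gxRows X (l ++ l')) = evalRows f (gxRows X l) ++ evalRows f (gxRows X l') := by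
  rw [gxRows, List.map_append, evalRows_append]
  rfl

theorem evalRows_gxRows_cons (f : CoeffRing →+* K) (X : LieType) (k : ℕ) (l : List ℕ) :
    evalRows f (gxRows X (k :: l)) =
      (fun a => (gxRow X k).eval₂ f a) :: evalRows f (gxRows X l) := rfl

theorem evalRows_gxRows_congr {f g : CoeffRing →+* K} {X : LieType} {l : List ℕ}
    (h : ∀ k ∈ l, ∀ a, (gxRow X k).eval₂ f a = (gxRow X k).eval₂ g a) :
    evalRows f (gxRows X l) = evalRows g (gxRows X l) := by
  rw [evalRows, evalRows, gxRows, List.map_map, List.map_map]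
  exact List.map_congr_left fun k hk => funext fun a => h k hk a

theorem coeffAct_beta (X : LieType) (i : ℕ) :
    coeffAct X i (betaIn CoeffRing) = betaIn CoeffRing := coeffAct_algebraMap X i _

theorem eval₂_gxRow_coeffAct (f : CoeffRing →+* K) (X : LieType) (i k : ℕ) (a : K) :
    (gxRow X k).eval₂ (f.comp (coeffAct X i)) a =
      ((rowDivisor X).map (algebraMap Zbeta CoeffRing)).eval₂ f a *
      ∏ m ∈ Finset.range (k - rowShift X), (a + f (bInt (simpleRefl X i ((m : ℤ) + 1))) +
        f (betaIn CoeffRing) * a * f (bInt (simpleRefl X i ((m : ℤ) + 1)))) := by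
  rw [eval₂_gxRow]
  simp only [RingHom.comp_apply, coeffAct_bInt, coeffAct_beta]
  congr 1
  rw [Polynomial.eval₂_map, Polynomial.eval₂_map, RingHom.comp_assoc, coeffAct_comp_algebraMap]

theorem simpleRefl_succ_apply (X : LieType) (i m : ℕ) :
    simpleRefl X (i + 1) ((m : ℤ) + 1) = ((Equiv.swap i (i + 1) m : ℕ) : ℤ) + 1 := by
  have : simpleRefl X (i + 1) = signedGen (i + 1) := by cases X <;> rfl
  rw [this, signedGen_succ_apply, Equiv.swap_apply_def]
  split_ifs <;> omega

/-- Unless the row uses exactly the first i + 1 parameters, the two exchanged ones are both present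
or both absent. -/
theorem eval₂_gxRow_coeffAct_succ_of_ne (f : CoeffRing →+* K) (X : LieType) {i k : ℕ}
    (hk : k ≠ i + 1 + rowShift X) (a : K) :
    (gxRow X k).eval₂ (f.comp (coeffAct X (i + 1))) a = (gxRow X k).eval₂ f a := by
  rw [eval₂_gxRow_coeffAct, eval₂_gxRow]
  congr 1
  refine Finset.prod_equiv (Equiv.swap i (i + 1)) (fun m => ?_) fun m _ => ?_
  · rw [Finset.mem_range, Finset.mem_range, Equiv.swap_apply_def]
    split_ifs <;> omega
  · rw [simpleRefl_succ_apply X i m]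

theorem eval₂_gxRow_coeffAct_succ_self (f : CoeffRing →+* K) (X : LieType) (i : ℕ) (a : K) :
    (gxRow X (i + 1 + rowShift X)).eval₂ (f.comp (coeffAct X (i + 1))) a =
      (gxRow X (i + rowShift X)).eval₂ f a * (a + f (bInt ((i : ℤ) + 2)) +
        f (betaIn CoeffRing) * a * f (bInt ((i : ℤ) + 2))) := by
  rw [eval₂_gxRow_coeffAct, eval₂_gxRow, Nat.add_sub_cancel, Nat.add_sub_cancel,
    Finset.prod_range_succ, ← mul_assoc, show simpleRefl X (i + 1) ((i : ℤ) + 1) = (i : ℤ) + 2 by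
      rw [simpleRefl_succ_apply, Equiv.swap_apply_left]; push_cast; ring]
  congr 2
  refine Finset.prod_congr rfl fun m hm => ?_
  rw [Finset.mem_range] at hm
  rw [simpleRefl_succ_apply, Equiv.swap_apply_of_ne_of_ne (by omega) (by omega)]

theorem eval₂_gxRow_succ (f : CoeffRing →+* K) (X : LieType) (i : ℕ) (a : K) :
    (gxRow X (i + 1 + rowShift X)).eval₂ f a =
      (gxRow X (i + rowShift X)).eval₂ f a * (a + f (bInt ((i : ℤ) + 1)) +
        f (betaIn CoeffRing) * a * f (bInt ((i : ℤ) + 1))) := by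
  rw [eval₂_gxRow, eval₂_gxRow, Nat.add_sub_cancel, Nat.add_sub_cancel,
    Finset.prod_range_succ, ← mul_assoc]

theorem evalRows_coeffAct_succ_of_notMem (f : CoeffRing →+* K) (X : LieType) (i : ℕ) {l : List ℕ}
    (h : i + 1 + rowShift X ∉ l) :
    evalRows (f.comp (coeffAct X (i + 1))) (gxRows X l) = evalRows f (gxRows X l) :=
  evalRows_gxRows_congr fun _ hk _ =>
    eval₂_gxRow_coeffAct_succ_of_ne f X (fun h' => h (h' ▸ hk)) _

/-- Since e ⊕ b_{i+1} = b_{i+2}, the new last factor is x ⊕ b_{i+2} = (1 + βe)(x ⊕ b_{i+1}) + e. The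
last term shortens the row by one. -/
theorem rowSum_coeffAct_succ_of_mem (f : CoeffRing →+* K) (X : LieType) (i : ℕ) (y : ι → K)
    (T : Finset ι → K) (s : Finset ι) {pre post : List ℕ}
    (hpre : i + 1 + rowShift X ∉ pre) (hpost : i + 1 + rowShift X ∉ post) :
    rowSum (f (betaIn CoeffRing)) y T (evalRows (f.comp (coeffAct X (i + 1)))
      (gxRows X (pre ++ (i + 1 + rowShift X) :: post))) s =
    (1 + f (betaIn CoeffRing) * f (eRoot X (i + 1))) * rowSum (f (betaIn CoeffRing)) y T
      (evalRows f (gxRows X (pre ++ (i + 1 + rowShift X) :: post))) s +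
    f (eRoot X (i + 1)) * rowSum (f (betaIn CoeffRing)) y T
      (evalRows f (gxRows X (pre ++ (i + rowShift X) :: post))) s := by
  simp only [evalRows_gxRows_append, evalRows_gxRows_cons, evalRows_coeffAct_succ_of_notMem f X i hpre,
    evalRows_coeffAct_succ_of_notMem f X i hpost]
  refine rowSum_mid_linear _ _ _ _ _ _ _ _ fun k _ => ?_
  rw [eval₂_gxRow_coeffAct_succ_self, eval₂_gxRow_succ]
  have he := congrArg f (eRoot_succ_mul X i)
  simp only [map_mul, map_add, map_sub, map_one] at he
  linear_combination (-(gxRow X (i + rowShift X)).eval₂ f (y k) *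
    (1 + f (betaIn CoeffRing) * y k)) * he

/-- For rows p(x)(x ⊕ b) and p(x) the symmetrized product is p(x)p(z)(x ⊕ z), because (x ⊕ b)(1 +
βz) - (z ⊕ b)(1 + βx) = x - z. The parameter b has disappeared. -/
theorem rowSum_coeffAct_succ_of_pair [CharZero K] (f : CoeffRing →+* K) (X : LieType) (i : ℕ) {y : ι → K}
    (hy : Function.Injective y) (T : Finset ι → K) (s : Finset ι) {pre post : List ℕ}
    (hpre : i + 1 + rowShift X ∉ pre) (hpost : i + 1 + rowShift X ∉ post) :
    rowSum (f (betaIn CoeffRing)) y T (evalRows (f.comp (coeffAct X (i + 1)))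
      (gxRows X (pre ++ (i + 1 + rowShift X) :: (i + rowShift X) :: post))) s =
    rowSum (f (betaIn CoeffRing)) y T
      (evalRows f (gxRows X (pre ++ (i + 1 + rowShift X) :: (i + rowShift X) :: post))) s := by
  simp only [evalRows_gxRows_append, evalRows_gxRows_cons, evalRows_coeffAct_succ_of_notMem f X i hpre,
    evalRows_coeffAct_succ_of_notMem f X i hpost]
  rw [rowSum_append, rowSum_append]
  refine rowSum_congr_terminal _ _ fun t _ _ => mul_left_cancel₀ two_ne_zero
    (rowSum_pair _ _ _ _ _ _ fun k _ j _ hkj => ?_)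
  have h1 : y k - y j ≠ 0 := sub_ne_zero.2 (hy.ne hkj)
  have h2 : y j - y k ≠ 0 := sub_ne_zero.2 (hy.ne hkj.symm)
  simp only [eval₂_gxRow_coeffAct_succ_self,
    eval₂_gxRow_coeffAct_succ_of_ne f X (show i + rowShift X ≠ i + 1 + rowShift X by omega)]
  simp only [eval₂_gxRow_succ]
  have h3 : y j - y k = -(y k - y j) := by ring
  rw [rowRatio, rowRatio, h3]
  field_simp
  ring

end RowIdentities

/-! ### Absorption of the substituted parameters by long rows. -/

section BoundaryRows

variable {K : Type*} [Field K] {ι : Type*} [DecidableEq ι]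

/-- With c = ⊖a, x ⊕ c = x ⊖ a is exactly the denominator of the ratio. -/
theorem rowRatio_mul_oplus {β a c x : K} (h : a + c + β * a * c = 0) (hx : x ≠ a) :
    (x + c + β * x * c) * rowRatio β x a = x + a + β * x * a := by
  have h1 := sub_ne_zero.2 hx
  have h2 : (x + c + β * x * c) * (1 + β * a) = x - a := by linear_combination (1 + β * x) * h
  rw [rowRatio]
  field_simp
  linear_combination (x + a + β * x * a) * h2

theorem map_bInt_oplus_neg (f : CoeffRing →+* K) (k : ℤ) :
    f (bInt k) + f (bInt (-k)) + f (betaIn CoeffRing) * f (bInt k) * f (bInt (-k)) = 0 := by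
  rw [← map_mul, ← map_mul, ← map_add, ← map_add, bInt_oplus_neg, map_zero]

theorem simpleRefl_zero_one {X : LieType} (hX : X ≠ LieType.D) : simpleRefl X 0 1 = -1 := by
  have : simpleRefl X 0 = signedGen 0 := by cases X <;> first | rfl | exact absurd rfl hX
  rw [this, signedGen_zero_apply, if_pos rfl]

theorem simpleRefl_zero_of_pos {X : LieType} (hX : X ≠ LieType.D) (m : ℕ) :
    simpleRefl X 0 (((m + 1 : ℕ) : ℤ) + 1) = ((m + 1 : ℕ) : ℤ) + 1 := by
  have : simpleRefl X 0 = signedGen 0 := by cases X <;> first | rfl | exact absurd rfl hX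
  rw [this, signedGen_zero_apply, if_neg (by push_cast; omega), if_neg (by push_cast; omega)]

theorem eval₂_gxRow_coeffAct_zero_one (f : CoeffRing →+* K) {X : LieType} (hX : X ≠ LieType.D)
    (a : K) : (gxRow X 1).eval₂ (f.comp (coeffAct X 0)) a = (gxRow X 1).eval₂ f a := by
  have : rowShift X = 1 := by cases X <;> first | rfl | exact absurd rfl hX
  rw [eval₂_gxRow_coeffAct, eval₂_gxRow, this]
  simp

/-- In types `B` and `C`, the rows of length at least two absorb the substitution made by `s₀`. -/
theorem eval₂_gxRow_coeffAct_zero (f : CoeffRing →+* K) {X : LieType} (hX : X ≠ LieType.D)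
    {k : ℕ} (hk : 2 ≤ k) (a : K) : ∃ q : K,
      (gxRow X k).eval₂ (f.comp (coeffAct X 0)) a =
        q * (a + f (bInt (-1)) + f (betaIn CoeffRing) * a * f (bInt (-1))) ∧
      (gxRow X k).eval₂ f a = q * (a + f (bInt 1) + f (betaIn CoeffRing) * a * f (bInt 1)) := by
  have hs : rowShift X = 1 := by cases X <;> first | rfl | exact absurd rfl hX
  obtain ⟨j, rfl⟩ : ∃ j, k = j + 2 := ⟨k - 2, by omega⟩
  rw [eval₂_gxRow_coeffAct, eval₂_gxRow, hs, show j + 2 - 1 = j + 1 by omega,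
    Finset.prod_range_succ', Finset.prod_range_succ', ← mul_assoc, ← mul_assoc, Nat.cast_zero, zero_add,
    simpleRefl_zero_one hX]
  refine ⟨_, ?_, rfl⟩
  congr 2
  refine Finset.prod_congr rfl fun m _ => ?_
  rw [simpleRefl_zero_of_pos hX]

/-- The twisted rows contain x ⊖ b_1 in place of x ⊕ b_1. They vanish on the new variable, equal to
b_1, and on any other variable the ratio against b_1 restores the factor x ⊕ b_1. -/
theorem rowSum_coeffAct_zero (f : CoeffRing →+* K) {X : LieType} (hX : X ≠ LieType.D) (y : ι → K)
    {o : ι} {s : Finset ι} (ho : o ∉ s) (hyo : y o = f (bInt 1)) (hy : ∀ k ∈ s, y k ≠ y o)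
    (T : Finset ι → K) {l : List ℕ} (hl : ∀ k ∈ l, 2 ≤ k) :
    rowSum (f (betaIn CoeffRing)) y T (evalRows (f.comp (coeffAct X 0)) (gxRows X l)) ({o} ∪ s) =
      rowSum (f (betaIn CoeffRing)) y (fun t => T ({o} ∪ t)) (evalRows f (gxRows X l)) s := by
  refine rowSum_union _ _ _ _ (by simpa using ho) ?_
  rw [evalRows, evalRows, gxRows, List.map_map, List.map_map, List.forall₂_map_left_iff,
    List.forall₂_map_right_iff, List.forall₂_same]
  intro k hk
  have h1 := map_bInt_oplus_neg f 1
  refine ⟨fun j hj => ?_, fun j hj => ?_⟩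
  · obtain rfl := Finset.mem_singleton.1 hj
    obtain ⟨q, hq, -⟩ := eval₂_gxRow_coeffAct_zero f hX (hl k hk) (y j)
    dsimp only [Function.comp_apply]
    rw [hq, hyo, h1, mul_zero, zero_mul]
  · obtain ⟨q, hq, hq'⟩ := eval₂_gxRow_coeffAct_zero f hX (hl k hk) (y j)
    dsimp only [Function.comp_apply]
    rw [hq, hq', Finset.prod_singleton, hyo, mul_assoc, rowRatio_mul_oplus h1 (hyo ▸ hy j hj)]

theorem simpleRefl_D_zero_of_pos (m : ℕ) :
    simpleRefl LieType.D 0 (((m + 1 + 1 : ℕ) : ℤ) + 1) = ((m + 1 + 1 : ℕ) : ℤ) + 1 := by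
  rw [simpleRefl_D_zero_apply, if_neg (by push_cast; omega), if_neg (by push_cast; omega),
    if_neg (by push_cast; omega), if_neg (by push_cast; omega)]

theorem eval₂_gxRow_D_one (f : CoeffRing →+* K) (a : K) :
    (gxRow LieType.D 1).eval₂ f a = a + f (bInt 1) + f (betaIn CoeffRing) * a * f (bInt 1) := by
  rw [eval₂_gxRow, eval₂_rowDivisor_D]
  simp [rowShift]

theorem eval₂_gxRow_coeffAct_D_one (f : CoeffRing →+* K) (a : K) :
    (gxRow LieType.D 1).eval₂ (f.comp (coeffAct LieType.D 0)) a =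
      a + f (bInt (-2)) + f (betaIn CoeffRing) * a * f (bInt (-2)) := by
  rw [eval₂_gxRow_coeffAct, eval₂_rowDivisor_D]
  simp [rowShift, simpleRefl_D_zero_apply]

theorem eval₂_gxRow_coeffAct_D_zero (f : CoeffRing →+* K) {k : ℕ} (hk : 2 ≤ k) (a : K) : ∃ q : K,
    (gxRow LieType.D k).eval₂ (f.comp (coeffAct LieType.D 0)) a =
      q * ((a + f (bInt (-1)) + f (betaIn CoeffRing) * a * f (bInt (-1))) *
        (a + f (bInt (-2)) + f (betaIn CoeffRing) * a * f (bInt (-2)))) ∧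
    (gxRow LieType.D k).eval₂ f a =
      q * ((a + f (bInt 2) + f (betaIn CoeffRing) * a * f (bInt 2)) *
        (a + f (bInt 1) + f (betaIn CoeffRing) * a * f (bInt 1))) := by
  obtain ⟨j, rfl⟩ : ∃ j, k = j + 2 := ⟨k - 2, by omega⟩
  rw [eval₂_gxRow_coeffAct, eval₂_gxRow, show j + 2 - rowShift LieType.D = j + 1 + 1 from rfl,
    Finset.prod_range_succ', Finset.prod_range_succ', Finset.prod_range_succ',
    Finset.prod_range_succ', show (((0 + 1 : ℕ) : ℤ) + 1) = 2 from rfl,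
    show (((0 : ℕ) : ℤ) + 1) = 1 from rfl, show simpleRefl LieType.D 0 2 = -1 by
      rw [simpleRefl_D_zero_apply]; rfl, show simpleRefl LieType.D 0 1 = -2 by
      rw [simpleRefl_D_zero_apply]; rfl]
  simp only [simpleRefl_D_zero_of_pos]
  have aux : ∀ d q u v u' v' : K, ∃ r, d * (q * u * v) = r * (u * v) ∧
      d * (q * u' * v') = r * (u' * v') := fun d q _ _ _ _ => ⟨d * q, by ring, by ring⟩
  exact aux _ _ _ _ _ _

/-- The same absorption for two new variables: a twisted row of length at least two contains both x
⊖ b_1 and x ⊖ b_2. -/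
theorem rowSum_coeffAct_D_zero (f : CoeffRing →+* K) (y : ι → K)
    {o o' : ι} (hoo : o ≠ o') {s : Finset ι} (ho : o ∉ s) (ho' : o' ∉ s) (hyo : y o = f (bInt 1))
    (hyo' : y o' = f (bInt 2)) (hy : ∀ k ∈ s, y k ≠ y o ∧ y k ≠ y o')
    (T : Finset ι → K) {l : List ℕ} (hl : ∀ k ∈ l, 2 ≤ k) :
    rowSum (f (betaIn CoeffRing)) y T
      (evalRows (f.comp (coeffAct LieType.D 0)) (gxRows LieType.D l)) ({o, o'} ∪ s) =
      rowSum (f (betaIn CoeffRing)) y (fun t => T ({o, o'} ∪ t))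
        (evalRows f (gxRows LieType.D l)) s := by
  refine rowSum_union _ _ _ _ ?_ ?_
  · rw [Finset.disjoint_left]
    intro k hk
    rcases Finset.mem_insert.1 hk with rfl | hk
    · exact ho
    · rwa [Finset.mem_singleton.1 hk]
  rw [evalRows, evalRows, gxRows, List.map_map, List.map_map, List.forall₂_map_left_iff,
    List.forall₂_map_right_iff, List.forall₂_same]
  intro k hk
  have h1 := map_bInt_oplus_neg f 1
  have h2 := map_bInt_oplus_neg f 2
  refine ⟨fun j hj => ?_, fun j hj => ?_⟩
  · obtain ⟨q, hq, -⟩ := eval₂_gxRow_coeffAct_D_zero f (hl k hk) (y j)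
    dsimp only [Function.comp_apply]
    rw [hq]
    rcases Finset.mem_insert.1 hj with rfl | hj
    · rw [hyo, h1, zero_mul, mul_zero, zero_mul]
    · rw [Finset.mem_singleton.1 hj, hyo', h2, mul_zero, mul_zero, zero_mul]
  · obtain ⟨q, hq, hq'⟩ := eval₂_gxRow_coeffAct_D_zero f (hl k hk) (y j)
    dsimp only [Function.comp_apply]
    rw [hq, hq', Finset.prod_pair hoo, hyo, hyo',
      ← rowRatio_mul_oplus h1 (hyo ▸ (hy j hj).1), ← rowRatio_mul_oplus h2 (hyo' ▸ (hy j hj).2)]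
    ring

end BoundaryRows

/-! ### Rows of length one, which come last. -/

section TerminalRows

variable {K : Type*} [Field K] {ι : Type*} [DecidableEq ι]

/-- If S is the row sum and U = ∏ (1 + β y_j), then 1 + βS is U in type B and U² in type C. The new
variable multiplies this by 1 + β b_1, respectively its square, which is 1 + β e(α_0) in both types.
-/
theorem rowSum_gxRow_one_union [CharZero K] (f : CoeffRing →+* K) (hβ : f (betaIn CoeffRing) ≠ 0) {X : LieType}
    (hX : X ≠ LieType.D) {y : ι → K} (hy : IsGeneralPoint (f (betaIn CoeffRing)) y) {o : ι}
    (hyo : y o = f (bInt 1)) {t : Finset ι} (ho : o ∉ t) :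
    rowSum (f (betaIn CoeffRing)) y (fun _ => 1)
      (evalRows (f.comp (coeffAct X 0)) (gxRows X [1])) ({o} ∪ t) =
    (1 + f (betaIn CoeffRing) * f (eRoot X 0)) * rowSum (f (betaIn CoeffRing)) y (fun _ => 1)
      (evalRows f (gxRows X [1])) t + f (eRoot X 0) * 1 := by
  have hd : Disjoint {o} t := by simpa using ho
  refine mul_left_cancel₀ hβ ?_
  cases X
  · have hrow : evalRows f (gxRows LieType.B [1]) = [fun x => x] := by
      rw [evalRows_gxRows_cons, show (fun a => (gxRow LieType.B 1).eval₂ f a) = fun x => x from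
        funext fun a => by rw [eval₂_gxRow, eval₂_rowDivisor_B]; simp [rowShift]]
      rfl
    rw [evalRows_gxRows_congr (g := f) fun k hk a => by
      rw [List.mem_singleton.1 hk, eval₂_gxRow_coeffAct_zero_one f hX], hrow, hy.rowSum_id hβ,
      Finset.prod_union hd, Finset.prod_singleton, mul_add, mul_left_comm, hy.rowSum_id hβ, hyo,
      show eRoot LieType.B 0 = bInt 1 from rfl]
    ring
  · have hrow : evalRows f (gxRows LieType.C [1]) =
        [fun x => x + x + f (betaIn CoeffRing) * x * x] := by
      rw [evalRows_gxRows_cons, show (fun a => (gxRow LieType.C 1).eval₂ f a) =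
        fun x => x + x + f (betaIn CoeffRing) * x * x from
        funext fun a => by rw [eval₂_gxRow, eval₂_rowDivisor_C]; simp [rowShift]]
      rfl
    rw [evalRows_gxRows_congr (g := f) fun k hk a => by
      rw [List.mem_singleton.1 hk, eval₂_gxRow_coeffAct_zero_one f hX], hrow, hy.rowSum_double hβ,
      Finset.prod_union hd, Finset.prod_singleton, mul_add, mul_left_comm, hy.rowSum_double hβ, hyo,
      eRoot_C_zero]
    simp only [map_add, map_mul]
    ring
  · exact absurd rfl hX

theorem rowSum_coeffAct_zero_append_one [CharZero K] (f : CoeffRing →+* K) (hβ : f (betaIn CoeffRing) ≠ 0)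
    {X : LieType} (hX : X ≠ LieType.D) {y : ι → K} (hy : IsGeneralPoint (f (betaIn CoeffRing)) y)
    {o : ι} (hyo : y o = f (bInt 1)) {s : Finset ι} (ho : o ∉ s) {pre : List ℕ}
    (hpre : ∀ k ∈ pre, 2 ≤ k) :
    rowSum (f (betaIn CoeffRing)) y (fun _ => 1)
      (evalRows (f.comp (coeffAct X 0)) (gxRows X (pre ++ [1]))) ({o} ∪ s) =
    (1 + f (betaIn CoeffRing) * f (eRoot X 0)) * rowSum (f (betaIn CoeffRing)) y (fun _ => 1)
      (evalRows f (gxRows X (pre ++ [1]))) s +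
    f (eRoot X 0) * rowSum (f (betaIn CoeffRing)) y (fun _ => 1) (evalRows f (gxRows X pre)) s := by
  rw [evalRows_gxRows_append, evalRows_gxRows_append, rowSum_append, rowSum_append,
    rowSum_coeffAct_zero f hX y ho hyo (fun k hk => hy.injective.ne fun h => ho (h ▸ hk)) _ hpre,
    ← rowSum_terminal_linear]
  exact rowSum_congr_terminal _ _ fun t ht _ =>
    rowSum_gxRow_one_union f hβ hX hy hyo fun h => ho (ht h)

theorem eval₂_gxRow_D_zero (f : CoeffRing →+* K) (a : K) :
    (gxRow LieType.D 0).eval₂ f a = 1 := by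
  rw [eval₂_gxRow, eval₂_rowDivisor_D]
  simp

theorem evalRows_gxRows_D_one (f : CoeffRing →+* K) : evalRows f (gxRows LieType.D [1]) =
    [fun x => x + f (bInt 1) + f (betaIn CoeffRing) * x * f (bInt 1)] := by
  rw [evalRows_gxRows_cons, show (fun a => (gxRow LieType.D 1).eval₂ f a) = _ from
    funext fun a => eval₂_gxRow_D_one f a]
  rfl

theorem evalRows_coeffAct_D_one (f : CoeffRing →+* K) :
    evalRows (f.comp (coeffAct LieType.D 0)) (gxRows LieType.D [1]) =
      [fun x => x + f (bInt (-2)) + f (betaIn CoeffRing) * x * f (bInt (-2))] := by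
  rw [evalRows_gxRows_cons, show (fun a => (gxRow LieType.D 1).eval₂ _ a) = _ from
    funext fun a => eval₂_gxRow_coeffAct_D_one f a]
  rfl

theorem evalRows_coeffAct_succ_D_one (f : CoeffRing →+* K) :
    evalRows (f.comp (coeffAct LieType.D 1)) (gxRows LieType.D [1]) =
      [fun x => x + f (bInt 2) + f (betaIn CoeffRing) * x * f (bInt 2)] := by
  rw [evalRows_gxRows_cons]
  congr 1
  funext a
  have := eval₂_gxRow_coeffAct_succ_self f LieType.D 0 a
  rw [show 0 + rowShift LieType.D = 0 from rfl, eval₂_gxRow_D_zero, one_mul] at this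
  exact this

theorem prod_pair_union_one_add (f : CoeffRing →+* K) {y : ι → K} {o o' : ι}
    (hyo : y o = f (bInt 1)) (hyo' : y o' = f (bInt 2)) {t : Finset ι} (hoo : o ≠ o')
    (hd : Disjoint {o, o'} t) :
    ∏ j ∈ {o, o'} ∪ t, (1 + f (betaIn CoeffRing) * y j) =
      (1 + f (betaIn CoeffRing) * f (bInt 1)) * (1 + f (betaIn CoeffRing) * f (bInt 2)) *
        ∏ j ∈ t, (1 + f (betaIn CoeffRing) * y j) := by
  rw [Finset.prod_union hd, Finset.prod_pair hoo, hyo, hyo']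

theorem card_pair_union {o o' : ι} {t : Finset ι} (hoo : o ≠ o') (hd : Disjoint {o, o'} t) :
    ({o, o'} ∪ t).card = t.card + 2 := by
  rw [Finset.card_union_of_disjoint hd, Finset.card_pair hoo, add_comm]

/-- For evenly many variables 1 + βS = U whatever the parameter of the row, and b_1, b_2 multiply U
by (1 + β b_1)(1 + β b_2) = 1 + β(b_1 ⊕ b_2). -/
theorem rowSum_gxRow_D_one_union_even [CharZero K] (f : CoeffRing →+* K) (hβ : f (betaIn CoeffRing) ≠ 0)
    {y : ι → K} (hy : IsGeneralPoint (f (betaIn CoeffRing)) y) {o o' : ι}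
    (hyo : y o = f (bInt 1)) (hyo' : y o' = f (bInt 2)) {t : Finset ι} (hoo : o ≠ o')
    (hd : Disjoint {o, o'} t) (ht : Even t.card) :
    rowSum (f (betaIn CoeffRing)) y (fun _ => 1)
      (evalRows (f.comp (coeffAct LieType.D 0)) (gxRows LieType.D [1])) ({o, o'} ∪ t) =
    (1 + f (betaIn CoeffRing) * f (eRoot LieType.D 0)) * rowSum (f (betaIn CoeffRing)) y
      (fun _ => 1) (evalRows f (gxRows LieType.D [1])) t + f (eRoot LieType.D 0) * 1 := by
  refine mul_left_cancel₀ hβ ?_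
  rw [evalRows_coeffAct_D_one, evalRows_gxRows_D_one, hy.rowSum_oplus_even hβ (by
    rw [card_pair_union hoo hd]; exact ht.add even_two), prod_pair_union_one_add f hyo hyo' hoo hd,
    eRoot_D_zero]
  have h := hy.rowSum_oplus_even hβ ht (f (bInt 1))
  simp only [map_add, map_mul]
  linear_combination (-((1 + f (betaIn CoeffRing) * f (bInt 1)) *
    (1 + f (betaIn CoeffRing) * f (bInt 2)))) * h

/-- For oddly many variables 1 + βS carries the factor 1 + βc of the parameter. The twisted
parameter ⊖b_2 cancels the contribution of the variable b_2, and the variable b_1 supplies the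
original factor. -/
theorem rowSum_gxRow_D_one_union_odd [CharZero K] (f : CoeffRing →+* K) (hβ : f (betaIn CoeffRing) ≠ 0)
    {y : ι → K} (hy : IsGeneralPoint (f (betaIn CoeffRing)) y) {o o' : ι}
    (hyo : y o = f (bInt 1)) (hyo' : y o' = f (bInt 2)) {t : Finset ι} (hoo : o ≠ o')
    (hd : Disjoint {o, o'} t) (ht : Odd t.card) :
    rowSum (f (betaIn CoeffRing)) y (fun _ => 1)
      (evalRows (f.comp (coeffAct LieType.D 0)) (gxRows LieType.D [1])) ({o, o'} ∪ t) =
    rowSum (f (betaIn CoeffRing)) y (fun _ => 1) (evalRows f (gxRows LieType.D [1])) t := by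
  refine mul_left_cancel₀ hβ ?_
  rw [evalRows_coeffAct_D_one, evalRows_gxRows_D_one, hy.rowSum_oplus_odd hβ (by
    rw [card_pair_union hoo hd]; exact ht.add_even even_two),
    prod_pair_union_one_add f hyo hyo' hoo hd, hy.rowSum_oplus_odd hβ ht]
  have h := map_bInt_oplus_neg f 2
  linear_combination (f (betaIn CoeffRing) * (1 + f (betaIn CoeffRing) * f (bInt 1)) *
    ∏ j ∈ t, (1 + f (betaIn CoeffRing) * y j)) * h

theorem rowSum_coeffAct_D_zero_append_one_even [CharZero K] (f : CoeffRing →+* K)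
    (hβ : f (betaIn CoeffRing) ≠ 0) {y : ι → K} (hy : IsGeneralPoint (f (betaIn CoeffRing)) y)
    {o o' : ι} (hyo : y o = f (bInt 1)) (hyo' : y o' = f (bInt 2)) {s : Finset ι} (hoo : o ≠ o')
    (hd : Disjoint {o, o'} s) {pre : List ℕ} (hpre : ∀ k ∈ pre, 2 ≤ k) (hs : Even s.card)
    (hl : Even pre.length) :
    rowSum (f (betaIn CoeffRing)) y (fun _ => 1)
      (evalRows (f.comp (coeffAct LieType.D 0)) (gxRows LieType.D (pre ++ [1]))) ({o, o'} ∪ s) =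
    (1 + f (betaIn CoeffRing) * f (eRoot LieType.D 0)) * rowSum (f (betaIn CoeffRing)) y
      (fun _ => 1) (evalRows f (gxRows LieType.D (pre ++ [1]))) s +
    f (eRoot LieType.D 0) * rowSum (f (betaIn CoeffRing)) y (fun _ => 1)
      (evalRows f (gxRows LieType.D pre)) s := by
  have ho : o ∉ s := Finset.disjoint_left.1 hd (by simp)
  have ho' : o' ∉ s := Finset.disjoint_left.1 hd (by simp)
  rw [evalRows_gxRows_append, evalRows_gxRows_append, rowSum_append, rowSum_append,
    rowSum_coeffAct_D_zero f y hoo ho ho' hyo hyo' (fun k hk => ⟨hy.injective.ne fun h => ho (h ▸ hk),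
      hy.injective.ne fun h => ho' (h ▸ hk)⟩) _ hpre, ← rowSum_terminal_linear]
  -- An even number of variables minus an even number of earlier rows leaves evenly many for the
  -- last row.
  refine rowSum_congr_terminal _ _ fun t ht hc => rowSum_gxRow_D_one_union_even f hβ hy hyo hyo' hoo
    (hd.mono_right ht) ?_
  rw [evalRows, gxRows, List.length_map, List.length_map] at hc
  rw [← hc, Nat.even_add] at hs
  exact hs.2 hl

theorem rowSum_coeffAct_D_zero_append_one_odd [CharZero K] (f : CoeffRing →+* K)
    (hβ : f (betaIn CoeffRing) ≠ 0) {y : ι → K} (hy : IsGeneralPoint (f (betaIn CoeffRing)) y)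
    {o o' : ι} (hyo : y o = f (bInt 1)) (hyo' : y o' = f (bInt 2)) {s : Finset ι} (hoo : o ≠ o')
    (hd : Disjoint {o, o'} s) {pre : List ℕ} (hpre : ∀ k ∈ pre, 2 ≤ k) (hs : Even s.card)
    (hl : Odd pre.length) :
    rowSum (f (betaIn CoeffRing)) y (fun _ => 1)
      (evalRows (f.comp (coeffAct LieType.D 0)) (gxRows LieType.D (pre ++ [1]))) ({o, o'} ∪ s) =
    rowSum (f (betaIn CoeffRing)) y (fun _ => 1) (evalRows f (gxRows LieType.D (pre ++ [1]))) s := by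
  have ho : o ∉ s := Finset.disjoint_left.1 hd (by simp)
  have ho' : o' ∉ s := Finset.disjoint_left.1 hd (by simp)
  rw [evalRows_gxRows_append, evalRows_gxRows_append, rowSum_append, rowSum_append,
    rowSum_coeffAct_D_zero f y hoo ho ho' hyo hyo' (fun k hk => ⟨hy.injective.ne fun h => ho (h ▸ hk),
      hy.injective.ne fun h => ho' (h ▸ hk)⟩) _ hpre]
  refine rowSum_congr_terminal _ _ fun t ht hc => rowSum_gxRow_D_one_union_odd f hβ hy hyo hyo' hoo
    (hd.mono_right ht) ?_
  rw [evalRows, gxRows, List.length_map, List.length_map] at hc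
  rw [← hc, Nat.even_add'] at hs
  exact hs.2 hl

/-- Shortening the row of length one yields the constant row 1, whose sum over an odd number of
variables is 1. It can then be omitted. -/
theorem rowSum_append_zero_D [CharZero K] (f : CoeffRing →+* K) (hβ : f (betaIn CoeffRing) ≠ 0) {y : ι → K}
    (hy : IsGeneralPoint (f (betaIn CoeffRing)) y) {s : Finset ι} {pre : List ℕ}
    (hs : Even s.card) (hl : Odd pre.length) :
    rowSum (f (betaIn CoeffRing)) y (fun _ => 1) (evalRows f (gxRows LieType.D (pre ++ [0]))) s =
      rowSum (f (betaIn CoeffRing)) y (fun _ => 1) (evalRows f (gxRows LieType.D pre)) s := by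
  rw [evalRows_gxRows_append, rowSum_append]
  refine rowSum_congr_terminal _ _ fun t _ hc => ?_
  rw [evalRows_gxRows_cons, show (fun a => (gxRow LieType.D 0).eval₂ f a) = _ from
    funext fun a => eval₂_gxRow_D_zero f a]
  refine hy.rowSum_one hβ ?_
  rw [evalRows, gxRows, List.length_map, List.length_map] at hc
  rw [← hc, Nat.even_add'] at hs
  exact hs.2 hl

/-- The reflection s_1 turns x ⊕ b_1 into x ⊕ b_2, and for evenly many remaining variables the row
sum does not depend on the parameter. -/
theorem rowSum_coeffAct_succ_D_append_one_even [CharZero K] (f : CoeffRing →+* K)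
    (hβ : f (betaIn CoeffRing) ≠ 0) {y : ι → K} (hy : IsGeneralPoint (f (betaIn CoeffRing)) y)
    {s : Finset ι} {pre : List ℕ} (hpre : ∀ k ∈ pre, 2 ≤ k) (hs : Even s.card)
    (hl : Even pre.length) :
    rowSum (f (betaIn CoeffRing)) y (fun _ => 1)
      (evalRows (f.comp (coeffAct LieType.D 1)) (gxRows LieType.D (pre ++ [1]))) s =
    rowSum (f (betaIn CoeffRing)) y (fun _ => 1) (evalRows f (gxRows LieType.D (pre ++ [1]))) s := by
  rw [evalRows_gxRows_append, evalRows_gxRows_append, rowSum_append, rowSum_append,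
    evalRows_coeffAct_succ_of_notMem f LieType.D 0 (l := pre) fun h =>
      absurd (hpre _ h) (by simp [rowShift])]
  refine rowSum_congr_terminal _ _ fun t _ hc => mul_left_cancel₀ hβ ?_
  have ht : Even t.card := by
    rw [evalRows, gxRows, List.length_map, List.length_map] at hc
    rw [← hc, Nat.even_add] at hs
    exact hs.2 hl
  rw [evalRows_coeffAct_succ_D_one, evalRows_gxRows_D_one, hy.rowSum_oplus_even hβ ht,
    hy.rowSum_oplus_even hβ ht]

end TerminalRows

/-! ### From row sum identities to divided differences. -/

section DividedDifferenceFormula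

theorem eq_of_eval_eq (X : LieType) {F G : Family} (hF : ∀ n, setLastZero CoeffRing n (F (n + 1)) = F n)
    (hG : ∀ n, setLastZero CoeffRing n (G (n + 1)) = G n)
    (h : ∀ n, (X = LieType.D → Even n) → ∀ (K : Type) [Field K] [CharZero K] (f : CoeffRing →+* K)
      (y : ℕ → K), Function.Injective f → IsGenericSeq f (betaIn CoeffRing) y →
      (F n).eval₂ f (fun i : Fin n => y i) = (G n).eval₂ f (fun i : Fin n => y i)) : F = G :=
  eq_of_stable hF hG fun n => ⟨2 * n, by omega, eq_of_generic (betaIn CoeffRing)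
    fun K _ _ f y hf hy => h (2 * n) (fun _ => even_two_mul n) K f y hf hy⟩

theorem dividedDiff_GX_eq {X : LieType} {i : ℕ} {l m : StrictPartition}
    (h : ∀ n, (X = LieType.D → Even n) → ∀ (K : Type) [Field K] [CharZero K] (f : CoeffRing →+* K)
      (y : ℕ → K), Function.Injective f → IsGenericSeq f (betaIn CoeffRing) y →
      (simpleReflAct X i (GX X l) n).eval₂ f (fun i : Fin n => y i) =
        (1 + f (betaIn CoeffRing) * f (eRoot X i)) * (GX X l n).eval₂ f (fun i : Fin n => y i) +
        f (eRoot X i) * (GX X m n).eval₂ f (fun i : Fin n => y i)) :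
    dividedDiff X i (GX X l) = GX X m := by
  have hl := fun n => (mem_GGammaRHat.1 (GX_mem_GGammaRHat X l) n).1
  have hm := fun n => (mem_GGammaRHat.1 (GX_mem_GGammaRHat X m) n).1
  refine dividedDiff_eq (GX_mem_GGammaRHat X l) (eq_of_eval_eq X (fun n => ?_) (fun n => ?_)
    fun n hn K _ _ f y hf hy => ?_)
  · rw [Pi.smul_apply, Pi.smul_apply, map_smul, hm]
  · simp only [Pi.sub_apply, Pi.smul_apply, map_sub, map_smul, setLastZero_simpleReflAct hl, hl]
  · have := h n hn K f y hf hy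
    simp only [Pi.sub_apply, Pi.add_apply, Pi.smul_apply, add_smul, one_smul, MvPolynomial.eval₂_sub,
      MvPolynomial.eval₂_add, MvPolynomial.smul_eq_C_mul, MvPolynomial.eval₂_mul,
      MvPolynomial.eval₂_C, map_mul]
    linear_combination -this

theorem dividedDiff_GX_eq_neg {X : LieType} {i : ℕ} {l : StrictPartition}
    (h : ∀ n, (X = LieType.D → Even n) → ∀ (K : Type) [Field K] [CharZero K] (f : CoeffRing →+* K)
      (y : ℕ → K), Function.Injective f → IsGenericSeq f (betaIn CoeffRing) y →
      (simpleReflAct X i (GX X l) n).eval₂ f (fun i : Fin n => y i) =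
        (GX X l n).eval₂ f (fun i : Fin n => y i)) :
    dividedDiff X i (GX X l) = -(betaIn CoeffRing • GX X l) := by
  have hl := fun n => (mem_GGammaRHat.1 (GX_mem_GGammaRHat X l) n).1
  refine dividedDiff_eq (GX_mem_GGammaRHat X l) ?_
  rw [IsDividedDifference, eq_of_eval_eq X (fun n => setLastZero_simpleReflAct hl X i n) hl h,
    add_smul, one_smul, smul_neg, smul_smul, mul_comm (eRoot X i)]
  abel

theorem eval₂_GX {X : LieType} (l : StrictPartition) {n : ℕ} (hn : X = LieType.D → Even n)
    {K : Type} [Field K] [CharZero K] (f : CoeffRing →+* K) {y : Fin n → K}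
    (hy : Function.Injective y) : (GX X l n).eval₂ f y =
      rowSum (f (betaIn CoeffRing)) y (fun _ => 1) (evalRows f (gxRows X l.parts)) Finset.univ :=
  isRowFamily_GX X l n hn K f y hy

theorem eval₂_map_coeffAct_GX {X : LieType} (i : ℕ) (l : StrictPartition) {n : ℕ}
    (hn : X = LieType.D → Even n)
    {K : Type} [Field K] [CharZero K] (f : CoeffRing →+* K) {y : Fin n → K}
    (hy : Function.Injective y) : (MvPolynomial.map (coeffAct X i) (GX X l n)).eval₂ f y =
      rowSum (f (betaIn CoeffRing)) y (fun _ => 1)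
        (evalRows (f.comp (coeffAct X i)) (gxRows X l.parts)) Finset.univ := by
  rw [MvPolynomial.eval₂_map, eval₂_GX l hn _ hy, RingHom.comp_apply, coeffAct_beta]

theorem rowSum_cons {K : Type*} [Field K] (β : K) {n : ℕ} (y : Fin n → K) (a : K)
    (ps : List (K → K)) :
    rowSum β (Fin.cons a y : Fin (n + 1) → K) (fun _ => 1) ps
      (Finset.univ.map (Fin.succEmb n)) = rowSum β y (fun _ => 1) ps Finset.univ := by
  rw [rowSum_map]
  rfl

theorem univ_eq_singleton_union (n : ℕ) : (Finset.univ : Finset (Fin (n + 1))) =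
    {0} ∪ Finset.univ.map (Fin.succEmb n) := by
  ext k
  refine Fin.cases ?_ (fun i => ?_) k <;> simp

/-- Index 1 is listed before 0 because b_2 is put in front of b_1: the value b_1 sits at index 1 and
b_2 at index 0. -/
theorem univ_eq_pair_union (n : ℕ) : (Finset.univ : Finset (Fin (n + 2))) =
    {1, 0} ∪ (Finset.univ.map (Fin.succEmb n)).map (Fin.succEmb (n + 1)) := by
  ext k
  refine Fin.cases ?_ (fun i => Fin.cases ?_ (fun j => ?_) i) k <;> simp

theorem two_add_beta_mul_bInt_ne_zero (m : ℕ) :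
    2 + betaIn CoeffRing * bInt ((m : ℤ) + 1) ≠ 0 := by
  intro h
  have h1 : algebraMap (MvPolynomial ℕ Zbeta) CoeffRing
      (2 + MvPolynomial.C Polynomial.X * MvPolynomial.X m) = 0 := by
    rw [map_add, map_mul, map_ofNat]
    exact h
  rw [map_eq_zero_iff _ algebraMap_coeffRing_injective] at h1
  have h2 := congrArg (MvPolynomial.eval₂ (Polynomial.evalRingHom (0 : ℤ)) fun _ => 1) h1
  simp at h2

theorem bInt_pos_ne_zero (m : ℕ) : bInt ((m : ℤ) + 1) ≠ 0 := by
  rw [bInt_natCast_succ]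
  exact (map_ne_zero_iff _ algebraMap_coeffRing_injective).2 (MvPolynomial.X_ne_zero m)

theorem betaIn_coeffRing_ne_zero : betaIn CoeffRing ≠ 0 := by
  have : betaIn CoeffRing = algebraMap (MvPolynomial ℕ Zbeta) CoeffRing
    (MvPolynomial.C Polynomial.X) := rfl
  rw [this, map_ne_zero_iff _ algebraMap_coeffRing_injective]
  exact MvPolynomial.C_ne_zero.2 Polynomial.X_ne_zero

theorem IsGeneralPoint.cons_bInt {K : Type*} [Field K] {f : CoeffRing →+* K}
    (hf : Function.Injective f) {n : ℕ} {y : Fin n → K}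
    (hy : IsGeneralPoint (f (betaIn CoeffRing)) y) {a : ℤ} (ha : 0 < a)
    (hm : ∀ k, y k ≠ f (bInt a)) :
    IsGeneralPoint (f (betaIn CoeffRing)) (Fin.cons (f (bInt a)) y : Fin (n + 1) → K) := by
  obtain ⟨m, rfl⟩ : ∃ m : ℕ, a = (m : ℤ) + 1 := ⟨(a - 1).toNat, by omega⟩
  refine hy.cons hm ?_ ((map_ne_zero_iff f hf).2 (bInt_pos_ne_zero m)) ?_
  · have := ((isUnit_one_add_bInt ((m : ℤ) + 1)).map f).ne_zero
    rwa [map_add, map_mul, map_one] at this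
  · have := (map_ne_zero_iff f hf).2 (two_add_beta_mul_bInt_ne_zero m)
    rwa [map_add, map_mul, map_ofNat] at this

end DividedDifferenceFormula

/-! ### The value of π_i on GX_λ. -/

section RemovalFormula

/-- The part that is lowered when a box of content `i` is removed. -/
def rootPart : LieType → ℕ → ℕ
  | LieType.D, 0 => 1
  | LieType.D, i + 1 => i + 1
  | _, i => i + 1

/-- `s_i` lowers the part `rootPart X i` of `l`. -/
def IsLowerable : LieType → ℕ → StrictPartition → Prop
  | LieType.D, 0, l => 1 ∈ l.parts ∧ Odd l.length
  | LieType.D, 1, l => 1 ∈ l.parts ∧ Even l.length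
  | LieType.D, i + 2, l => i + 2 ∈ l.parts ∧ i + 1 ∉ l.parts
  | _, 0, l => 1 ∈ l.parts
  | _, i + 1, l => i + 2 ∈ l.parts ∧ i + 1 ∉ l.parts

/-- `m` is obtained from `l` by lowering the part `k` by one. -/
def IsLowering (k : ℕ) (l m : StrictPartition) : Prop :=
  ∃ pre post, l.parts = pre ++ k :: post ∧
    m.parts = pre ++ (if k = 1 then post else (k - 1) :: post)

theorem StrictPartition.lt_of_parts_eq {l : StrictPartition} {pre post : List ℕ} {k : ℕ}
    (h : l.parts = pre ++ k :: post) : (∀ j ∈ pre, k < j) ∧ ∀ j ∈ post, j < k := by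
  have hd := l.decreasing
  rw [h, List.pairwise_append, List.pairwise_cons] at hd
  exact ⟨fun j hj => hd.2.2 j hj k (by simp), hd.2.1.1⟩

theorem StrictPartition.post_eq_nil {l : StrictPartition} {pre post : List ℕ}
    (h : l.parts = pre ++ 1 :: post) : post = [] := by
  rcases post with _ | ⟨a, post⟩
  · rfl
  · have h1 := l.pos a (by simp [h])
    have h2 := (StrictPartition.lt_of_parts_eq h).2 a (by simp)
    omega

theorem IsLowerable.mem {X : LieType} {i : ℕ} {l : StrictPartition} (h : IsLowerable X i l) :
    rootPart X i ∈ l.parts := by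
  match X, i with
  | LieType.D, 0 => exact h.1
  | LieType.D, 1 => exact h.1
  | LieType.D, i + 2 => exact h.1
  | LieType.B, 0 => exact h
  | LieType.B, i + 1 => exact h.1
  | LieType.C, 0 => exact h
  | LieType.C, i + 1 => exact h.1

theorem IsLowerable.eq_one_or {X : LieType} {i : ℕ} {l : StrictPartition}
    (h : IsLowerable X i l) : rootPart X i = 1 ∨ rootPart X i - 1 ∉ l.parts := by
  match X, i with
  | LieType.D, 0 => exact .inl rfl
  | LieType.D, 1 => exact .inl rfl
  | LieType.D, i + 2 => exact .inr h.2
  | LieType.B, 0 => exact .inl rfl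
  | LieType.B, i + 1 => exact .inr h.2
  | LieType.C, 0 => exact .inl rfl
  | LieType.C, i + 1 => exact .inr h.2

theorem exists_isLowering {k : ℕ} {l : StrictPartition} (hk : k ∈ l.parts)
    (h : k = 1 ∨ k - 1 ∉ l.parts) : ∃ m, IsLowering k l m := by
  obtain ⟨pre, post, hp⟩ := List.append_of_mem hk
  obtain ⟨h1, h2⟩ := StrictPartition.lt_of_parts_eq hp
  have hd := l.decreasing
  rw [hp, List.pairwise_append, List.pairwise_cons] at hd
  have hpos := l.pos
  by_cases hk1 : k = 1
  · refine ⟨⟨pre ++ post, ?_, ?_⟩, pre, post, hp, by rw [if_pos hk1]⟩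
    · rw [List.pairwise_append]
      exact ⟨hd.1, hd.2.1.2, fun a ha b hb => hd.2.2 a ha b (by simp [hb])⟩
    · exact fun p hp' => hpos p (by rw [hp]; simp at hp' ⊢; tauto)
  · have hk' := h.resolve_left hk1
    have hk0 := hpos k hk
    refine ⟨⟨pre ++ (k - 1) :: post, ?_, ?_⟩, pre, post, hp, by rw [if_neg hk1]⟩
    · rw [List.pairwise_append, List.pairwise_cons]
      refine ⟨hd.1, ⟨fun a ha => ?_, hd.2.1.2⟩, fun a ha b hb => ?_⟩
      · have h3 := h2 a ha
        have h4 : a ≠ k - 1 := fun h => hk' (by rw [hp, ← h]; simp [ha])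
        omega
      · have h3 := h1 a ha
        rcases List.mem_cons.1 hb with rfl | hb
        · omega
        · exact hd.2.2 a ha b (by simp [hb])
    · intro p hp'
      rcases List.mem_append.1 hp' with hp' | hp'
      · exact hpos p (by rw [hp]; simp [hp'])
      · rcases List.mem_cons.1 hp' with rfl | hp'
        · omega
        · exact hpos p (by rw [hp]; simp [hp'])

theorem eval₂_simpleReflAct_succ {X : LieType} (i : ℕ) (l : StrictPartition) {n : ℕ}
    (hn : X = LieType.D → Even n) {K : Type} [Field K] [CharZero K] {f : CoeffRing →+* K}
    {y : ℕ → K} (hy : IsGenericSeq f (betaIn CoeffRing) y) :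
    (simpleReflAct X (i + 1) (GX X l) n).eval₂ f (fun i : Fin n => y i) =
      rowSum (f (betaIn CoeffRing)) (fun i : Fin n => y i) (fun _ => 1)
        (evalRows (f.comp (coeffAct X (i + 1))) (gxRows X l.parts)) Finset.univ := by
  rw [simpleReflAct_succ, eval₂_map_coeffAct_GX _ l hn f (hy.isGeneralPoint n).injective]

theorem dividedDiff_succ_of_notMem {X : LieType} {i : ℕ} {l : StrictPartition}
    (h : i + 1 + rowShift X ∉ l.parts) :
    dividedDiff X (i + 1) (GX X l) = -(betaIn CoeffRing • GX X l) := by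
  refine dividedDiff_GX_eq_neg fun n hn K _ _ f y hf hy => ?_
  rw [eval₂_simpleReflAct_succ i l hn hy, eval₂_GX l hn f (hy.isGeneralPoint n).injective,
    evalRows_coeffAct_succ_of_notMem f X i h]

theorem dividedDiff_succ_of_pair {X : LieType} {i : ℕ} {l : StrictPartition}
    (h : i + 1 + rowShift X ∈ l.parts) (h' : i + rowShift X ∈ l.parts) :
    dividedDiff X (i + 1) (GX X l) = -(betaIn CoeffRing • GX X l) := by
  rw [add_right_comm] at h
  obtain ⟨pre, post, hl, h1, h2⟩ := l.exists_append_pair h h'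
  rw [add_right_comm] at hl
  refine dividedDiff_GX_eq_neg fun n hn K _ _ f y hf hy => ?_
  rw [eval₂_simpleReflAct_succ i l hn hy, eval₂_GX l hn f (hy.isGeneralPoint n).injective, hl,
    rowSum_coeffAct_succ_of_pair f X i (hy.isGeneralPoint n).injective]
  · intro h
    have := h1 _ h
    omega
  · intro h
    have := h2 _ h
    omega

/-- The hypothesis `hm` compares row sums instead of lists of parts, since in type D with i = 0 the
shortened row has length 0 and is not a part of m. -/
theorem dividedDiff_succ_of_mem {X : LieType} {i : ℕ} {l m : StrictPartition} {pre post : List ℕ}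
    (hl : l.parts = pre ++ (i + 1 + rowShift X) :: post)
    (hm : ∀ n, (X = LieType.D → Even n) → ∀ (K : Type) [Field K] [CharZero K]
      (f : CoeffRing →+* K) (y : Fin n → K), Function.Injective f →
      IsGeneralPoint (f (betaIn CoeffRing)) y → rowSum (f (betaIn CoeffRing)) y (fun _ => 1)
        (evalRows f (gxRows X (pre ++ (i + rowShift X) :: post))) Finset.univ =
        rowSum (f (betaIn CoeffRing)) y (fun _ => 1)
          (evalRows f (gxRows X m.parts)) Finset.univ) :
    dividedDiff X (i + 1) (GX X l) = GX X m := by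
  obtain ⟨h1, h2⟩ := StrictPartition.lt_of_parts_eq hl
  refine dividedDiff_GX_eq fun n hn K _ _ f y hf hy => ?_
  have hy' := hy.isGeneralPoint n
  rw [eval₂_simpleReflAct_succ i l hn hy, eval₂_GX l hn f hy'.injective,
    eval₂_GX m hn f hy'.injective, hl, rowSum_coeffAct_succ_of_mem f X i _ _ _
      (fun h => (h1 _ h).ne rfl) (fun h => (h2 _ h).ne rfl), hm n hn K f _ hf hy']

theorem map_beta_ne_zero {K : Type*} [Field K] {f : CoeffRing →+* K} (hf : Function.Injective f) :
    f (betaIn CoeffRing) ≠ 0 := (map_ne_zero_iff f hf).2 betaIn_coeffRing_ne_zero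

theorem dividedDiff_D_one_of_even {l m : StrictPartition} (h : IsLowering 1 l m)
    (hl : Even l.length) : dividedDiff LieType.D 1 (GX LieType.D l) = GX LieType.D m := by
  obtain ⟨pre, post, hl', hm⟩ := h
  obtain rfl := StrictPartition.post_eq_nil hl'
  refine dividedDiff_succ_of_mem (i := 0) hl' fun n hn K _ _ f y hf hy => ?_
  rw [hm, if_pos rfl, List.append_nil]
  refine rowSum_append_zero_D f (map_beta_ne_zero hf) hy (by simpa using hn rfl) ?_
  rw [StrictPartition.length, hl'] at hl
  simpa [Nat.even_add_one] using hl

theorem dividedDiff_D_one_of_odd {l : StrictPartition} (h : 1 ∈ l.parts) (hl : Odd l.length) :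
    dividedDiff LieType.D 1 (GX LieType.D l) = -(betaIn CoeffRing • GX LieType.D l) := by
  obtain ⟨pre, hp, h2⟩ := l.exists_append_one h
  refine dividedDiff_GX_eq_neg fun n hn K _ _ f y hf hy => ?_
  rw [eval₂_simpleReflAct_succ 0 l hn hy, eval₂_GX l hn f (hy.isGeneralPoint n).injective, hp]
  refine rowSum_coeffAct_succ_D_append_one_even f (map_beta_ne_zero hf) (hy.isGeneralPoint n) h2
    (by simpa using hn rfl) ?_
  rw [StrictPartition.length, hp] at hl
  simpa [Nat.odd_add_one] using hl

theorem cons_bInt_one_isGeneralPoint {K : Type} [Field K] {f : CoeffRing →+* K}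
    (hf : Function.Injective f) {y : ℕ → K} (hy : IsGenericSeq f (betaIn CoeffRing) y) (n : ℕ) :
    IsGeneralPoint (f (betaIn CoeffRing)) (Fin.cons (f (bInt 1)) (fun i : Fin n => y i) :
      Fin (n + 1) → K) :=
  (hy.isGeneralPoint n).cons_bInt hf one_pos fun k => hy.ne_map k _

theorem bInt_one_ne_two : bInt 1 ≠ bInt 2 := by
  intro h
  have h1 : bInt 1 = algebraMap (MvPolynomial ℕ Zbeta) CoeffRing (MvPolynomial.X 0) := rfl
  have h2 : bInt 2 = algebraMap (MvPolynomial ℕ Zbeta) CoeffRing (MvPolynomial.X 1) := rfl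
  rw [h1, h2] at h
  exact zero_ne_one (MvPolynomial.X_injective (R := Zbeta) (algebraMap_coeffRing_injective h))

theorem cons_bInt_two_isGeneralPoint {K : Type} [Field K] {f : CoeffRing →+* K}
    (hf : Function.Injective f) {y : ℕ → K} (hy : IsGenericSeq f (betaIn CoeffRing) y) (n : ℕ) :
    IsGeneralPoint (f (betaIn CoeffRing)) (Fin.cons (f (bInt 2))
      (Fin.cons (f (bInt 1)) (fun i : Fin n => y i) : Fin (n + 1) → K) : Fin (n + 2) → K) := by
  refine (cons_bInt_one_isGeneralPoint hf hy n).cons_bInt hf two_pos fun k => ?_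
  induction k using Fin.cases with
  | zero =>
    rw [Fin.cons_zero]
    exact hf.ne bInt_one_ne_two
  | succ i => exact hy.ne_map i _

theorem eval₂_simpleReflAct_zero {X : LieType} (hX : X ≠ LieType.D) (l : StrictPartition) (n : ℕ)
    {K : Type} [Field K] [CharZero K] {f : CoeffRing →+* K} (hf : Function.Injective f)
    {y : ℕ → K} (hy : IsGenericSeq f (betaIn CoeffRing) y) :
    (simpleReflAct X 0 (GX X l) n).eval₂ f (fun i : Fin n => y i) =
      rowSum (f (betaIn CoeffRing)) (Fin.cons (f (bInt 1)) (fun i : Fin n => y i) :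
        Fin (n + 1) → K) (fun _ => 1) (evalRows (f.comp (coeffAct X 0)) (gxRows X l.parts))
        ({0} ∪ Finset.univ.map (Fin.succEmb n)) := by
  have h1 : simpleReflAct X 0 (GX X l) n =
      setFirst n (bInt 1) (MvPolynomial.map (coeffAct X 0) (GX X l (n + 1))) := by
    cases X
    · exact simpleReflAct_B_zero _ _
    · exact simpleReflAct_C_zero _ _
    · exact absurd rfl hX
  rw [h1, eval₂_setFirst, ← univ_eq_singleton_union]
  exact eval₂_map_coeffAct_GX 0 l (fun h => absurd h hX) f
    (cons_bInt_one_isGeneralPoint hf hy n).injective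

theorem zero_notMem_map_succEmb (n : ℕ) (s : Finset (Fin n)) :
    (0 : Fin (n + 1)) ∉ s.map (Fin.succEmb n) := by
  simp

theorem dividedDiff_zero_of_mem {X : LieType} (hX : X ≠ LieType.D) {l m : StrictPartition}
    (h : IsLowering 1 l m) : dividedDiff X 0 (GX X l) = GX X m := by
  obtain ⟨pre, post, hl, hm⟩ := h
  obtain rfl := StrictPartition.post_eq_nil hl
  rw [if_pos rfl, List.append_nil] at hm
  refine dividedDiff_GX_eq fun n hn K _ _ f y hf hy => ?_
  rw [eval₂_simpleReflAct_zero hX l n hf hy, hl, rowSum_coeffAct_zero_append_one f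
    (map_beta_ne_zero hf) hX (cons_bInt_one_isGeneralPoint hf hy n) rfl
    (zero_notMem_map_succEmb n _) (StrictPartition.lt_of_parts_eq hl).1, rowSum_cons, rowSum_cons,
    eval₂_GX l hn f (hy.isGeneralPoint n).injective,
    eval₂_GX m hn f (hy.isGeneralPoint n).injective, hl, hm]

theorem dividedDiff_zero_of_notMem {X : LieType} (hX : X ≠ LieType.D) {l : StrictPartition}
    (h : 1 ∉ l.parts) : dividedDiff X 0 (GX X l) = -(betaIn CoeffRing • GX X l) := by
  refine dividedDiff_GX_eq_neg fun n hn K _ _ f y hf hy => ?_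
  rw [eval₂_simpleReflAct_zero hX l n hf hy, rowSum_coeffAct_zero f hX _
    (zero_notMem_map_succEmb n _) rfl (fun k hk => (cons_bInt_one_isGeneralPoint hf hy n).injective.ne
      fun h => zero_notMem_map_succEmb n _ (h ▸ hk)), rowSum_cons,
    eval₂_GX l hn f (hy.isGeneralPoint n).injective]
  intro k hk
  have h1 := l.pos k hk
  have h2 : k ≠ 1 := fun h' => h (h' ▸ hk)
  omega

theorem eval₂_simpleReflAct_D_zero (l : StrictPartition) {n : ℕ} (hn : Even n)
    {K : Type} [Field K] [CharZero K] {f : CoeffRing →+* K} (hf : Function.Injective f)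
    {y : ℕ → K} (hy : IsGenericSeq f (betaIn CoeffRing) y) :
    (simpleReflAct LieType.D 0 (GX LieType.D l) n).eval₂ f (fun i : Fin n => y i) =
      rowSum (f (betaIn CoeffRing)) (Fin.cons (f (bInt 2))
        (Fin.cons (f (bInt 1)) (fun i : Fin n => y i) : Fin (n + 1) → K) : Fin (n + 2) → K)
        (fun _ => 1) (evalRows (f.comp (coeffAct LieType.D 0)) (gxRows LieType.D l.parts))
        ({1, 0} ∪ (Finset.univ.map (Fin.succEmb n)).map (Fin.succEmb (n + 1))) := by
  rw [simpleReflAct_D_zero, eval₂_setFirst, eval₂_setFirst, ← univ_eq_pair_union]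
  exact eval₂_map_coeffAct_GX 0 l (fun _ => hn.add even_two) f
    (cons_bInt_two_isGeneralPoint hf hy n).injective

theorem rowSum_cons_cons {K : Type*} [Field K] (β : K) {n : ℕ} (y : Fin n → K) (a b : K)
    (ps : List (K → K)) :
    rowSum β (Fin.cons b (Fin.cons a y : Fin (n + 1) → K) : Fin (n + 2) → K) (fun _ => 1) ps
      ((Finset.univ.map (Fin.succEmb n)).map (Fin.succEmb (n + 1))) =
      rowSum β y (fun _ => 1) ps Finset.univ := by
  rw [rowSum_map, ← rowSum_cons β y a]
  rfl

theorem disjoint_pair_map_succEmb (n : ℕ) : Disjoint {1, 0}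
    (((Finset.univ : Finset (Fin n)).map (Fin.succEmb n)).map (Fin.succEmb (n + 1))) := by
  rw [Finset.disjoint_left]
  intro k hk
  rcases Finset.mem_insert.1 hk with rfl | hk
  · rw [show (1 : Fin (n + 2)) = Fin.succEmb (n + 1) 0 from rfl, Finset.mem_map']
    exact zero_notMem_map_succEmb n _
  · rw [Finset.mem_singleton.1 hk]
    exact zero_notMem_map_succEmb (n + 1) _

theorem dividedDiff_D_zero_of_odd {l m : StrictPartition} (h : IsLowering 1 l m)
    (hl : Odd l.length) : dividedDiff LieType.D 0 (GX LieType.D l) = GX LieType.D m := by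
  obtain ⟨pre, post, hp, hm⟩ := h
  obtain rfl := StrictPartition.post_eq_nil hp
  rw [if_pos rfl, List.append_nil] at hm
  refine dividedDiff_GX_eq fun n hn K _ _ f y hf hy => ?_
  rw [eval₂_simpleReflAct_D_zero l (hn rfl) hf hy, hp, rowSum_coeffAct_D_zero_append_one_even f
    (map_beta_ne_zero hf) (cons_bInt_two_isGeneralPoint hf hy n) rfl rfl (by simp)
    (disjoint_pair_map_succEmb n) (StrictPartition.lt_of_parts_eq hp).1, rowSum_cons_cons,
    rowSum_cons_cons, eval₂_GX l hn f (hy.isGeneralPoint n).injective,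
    eval₂_GX m hn f (hy.isGeneralPoint n).injective, hp, hm]
  · simpa using hn rfl
  · rw [StrictPartition.length, hp] at hl
    simpa [Nat.odd_add_one] using hl

theorem dividedDiff_D_zero_of_even {l : StrictPartition} (h : 1 ∈ l.parts) (hl : Even l.length) :
    dividedDiff LieType.D 0 (GX LieType.D l) = -(betaIn CoeffRing • GX LieType.D l) := by
  obtain ⟨pre, hp, h2⟩ := l.exists_append_one h
  refine dividedDiff_GX_eq_neg fun n hn K _ _ f y hf hy => ?_
  rw [eval₂_simpleReflAct_D_zero l (hn rfl) hf hy, hp, rowSum_coeffAct_D_zero_append_one_odd f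
    (map_beta_ne_zero hf) (cons_bInt_two_isGeneralPoint hf hy n) rfl rfl (by simp)
    (disjoint_pair_map_succEmb n) h2, rowSum_cons_cons,
    eval₂_GX l hn f (hy.isGeneralPoint n).injective, hp]
  · simpa using hn rfl
  · rw [StrictPartition.length, hp] at hl
    simpa [Nat.even_add_one] using hl

theorem dividedDiff_D_zero_of_notMem {l : StrictPartition} (h : 1 ∉ l.parts) :
    dividedDiff LieType.D 0 (GX LieType.D l) = -(betaIn CoeffRing • GX LieType.D l) := by
  refine dividedDiff_GX_eq_neg fun n hn K _ _ f y hf hy => ?_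
  have hd := disjoint_pair_map_succEmb n
  have h1 := Finset.disjoint_left.1 hd (show (1 : Fin (n + 2)) ∈ _ by simp)
  have h0 := Finset.disjoint_left.1 hd (show (0 : Fin (n + 2)) ∈ _ by simp)
  have hne : ∀ k ∈ (Finset.univ.map (Fin.succEmb n)).map (Fin.succEmb (n + 1)), k ≠ 1 ∧ k ≠ 0 :=
    fun k hk => ⟨fun e => h1 (e ▸ hk), fun e => h0 (e ▸ hk)⟩
  have hinj := (cons_bInt_two_isGeneralPoint hf hy n).injective
  rw [eval₂_simpleReflAct_D_zero l (hn rfl) hf hy, rowSum_coeffAct_D_zero f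
    (o := (1 : Fin (n + 2))) (o' := 0) _ (by simp) h1 h0 rfl rfl
    (fun k hk => ⟨hinj.ne (hne k hk).1, hinj.ne (hne k hk).2⟩), rowSum_cons_cons,
    eval₂_GX l hn f (hy.isGeneralPoint n).injective]
  intro k hk
  have h1 := l.pos k hk
  have h2 : k ≠ 1 := fun h' => h (h' ▸ hk)
  omega

/-- The condition `hi` excludes only s_1 in type D, where a part 1 disappears and the parity
argument is needed. -/
theorem dividedDiff_succ_of_isLowering {X : LieType} {i : ℕ} {l m : StrictPartition}
    (hi : i + rowShift X ≠ 0) (h : IsLowering (i + 1 + rowShift X) l m) :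
    dividedDiff X (i + 1) (GX X l) = GX X m := by
  obtain ⟨pre, post, hl, hm⟩ := h
  rw [if_neg (by omega), show i + 1 + rowShift X - 1 = i + rowShift X by omega] at hm
  exact dividedDiff_succ_of_mem hl fun n hn K _ _ f y hf hy => by rw [hm]

theorem dividedDiff_GX_of_isLowerable {X : LieType} {i : ℕ} {l m : StrictPartition}
    (h : IsLowerable X i l) (hm : IsLowering (rootPart X i) l m) :
    dividedDiff X i (GX X l) = GX X m := by
  match X, i with
  | LieType.D, 0 => exact dividedDiff_D_zero_of_odd hm h.2
  | LieType.D, 1 => exact dividedDiff_D_one_of_even hm h.2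
  | LieType.D, i + 2 => exact dividedDiff_succ_of_isLowering (i := i + 1) (by simp [rowShift]) hm
  | LieType.B, 0 => exact dividedDiff_zero_of_mem (by simp) hm
  | LieType.B, i + 1 => exact dividedDiff_succ_of_isLowering (by simp [rowShift]) hm
  | LieType.C, 0 => exact dividedDiff_zero_of_mem (by simp) hm
  | LieType.C, i + 1 => exact dividedDiff_succ_of_isLowering (by simp [rowShift]) hm

theorem dividedDiff_GX_of_not_isLowerable {X : LieType} {i : ℕ} {l : StrictPartition}
    (h : ¬ IsLowerable X i l) : dividedDiff X i (GX X l) = -(betaIn CoeffRing • GX X l) := by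
  have key : ∀ j, ¬ (j + 1 + rowShift X ∈ l.parts ∧ j + rowShift X ∉ l.parts) →
      dividedDiff X (j + 1) (GX X l) = -(betaIn CoeffRing • GX X l) := fun j hj => by
    by_cases h1 : j + 1 + rowShift X ∈ l.parts
    · exact dividedDiff_succ_of_pair h1 (by tauto)
    · exact dividedDiff_succ_of_notMem h1
  match X, i with
  | LieType.D, 0 =>
    by_cases h1 : 1 ∈ l.parts
    · exact dividedDiff_D_zero_of_even h1 (Nat.not_odd_iff_even.1 fun h2 => h ⟨h1, h2⟩)
    · exact dividedDiff_D_zero_of_notMem h1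
  | LieType.D, 1 =>
    by_cases h1 : 1 ∈ l.parts
    · exact dividedDiff_D_one_of_odd h1 (Nat.not_even_iff_odd.1 fun h2 => h ⟨h1, h2⟩)
    · exact dividedDiff_succ_of_notMem (i := 0) h1
  | LieType.D, i + 2 => exact key (i + 1) h
  | LieType.B, 0 => exact dividedDiff_zero_of_notMem (by simp) h
  | LieType.B, i + 1 => exact key i h
  | LieType.C, 0 => exact dividedDiff_zero_of_notMem (by simp) h
  | LieType.C, i + 1 => exact key i h

end RemovalFormula

/-! ### Left multiplication by s_i on sets of barred values. -/

section NegativeSets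

/-- `N` is the set of the `k > 0` with `\bar k ∈ w({1, 2, …})`. -/
def IsNegSet (w : Equiv.Perm ℤ) (N : Finset ℤ) : Prop := ∀ k, k ∈ N ↔ 0 < k ∧ w⁻¹ k < 0

/-- `s_i` lowers the set `N` of barred values to `N'`. -/
def IsDrop : LieType → ℕ → Finset ℤ → Finset ℤ → Prop
  | LieType.D, 0, N, N' => 1 ∈ N ∧ 2 ∈ N ∧ N' = (N.erase 1).erase 2
  | _, 0, N, N' => 1 ∈ N ∧ N' = N.erase 1
  | _, i + 1, N, N' => (i : ℤ) + 2 ∈ N ∧ (i : ℤ) + 1 ∉ N ∧ N' = insert ((i : ℤ) + 1) (N.erase (i + 2))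

/-- The length of the Grassmannian element with set `N` of barred values. -/
def negWeight (X : LieType) (N : Finset ℤ) : ℤ := ∑ k ∈ N, (k - 1 + rowShift X)

theorem isDrop_succ {X : LieType} {i : ℕ} {N N' : Finset ℤ} : IsDrop X (i + 1) N N' ↔
    (i : ℤ) + 2 ∈ N ∧ (i : ℤ) + 1 ∉ N ∧ N' = insert ((i : ℤ) + 1) (N.erase (i + 2)) := by
  cases X <;> rfl

theorem isDrop_zero {X : LieType} (hX : X ≠ LieType.D) {N N' : Finset ℤ} : IsDrop X 0 N N' ↔
    1 ∈ N ∧ N' = N.erase 1 := by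
  cases X
  · rfl
  · rfl
  · exact absurd rfl hX

theorem isDrop_D_zero {N N' : Finset ℤ} : IsDrop LieType.D 0 N N' ↔
    1 ∈ N ∧ 2 ∈ N ∧ N' = (N.erase 1).erase 2 := Iff.rfl

theorem simpleRefl_succ_eq (X : LieType) (i : ℕ) : simpleRefl X (i + 1) = signedGen (i + 1) := by
  cases X <;> rfl

theorem simpleRefl_zero_eq {X : LieType} (hX : X ≠ LieType.D) : simpleRefl X 0 = signedGen 0 := by
  cases X
  · rfl
  · rfl
  · exact absurd rfl hX

theorem simpleRefl_cases {p : LieType → ℕ → Prop} (zero : ∀ X, X ≠ LieType.D → p X 0)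
    (zero_D : p LieType.D 0) (succ : ∀ X i, p X (i + 1)) (X : LieType) (i : ℕ) : p X i := by
  cases i with
  | succ i => exact succ X i
  | zero =>
    cases X
    · exact zero _ (by simp)
    · exact zero _ (by simp)
    · exact zero_D

theorem simpleRefl_neg (X : LieType) (i : ℕ) (k : ℤ) :
    simpleRefl X i (-k) = -simpleRefl X i k := by
  induction X, i using simpleRefl_cases with
  | zero X hX =>
    rw [simpleRefl_zero_eq hX, signedGen_neg]
  | zero_D =>
    rw [simpleRefl_D_zero_apply, simpleRefl_D_zero_apply]
    split_ifs <;> omega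
  | succ X i =>
    rw [simpleRefl_succ_eq, signedGen_neg]

theorem simpleRefl_self (X : LieType) (i : ℕ) (k : ℤ) :
    simpleRefl X i (simpleRefl X i k) = k := by
  induction X, i using simpleRefl_cases with
  | zero X hX =>
    rw [simpleRefl_zero_eq hX, signedGen_zero_apply, signedGen_zero_apply]
    grind
  | zero_D =>
    rw [simpleRefl_D_zero_apply, simpleRefl_D_zero_apply]
    grind
  | succ X i =>
    rw [simpleRefl_succ_eq, signedGen_succ_apply, signedGen_succ_apply]
    grind

theorem simpleRefl_mul_self (X : LieType) (i : ℕ) : simpleRefl X i * simpleRefl X i = 1 :=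
  Equiv.ext fun k => simpleRefl_self X i k

theorem inv_simpleRefl_mul_apply (X : LieType) (i : ℕ) (w : Equiv.Perm ℤ) (k : ℤ) :
    (simpleRefl X i * w)⁻¹ k = w⁻¹ (simpleRefl X i k) := by
  rw [mul_inv_rev, inv_eq_of_mul_eq_one_left (simpleRefl_mul_self X i), Equiv.Perm.mul_apply]

theorem inv_neg_apply {w : Equiv.Perm ℤ} (hw : ∀ k, w (-k) = -w k) (k : ℤ) :
    w⁻¹ (-k) = -w⁻¹ k := by
  rw [Equiv.Perm.inv_eq_iff_eq, hw]
  simp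

theorem inv_apply_ne_zero {w : Equiv.Perm ℤ} (hw : ∀ k, w (-k) = -w k) {k : ℤ} (hk : k ≠ 0) :
    w⁻¹ k ≠ 0 := by
  intro h
  have h1 := inv_neg_apply hw k
  rw [h, neg_zero, ← h] at h1
  have := (w⁻¹).injective h1
  omega

theorem IsDrop.isNegSet {X : LieType} {i : ℕ} {N N' : Finset ℤ} (h : IsDrop X i N N')
    {w : Equiv.Perm ℤ} (hw : ∀ k, w (-k) = -w k) (hN : IsNegSet w N) :
    IsNegSet (simpleRefl X i * w) N' := by
  have h1 := inv_neg_apply hw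
  have h2 := fun k => inv_apply_ne_zero hw (k := k)
  intro k
  rw [inv_simpleRefl_mul_apply]
  revert h
  induction X, i using simpleRefl_cases with
  | zero X hX =>
    rw [simpleRefl_zero_eq hX, signedGen_zero_apply, isDrop_zero hX]
    rintro ⟨h, rfl⟩
    have := hN 1
    have := h1 1
    rw [Finset.mem_erase, hN]
    split_ifs <;> grind
  | zero_D =>
    rw [simpleRefl_D_zero_apply, isDrop_D_zero]
    rintro ⟨h, h', rfl⟩
    have := hN 1
    have := hN 2
    have := h1 1
    have := h1 2
    rw [Finset.mem_erase, Finset.mem_erase, hN]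
    split_ifs <;> grind
  | succ X i =>
    rw [simpleRefl_succ_eq, signedGen_succ_apply, isDrop_succ]
    rintro ⟨h, h', rfl⟩
    have := hN (i + 1)
    have := hN (i + 2)
    rw [Finset.mem_insert, Finset.mem_erase, hN]
    split_ifs <;> grind

theorem IsDrop.isNegSet_symm {X : LieType} {i : ℕ} {N N' : Finset ℤ} (h : IsDrop X i N' N)
    {w : Equiv.Perm ℤ} (hw : ∀ k, w (-k) = -w k) (hN : IsNegSet w N)
    (hpos : ∀ k ∈ N', 0 < k) : IsNegSet (simpleRefl X i * w) N' := by
  have h1 := inv_neg_apply hw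
  have h2 := fun k => inv_apply_ne_zero hw (k := k)
  intro k
  rw [inv_simpleRefl_mul_apply]
  revert h
  have hk := hN k
  have hk' := hpos k
  induction X, i using simpleRefl_cases with
  | zero X hX =>
    rw [simpleRefl_zero_eq hX, signedGen_zero_apply, isDrop_zero hX]
    rintro ⟨h, rfl⟩
    have := hN 1
    have := h1 1
    have := h2 1
    rw [Finset.mem_erase] at *
    split_ifs <;> grind
  | zero_D =>
    rw [simpleRefl_D_zero_apply, isDrop_D_zero]
    rintro ⟨h, h', rfl⟩
    have := hN 1
    have := hN 2
    have := h1 1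
    have := h1 2
    have := h2 1
    have := h2 2
    rw [Finset.mem_erase, Finset.mem_erase] at *
    split_ifs <;> grind
  | succ X i =>
    rw [simpleRefl_succ_eq, signedGen_succ_apply, isDrop_succ]
    rintro ⟨h, h', rfl⟩
    have := hN (i + 1)
    have := hN (i + 2)
    rw [Finset.mem_insert, Finset.mem_erase] at *
    split_ifs <;> grind

/-- The third case besides lowering and raising: s_i exchanges two values with the same or, for \hat
1, opposite barredness, and N stays the same. For s_0 in types B and C this case does not occur. -/
theorem isNegSet_of_not_isDrop {X : LieType} {i : ℕ} {N : Finset ℤ}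
    (h : ¬ ∃ N', IsDrop X i N N') (h' : ¬ ∃ N', (∀ k ∈ N', 0 < k) ∧ IsDrop X i N' N)
    {w : Equiv.Perm ℤ} (hw : ∀ k, w (-k) = -w k) (hN : IsNegSet w N) :
    IsNegSet (simpleRefl X i * w) N := by
  have h1 := inv_neg_apply hw
  have h2 := fun k => inv_apply_ne_zero hw (k := k)
  have hpos : ∀ k ∈ N, 0 < k := fun k hk => ((hN k).1 hk).1
  intro k
  rw [inv_simpleRefl_mul_apply]
  revert h h'
  have hk := hN k
  induction X, i using simpleRefl_cases with
  | zero X hX =>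
    rw [simpleRefl_zero_eq hX, signedGen_zero_apply]
    intro h h'
    exfalso
    by_cases h3 : 1 ∈ N
    · exact h ⟨_, (isDrop_zero hX).2 ⟨h3, rfl⟩⟩
    · exact h' ⟨insert 1 N, by simpa using hpos, (isDrop_zero hX).2 ⟨by simp, by simp [h3]⟩⟩
  | zero_D =>
    rw [simpleRefl_D_zero_apply]
    intro h h'
    have h3 : ¬ (1 ∈ N ∧ 2 ∈ N) := fun h3 => h ⟨_, isDrop_D_zero.2 ⟨h3.1, h3.2, rfl⟩⟩
    have h4 : ¬ (1 ∉ N ∧ 2 ∉ N) := fun h4 => h' ⟨insert 1 (insert 2 N), by simpa using hpos,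
      isDrop_D_zero.2 ⟨by simp, by simp, by
        rw [Finset.erase_insert (by simp [h4.1]), Finset.erase_insert h4.2]⟩⟩
    have := hN 1
    have := hN 2
    have := h1 1
    have := h1 2
    have := h2 1
    have := h2 2
    split_ifs <;> grind
  | succ X i =>
    rw [simpleRefl_succ_eq, signedGen_succ_apply]
    intro h h'
    have h3 : ¬ ((i : ℤ) + 2 ∈ N ∧ (i : ℤ) + 1 ∉ N) := fun h3 =>
      h ⟨_, isDrop_succ.2 ⟨h3.1, h3.2, rfl⟩⟩
    have h4 : ¬ ((i : ℤ) + 1 ∈ N ∧ (i : ℤ) + 2 ∉ N) := fun h4 =>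
      h' ⟨insert ((i : ℤ) + 2) (N.erase (i + 1)), by
        intro k hk
        rw [Finset.mem_insert, Finset.mem_erase] at hk
        rcases hk with rfl | hk
        · omega
        · exact hpos k hk.2, isDrop_succ.2 ⟨by simp, by simp, by
          rw [Finset.erase_insert (by simp [h4.2]), Finset.insert_erase h4.1]⟩⟩
    have := hN (i + 1)
    have := hN (i + 2)
    split_ifs <;> grind

/-- Left multiplication by s_i can break the increasing order only if two values that it
interchanges both occur at positive positions, and then N does not change. So a move of N keeps the
element Grassmannian. -/
theorem strictMonoOn_simpleRefl_mul {X : LieType} {i : ℕ} {N N' : Finset ℤ}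
    (h : IsDrop X i N N' ∨ IsDrop X i N' N) {w : Equiv.Perm ℤ} (hw : ∀ k, w (-k) = -w k)
    (hN : IsNegSet w N) (hmono : StrictMonoOn w (Set.Ioi 0)) :
    StrictMonoOn (simpleRefl X i * w) (Set.Ioi 0) := by
  have h1 := inv_neg_apply hw
  intro m hm n hn hmn
  have hab := hmono hm hn hmn
  rw [Set.mem_Ioi] at hm hn
  have ha : w⁻¹ (w m) = m := by simp
  have hb : w⁻¹ (w n) = n := by simp
  rw [Equiv.Perm.mul_apply, Equiv.Perm.mul_apply]
  generalize w m = a at *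
  generalize w n = b at *
  revert h
  induction X, i using simpleRefl_cases with
  | zero X hX =>
    rw [simpleRefl_zero_eq hX, signedGen_zero_apply, signedGen_zero_apply]
    intro _
    have := h1 1
    split_ifs <;> grind
  | zero_D =>
    rw [simpleRefl_D_zero_apply, simpleRefl_D_zero_apply, isDrop_D_zero, isDrop_D_zero]
    intro h
    have h3 : 1 ∈ N ↔ 2 ∈ N := by
      rcases h with ⟨h, h', rfl⟩ | ⟨h, h', rfl⟩
      · tauto
      · simp
    have := hN 1
    have := hN 2
    have := h1 1
    have := h1 2
    split_ifs <;> grind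
  | succ X i =>
    rw [simpleRefl_succ_eq, signedGen_succ_apply, signedGen_succ_apply, isDrop_succ, isDrop_succ]
    intro h
    have h3 : (i : ℤ) + 2 ∈ N ↔ (i : ℤ) + 1 ∉ N := by
      rcases h with ⟨h, h', rfl⟩ | ⟨h, h', rfl⟩
      · tauto
      · simp
    have := hN (i + 1)
    have := hN (i + 2)
    have := h1 (i + 1)
    have := h1 (i + 2)
    split_ifs <;> grind

end NegativeSets

/-! ### Words, lengths, and the Grassmannian element of a set. -/

section Words

theorem IsNegSet.pos {w : Equiv.Perm ℤ} {N : Finset ℤ} (h : IsNegSet w N) : ∀ k ∈ N, 0 < k :=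
  fun k hk => ((h k).1 hk).1

theorem IsNegSet.unique {w : Equiv.Perm ℤ} {N N' : Finset ℤ} (h : IsNegSet w N)
    (h' : IsNegSet w N') : N = N' :=
  Finset.ext fun k => (h k).trans (h' k).symm

theorem rowShift_of_ne {X : LieType} (hX : X ≠ LieType.D) : rowShift X = 1 := by
  cases X
  · rfl
  · rfl
  · exact absurd rfl hX

theorem IsDrop.negWeight_eq {X : LieType} {i : ℕ} {N N' : Finset ℤ} (h : IsDrop X i N N') :
    negWeight X N' + 1 = negWeight X N := by
  rw [negWeight, negWeight]
  induction X, i using simpleRefl_cases with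
  | zero X hX =>
    obtain ⟨e, rfl⟩ := (isDrop_zero hX).1 h
    rw [Finset.sum_erase_eq_sub e, rowShift_of_ne hX]
    simp
  | zero_D =>
    obtain ⟨e, e', rfl⟩ := isDrop_D_zero.1 h
    rw [Finset.sum_erase_eq_sub (by simpa using e'), Finset.sum_erase_eq_sub e]
    simp [rowShift]
  | succ X i =>
    obtain ⟨e, e', rfl⟩ := isDrop_succ.1 h
    rw [Finset.sum_insert (by simp [e']), Finset.sum_erase_eq_sub e]
    ring

theorem IsDrop.even_card_iff {i : ℕ} {N N' : Finset ℤ} (h : IsDrop LieType.D i N N') :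
    Even N.card ↔ Even N'.card := by
  cases i with
  | zero =>
    obtain ⟨e, e', rfl⟩ := isDrop_D_zero.1 h
    have h1 := Finset.card_erase_add_one e
    have h2 := Finset.card_erase_add_one (show 2 ∈ N.erase 1 by simpa using e')
    rw [← h1, ← h2]
    simp [Nat.even_add_one]
  | succ i =>
    obtain ⟨e, e', rfl⟩ := isDrop_succ.1 h
    rw [Finset.card_insert_of_notMem (by simp [e']), Finset.card_erase_add_one e]

theorem IsDrop.pos {X : LieType} {i : ℕ} {N N' : Finset ℤ} (h : IsDrop X i N N')
    (hN : ∀ k ∈ N, 0 < k) : ∀ k ∈ N', 0 < k := by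
  intro k hk
  induction X, i using simpleRefl_cases with
  | zero X hX =>
    obtain ⟨e, rfl⟩ := (isDrop_zero hX).1 h
    exact hN k (Finset.mem_of_mem_erase hk)
  | zero_D =>
    obtain ⟨e, e', rfl⟩ := isDrop_D_zero.1 h
    exact hN k (Finset.mem_of_mem_erase (Finset.mem_of_mem_erase hk))
  | succ X i =>
    obtain ⟨e, e', rfl⟩ := isDrop_succ.1 h
    rcases Finset.mem_insert.1 hk with rfl | hk
    · omega
    · exact hN k (Finset.mem_of_mem_erase hk)

theorem mul_simpleRefl_neg (X : LieType) (i : ℕ) {w : Equiv.Perm ℤ} (hw : ∀ k, w (-k) = -w k)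
    (k : ℤ) : (simpleRefl X i * w) (-k) = -(simpleRefl X i * w) k := by
  rw [Equiv.Perm.mul_apply, Equiv.Perm.mul_apply, hw, simpleRefl_neg]

theorem isNegSet_one : IsNegSet 1 ∅ := by
  intro k
  simp
  omega

/-- Each letter changes the weight by at most one, which bounds the length from below by the weight.
In type D the moves preserve the parity of |N|. -/
theorem exists_isNegSet_word (X : LieType) (L : List ℕ) :
    (∀ k, (L.map (simpleRefl X)).prod (-k) = -(L.map (simpleRefl X)).prod k) ∧
    ∃ N, IsNegSet (L.map (simpleRefl X)).prod N ∧ (X = LieType.D → Even N.card) ∧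
      negWeight X N ≤ L.length := by
  induction L with
  | nil => exact ⟨by simp, ∅, isNegSet_one, by simp, by simp [negWeight]⟩
  | cons i L ih =>
    obtain ⟨hw, N, hN, hE, hW⟩ := ih
    rw [List.map_cons, List.prod_cons, List.length_cons]
    push_cast
    refine ⟨mul_simpleRefl_neg X i hw, ?_⟩
    by_cases h : ∃ N', IsDrop X i N N'
    · obtain ⟨N', h⟩ := h
      refine ⟨N', h.isNegSet hw hN, ?_, ?_⟩
      · rintro rfl
        exact h.even_card_iff.1 (hE rfl)
      · have := h.negWeight_eq
        omega
    · by_cases h' : ∃ N', (∀ k ∈ N', 0 < k) ∧ IsDrop X i N' N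
      · obtain ⟨N', hp, h'⟩ := h'
        refine ⟨N', h'.isNegSet_symm hw hN hp, ?_, ?_⟩
        · rintro rfl
          exact h'.even_card_iff.2 (hE rfl)
        · have := h'.negWeight_eq
          omega
      · exact ⟨N, isNegSet_of_not_isDrop h h' hw hN, hE, by omega⟩

/-- The smallest element k of nonzero weight can be lowered: either k - 1 is free, or k = 1 in types
B, C and s_0 removes it, or k = 2 with 1 in N in type D and \hat 1 removes both. -/
theorem exists_isDrop {X : LieType} {N : Finset ℤ} (hN : ∀ k ∈ N, 0 < k)
    (h : negWeight X N ≠ 0) : ∃ i N', IsDrop X i N N' := by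
  obtain ⟨k₀, hk₀, hne⟩ := Finset.exists_ne_zero_of_sum_ne_zero h
  obtain ⟨k, hk, hmin⟩ := (N.filter fun k : ℤ => k - 1 + (rowShift X : ℤ) ≠ 0).exists_min_image id
    ⟨k₀, by simpa using ⟨hk₀, hne⟩⟩
  rw [Finset.mem_filter] at hk
  have hk0 := hN k hk.1
  have hmin' : ∀ a ∈ N, a - 1 + rowShift X ≠ 0 → k ≤ a := fun a ha h =>
    hmin a (Finset.mem_filter.2 ⟨ha, h⟩)
  have hsucc : 2 ≤ k → k - 1 ∉ N → ∃ i N', IsDrop X i N N' := fun h2 h1 =>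
    ⟨(k - 2).toNat + 1, _, isDrop_succ.2 ⟨by
      rw [show ((k - 2).toNat : ℤ) + 2 = k by omega]; exact hk.1, by
      rwa [show ((k - 2).toNat : ℤ) + 1 = k - 1 by omega], rfl⟩⟩
  by_cases hX : X = LieType.D
  · subst hX
    have hs : rowShift LieType.D = 0 := rfl
    rw [hs] at hmin' hk
    have h2 : 2 ≤ k := by
      have := hk.2
      push_cast at this
      omega
    by_cases h1 : k = 2 ∧ 1 ∈ N
    · exact ⟨0, _, isDrop_D_zero.2 ⟨h1.2, h1.1 ▸ hk.1, rfl⟩⟩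
    · refine hsucc h2 fun h3 => ?_
      have h4 := hmin' (k - 1) h3
      push_cast at h4
      have h5 : k = 2 := by omega
      subst h5
      exact h1 ⟨rfl, h3⟩
  · rw [rowShift_of_ne hX] at hmin'
    by_cases h1 : k = 1
    · exact ⟨0, _, (isDrop_zero hX).2 ⟨h1 ▸ hk.1, rfl⟩⟩
    · refine hsucc (by omega) fun h3 => ?_
      have h4 := hmin' (k - 1) h3
      push_cast at h4
      omega

theorem negWeight_term_nonneg {X : LieType} {k : ℤ} (hk : 0 < k) : 0 ≤ k - 1 + rowShift X := by
  omega

theorem negWeight_nonneg {X : LieType} {N : Finset ℤ} (hN : ∀ k ∈ N, 0 < k) :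
    0 ≤ negWeight X N :=
  Finset.sum_nonneg fun k hk => negWeight_term_nonneg (hN k hk)

theorem eq_empty_of_negWeight_eq_zero {X : LieType} {N : Finset ℤ} (hN : ∀ k ∈ N, 0 < k)
    (hE : X = LieType.D → Even N.card) (h : negWeight X N = 0) : N = ∅ := by
  have h1 := (Finset.sum_eq_zero_iff_of_nonneg fun k hk => negWeight_term_nonneg (hN k hk)).1 h
  by_cases hX : X = LieType.D
  · subst hX
    have hs : rowShift LieType.D = 0 := rfl
    rw [hs] at h1
    have h2 : N ⊆ {1} := fun k hk => by
      have := h1 k hk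
      push_cast at this
      rw [Finset.mem_singleton]
      omega
    rcases Finset.subset_singleton_iff.1 h2 with h3 | h3
    · exact h3
    · have := hE rfl
      rw [h3] at this
      simp at this
  · rw [rowShift_of_ne hX] at h1
    refine Finset.eq_empty_of_forall_notMem fun k hk => ?_
    have := h1 k hk
    have := hN k hk
    push_cast at *
    omega

/-- Lowering N step by step to the empty set and reading the moves backwards gives a word with one
letter per unit of weight, Grassmannian at each stage. In type D, N = {1} has weight zero too, but
is excluded by parity. -/
theorem exists_word_of_negWeight (X : LieType) (n : ℕ) (N : Finset ℤ) (hN : ∀ k ∈ N, 0 < k)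
    (hE : X = LieType.D → Even N.card) (h : negWeight X N = n) : ∃ L : List ℕ, L.length = n ∧
      IsNegSet (L.map (simpleRefl X)).prod N ∧
      StrictMonoOn (L.map (simpleRefl X)).prod (Set.Ioi 0) := by
  induction n generalizing N with
  | zero =>
    obtain rfl := eq_empty_of_negWeight_eq_zero hN hE (by simpa using h)
    exact ⟨[], rfl, isNegSet_one, fun a _ b _ hab => by simpa using hab⟩
  | succ n ih =>
    obtain ⟨i, N', hd⟩ := exists_isDrop (X := X) hN (by rw [h]; push_cast; omega)
    obtain ⟨L, hL, hneg, hmono⟩ := ih N' (hd.pos hN) (fun hX => by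
      subst hX
      exact hd.even_card_iff.1 (hE rfl)) (by
      have := hd.negWeight_eq
      push_cast at h
      omega)
    have hw := (exists_isNegSet_word X L).1
    refine ⟨i :: L, by rw [List.length_cons, hL], ?_, ?_⟩
    · rw [List.map_cons, List.prod_cons]
      exact hd.isNegSet_symm hw hneg hN
    · rw [List.map_cons, List.prod_cons]
      exact strictMonoOn_simpleRefl_mul (.inr hd) hw hneg hmono

theorem IsNegSet.inv_pos_iff {w : Equiv.Perm ℤ} {N : Finset ℤ} (h : IsNegSet w N)
    (hw : ∀ k, w (-k) = -w k) (k : ℤ) :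
    0 < w⁻¹ k ↔ (0 < k ∧ k ∉ N) ∨ (k < 0 ∧ -k ∈ N) := by
  have h0 : w⁻¹ 0 = 0 := by
    have := inv_neg_apply hw 0
    rw [neg_zero] at this
    omega
  have h1 := inv_neg_apply hw k
  have h2 := inv_apply_ne_zero hw (k := k)
  have h3 := h k
  have h4 := h (-k)
  by_cases hk : k = 0
  · subst hk
    simp [h0]
  · have := h2 hk
    rw [h3, h4, h1]
    omega

/-- The set N determines the image of the positive integers, and an increasing enumeration is
determined by its range; oddness gives the rest. -/
theorem eq_of_isNegSet {w w' : Equiv.Perm ℤ} {N : Finset ℤ} (hw : ∀ k, w (-k) = -w k)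
    (hw' : ∀ k, w' (-k) = -w' k) (hN : IsNegSet w N) (hN' : IsNegSet w' N)
    (hm : StrictMonoOn w (Set.Ioi 0)) (hm' : StrictMonoOn w' (Set.Ioi 0)) : w = w' := by
  have hmono : ∀ {w : Equiv.Perm ℤ}, StrictMonoOn w (Set.Ioi 0) →
      StrictMono fun n : ℕ => w ((n : ℤ) + 1) := fun hm a b hab =>
    hm (Set.mem_Ioi.2 (by omega)) (Set.mem_Ioi.2 (by omega)) (by omega)
  have hrange : ∀ {w : Equiv.Perm ℤ} (k : ℤ), k ∈ Set.range (fun n : ℕ => w ((n : ℤ) + 1)) ↔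
      0 < w⁻¹ k := fun {w} k => by
    constructor
    · rintro ⟨n, rfl⟩
      simp only [Equiv.Perm.coe_inv, Equiv.symm_apply_apply]
      omega
    · intro h
      refine ⟨(w⁻¹ k - 1).toNat, ?_⟩
      dsimp only
      rw [show ((w⁻¹ k - 1).toNat : ℤ) + 1 = w⁻¹ k by omega]
      simp
  have h1 := ((hmono hm).range_inj (hmono hm')).1 (Set.ext fun k => by
    rw [hrange, hrange, hN.inv_pos_iff hw, hN'.inv_pos_iff hw'])
  have h2 : ∀ k : ℤ, 0 < k → w k = w' k := fun k hk => by
    have := congrFun h1 (k - 1).toNat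
    rwa [show ((k - 1).toNat : ℤ) + 1 = k by omega] at this
  refine Equiv.ext fun k => ?_
  rcases lt_trichotomy k 0 with hk | rfl | hk
  · have := h2 (-k) (by omega)
    rw [hw, hw'] at this
    omega
  · have e := hw 0
    have e' := hw' 0
    rw [neg_zero] at e e'
    omega
  · exact h2 k hk

theorem exists_word_of_mem_weylGroup {X : LieType} {w : Equiv.Perm ℤ} (hw : w ∈ weylGroup X) :
    ∃ L : List ℕ, (L.map (simpleRefl X)).prod = w := by
  induction hw using Subgroup.closure_induction with
  | mem w hw =>
    obtain ⟨i, rfl⟩ := hw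
    exact ⟨[i], by simp⟩
  | one => exact ⟨[], rfl⟩
  | mul u v _ _ hu hv =>
    obtain ⟨L, rfl⟩ := hu
    obtain ⟨L', rfl⟩ := hv
    exact ⟨L ++ L', by simp⟩
  | inv u _ hu =>
    obtain ⟨L, rfl⟩ := hu
    refine ⟨L.reverse, ?_⟩
    rw [List.prod_inv_reverse, List.map_map, List.map_reverse]
    congr 2
    refine List.map_congr_left fun i _ => ?_
    exact (inv_eq_of_mul_eq_one_left (simpleRefl_mul_self X i)).symm

theorem word_mem_weylGroup (X : LieType) (L : List ℕ) :
    (L.map (simpleRefl X)).prod ∈ weylGroup X := by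
  refine Subgroup.list_prod_mem _ fun w hw => ?_
  obtain ⟨i, -, rfl⟩ := List.mem_map.1 hw
  exact Subgroup.subset_closure ⟨i, rfl⟩

/-- The constructed word attains the weight, and no word for w can be shorter. -/
theorem weylLength_eq {X : LieType} {w : Equiv.Perm ℤ} {N : Finset ℤ} (hw : ∀ k, w (-k) = -w k)
    (hN : IsNegSet w N) (hE : X = LieType.D → Even N.card) (hm : StrictMonoOn w (Set.Ioi 0)) :
    (weylLength X w : ℤ) = negWeight X N := by
  obtain ⟨n, hn⟩ := Int.eq_ofNat_of_zero_le (negWeight_nonneg (X := X) hN.pos)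
  obtain ⟨L, hL, hLN, hLm⟩ := exists_word_of_negWeight X n N hN.pos hE hn
  have hprod := eq_of_isNegSet (exists_isNegSet_word X L).1 hw hLN hN hLm hm
  rw [hn]
  refine congrArg _ (le_antisymm (Nat.sInf_le ⟨L, hL, hprod⟩) (le_csInf ⟨_, L, rfl, hprod⟩ ?_))
  rintro k ⟨L', rfl, rfl⟩
  obtain ⟨-, N', hN', -, hle⟩ := exists_isNegSet_word X L'
  rw [hN.unique hN'] at hn
  rw [hn] at hle
  exact_mod_cast hle

end Words

/-! ### Strict partitions as sets of barred values. -/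

section Partitions

/-- The strict partition `l` corresponds to the set `N` of barred values. -/
def IsPartitionOfSet (X : LieType) (l : StrictPartition) (N : Finset ℤ) : Prop :=
  ∀ k : ℕ, k ∈ l.parts ↔ 0 < k ∧ (k : ℤ) + 1 - rowShift X ∈ N

theorem StrictPartition.nodup (l : StrictPartition) : l.parts.Nodup :=
  l.decreasing.imp fun h => h.ne'

theorem StrictPartition.eq_of_mem_iff {l m : StrictPartition}
    (h : ∀ k, k ∈ l.parts ↔ k ∈ m.parts) : l = m := by
  have h1 := (List.perm_ext_iff_of_nodup l.nodup m.nodup).2 h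
  have h2 : l.parts = m.parts := h1.eq_of_pairwise (fun a b _ _ h h' => by omega)
    l.decreasing m.decreasing
  cases l
  cases m
  cases h2
  rfl

theorem exists_strictPartition (S : Finset ℕ) (hS : 0 ∉ S) :
    ∃ l : StrictPartition, ∀ k, k ∈ l.parts ↔ k ∈ S :=
  ⟨⟨S.sort (· ≥ ·), S.sortedGT_sort.pairwise, fun p hp => by
    rw [Finset.mem_sort] at hp
    exact Nat.pos_of_ne_zero fun h => hS (h ▸ hp)⟩, fun k => Finset.mem_sort _⟩

theorem exists_isPartitionOfSet (X : LieType) (N : Finset ℤ) :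
    ∃ l, IsPartitionOfSet X l N := by
  obtain ⟨l, hl⟩ := exists_strictPartition
    ((N.image fun k : ℤ => (k - 1 + (rowShift X : ℤ)).toNat).filter (0 < ·)) (by simp)
  refine ⟨l, fun k => ?_⟩
  rw [hl, Finset.mem_filter, Finset.mem_image]
  constructor
  · rintro ⟨⟨a, ha, rfl⟩, hk⟩
    refine ⟨hk, ?_⟩
    rwa [show ((a - 1 + rowShift X).toNat : ℤ) + 1 - rowShift X = a by omega]
  · rintro ⟨hk, h⟩
    exact ⟨⟨_, h, by omega⟩, hk⟩

theorem StrictPartition.length_eq_card (l : StrictPartition) :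
    l.length = l.parts.toFinset.card := (List.toFinset_card_of_nodup l.nodup).symm

theorem IsPartitionOfSet.length_D {l : StrictPartition} {N : Finset ℤ}
    (h : IsPartitionOfSet LieType.D l N) (hN : ∀ k ∈ N, 0 < k) :
    l.length = (N.erase 1).card := by
  rw [l.length_eq_card]
  have hs : rowShift LieType.D = 0 := rfl
  refine Finset.card_bij (fun k _ => (k : ℤ) + 1) (fun k hk => ?_) (fun a _ b _ h => by omega)
    fun b hb => ?_
  · have h1 := (h k).1 (List.mem_toFinset.1 hk)
    rw [hs] at h1
    rw [Finset.mem_erase]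
    exact ⟨by omega, by simpa using h1.2⟩
  · rw [Finset.mem_erase] at hb
    have h1 := hN b hb.2
    refine ⟨(b - 1).toNat, List.mem_toFinset.2 ((h _).2 ⟨by omega, ?_⟩), by omega⟩
    rw [hs, show ((b - 1).toNat : ℤ) + 1 - (0 : ℕ) = b by omega]
    exact hb.2

theorem exists_set_isPartitionOfSet (X : LieType) (l : StrictPartition) :
    ∃ N : Finset ℤ, (∀ k ∈ N, 0 < k) ∧ (X = LieType.D → Even N.card) ∧ IsPartitionOfSet X l N := by
  have hr : rowShift X ≤ 1 := by cases X <;> simp [rowShift]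
  set N₀ : Finset ℤ := l.parts.toFinset.image fun k : ℕ => (k : ℤ) + 1 - rowShift X with hN₀
  have hmem : ∀ k : ℤ, k ∈ N₀ ↔ ∃ j ∈ l.parts, (j : ℤ) + 1 - rowShift X = k := fun k => by
    simp [hN₀]
  have hpos : ∀ k ∈ N₀, 0 < k := fun k hk => by
    obtain ⟨j, hj, rfl⟩ := (hmem k).1 hk
    have := l.pos j hj
    omega
  have hpart : IsPartitionOfSet X l N₀ := fun k => by
    rw [hmem]
    constructor
    · exact fun hk => ⟨l.pos k hk, k, hk, rfl⟩
    · rintro ⟨-, j, hj, h⟩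
      rwa [show k = j by omega]
  by_cases hE : X = LieType.D → Even N₀.card
  · exact ⟨N₀, hpos, hE, hpart⟩
  · push Not at hE
    obtain ⟨rfl, hodd⟩ := hE
    have h1 : (1 : ℤ) ∉ N₀ := fun h => by
      obtain ⟨j, hj, hj'⟩ := (hmem 1).1 h
      have := l.pos j hj
      have hs : rowShift LieType.D = 0 := rfl
      omega
    -- The value 1 corresponds to the dropped part 0, so adding it corrects the parity without
    -- changing the partition.
    refine ⟨insert 1 N₀, ?_, fun _ => ?_, fun k => ?_⟩
    · intro k hk
      rcases Finset.mem_insert.1 hk with rfl | hk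
      · omega
      · exact hpos k hk
    · rw [Finset.card_insert_of_notMem h1, Nat.even_add_one]
      exact hodd
    · rw [hpart k, Finset.mem_insert]
      have hs : rowShift LieType.D = 0 := rfl
      constructor
      · exact fun h => ⟨h.1, .inr h.2⟩
      · rintro ⟨h, h' | h'⟩
        · omega
        · exact ⟨h, h'⟩

/-- The partition determines N except for the element 1 in type D, and evenness of |N| decides about
that one. -/
theorem IsPartitionOfSet.unique_set {X : LieType} {l : StrictPartition} {N N' : Finset ℤ}
    (h : IsPartitionOfSet X l N) (h' : IsPartitionOfSet X l N') (hN : ∀ k ∈ N, 0 < k)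
    (hN' : ∀ k ∈ N', 0 < k) (hE : X = LieType.D → Even N.card)
    (hE' : X = LieType.D → Even N'.card) : N = N' := by
  have key : ∀ k : ℤ, 0 < k - 1 + rowShift X → (k ∈ N ↔ k ∈ N') := fun k hk => by
    have h1 := h (k - 1 + rowShift X).toNat
    have h2 := h' (k - 1 + rowShift X).toNat
    rw [show ((k - 1 + rowShift X).toNat : ℤ) + 1 - rowShift X = k by omega] at h1 h2
    have h3 : 0 < (k - 1 + rowShift X).toNat := by omega
    tauto
  by_cases hX : X = LieType.D
  · subst hX
    have hs : rowShift LieType.D = 0 := rfl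
    have h1 : (1 : ℤ) ∈ N ↔ (1 : ℤ) ∈ N' := by
      have e := (h.length_D hN).symm.trans (h'.length_D hN')
      have p := hE rfl
      have p' := hE' rfl
      by_cases a : (1 : ℤ) ∈ N <;> by_cases b : (1 : ℤ) ∈ N'
      · tauto
      · rw [Finset.erase_eq_of_notMem b] at e
        rw [← Finset.card_erase_add_one a, e, Nat.even_add_one] at p
        exact absurd p' p
      · rw [Finset.erase_eq_of_notMem a] at e
        rw [← Finset.card_erase_add_one b, ← e, Nat.even_add_one] at p'
        exact absurd p p'
      · tauto
    ext k
    by_cases hk : k = 1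
    · rw [hk, h1]
    · by_cases hk' : 0 < k
      · exact key k (by omega)
      · exact ⟨fun h => absurd (hN k h) hk', fun h => absurd (hN' k h) hk'⟩
  · rw [rowShift_of_ne hX] at key
    ext k
    by_cases hk' : 0 < k
    · exact key k (by push_cast; omega)
    · exact ⟨fun h => absurd (hN k h) hk', fun h => absurd (hN' k h) hk'⟩

theorem isPartitionOfSet_partitionOf {X : LieType} {w : Equiv.Perm ℤ} {N : Finset ℤ}
    (hw : ∀ k, w (-k) = -w k) (hN : IsNegSet w N) : IsPartitionOfSet X (partitionOf X w) N := by
  let p : StrictPartition → Prop := fun l => ∀ k : ℕ, k ∈ l.parts ↔ 0 < k ∧ ∃ m : ℤ, 0 < m ∧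
    w m = match X with
      | LieType.D => -((k : ℤ) + 1)
      | _ => -(k : ℤ)
  have key : ∀ l : StrictPartition, p l ↔ IsPartitionOfSet X l N := by
    intro l
    refine forall_congr' fun k => ?_
    have h1 : ∀ a : ℤ, 0 < a → ((∃ m : ℤ, 0 < m ∧ w m = -a) ↔ a ∈ N) := fun a ha => by
      rw [hN a]
      have h2 := inv_neg_apply hw a
      constructor
      · rintro ⟨m, hm, h⟩
        rw [← h] at h2
        simp only [Equiv.Perm.coe_inv, Equiv.symm_apply_apply] at h2 ⊢
        omega
      · rintro ⟨-, h⟩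
        exact ⟨w⁻¹ (-a), by omega, by simp⟩
    refine iff_congr Iff.rfl (and_congr_right fun hk => ?_)
    cases X
    · rw [show (k : ℤ) + 1 - rowShift LieType.B = k by simp [rowShift]]
      exact h1 k (by omega)
    · rw [show (k : ℤ) + 1 - rowShift LieType.C = k by simp [rowShift]]
      exact h1 k (by omega)
    · rw [show (k : ℤ) + 1 - rowShift LieType.D = k + 1 by simp [rowShift]]
      exact h1 (k + 1) (by omega)
  obtain ⟨l, hl⟩ := exists_isPartitionOfSet X N
  exact (key _).1 (Classical.epsilon_spec (p := p) ⟨l, (key l).2 hl⟩)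

theorem IsPartitionOfSet.unique {X : LieType} {l m : StrictPartition} {N : Finset ℤ}
    (hl : IsPartitionOfSet X l N) (hm : IsPartitionOfSet X m N) : l = m :=
  StrictPartition.eq_of_mem_iff fun k => (hl k).trans (hm k).symm

theorem partitionOf_eq {X : LieType} {w : Equiv.Perm ℤ} {N : Finset ℤ} {l : StrictPartition}
    (hw : ∀ k, w (-k) = -w k) (hN : IsNegSet w N) (hl : IsPartitionOfSet X l N) :
    partitionOf X w = l :=
  (isPartitionOfSet_partitionOf hw hN).unique hl

/-- A word built from N shows that a suitable Grassmannian element exists; whichever one is chosen,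
its set is even in type D and has partition l, hence equals N. -/
theorem grassmannianOf_spec {X : LieType} {l : StrictPartition} {N : Finset ℤ}
    (hN : ∀ k ∈ N, 0 < k) (hE : X = LieType.D → Even N.card) (hl : IsPartitionOfSet X l N) :
    (∀ k, grassmannianOf X l (-k) = -grassmannianOf X l k) ∧ IsNegSet (grassmannianOf X l) N ∧
      StrictMonoOn (grassmannianOf X l) (Set.Ioi 0) := by
  obtain ⟨n, hn⟩ := Int.eq_ofNat_of_zero_le (negWeight_nonneg (X := X) hN)
  obtain ⟨L, -, hLN, hLm⟩ := exists_word_of_negWeight X n N hN hE hn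
  have hspec : IsGrassmannian X (grassmannianOf X l) ∧ partitionOf X (grassmannianOf X l) = l :=
    Classical.epsilon_spec (p := fun w => IsGrassmannian X w ∧ partitionOf X w = l)
      ⟨_, ⟨word_mem_weylGroup X L, hLm⟩, partitionOf_eq (exists_isNegSet_word X L).1 hLN hl⟩
  obtain ⟨L', hL'⟩ := exists_word_of_mem_weylGroup hspec.1.1
  obtain ⟨hw, N', hN', hE', -⟩ := exists_isNegSet_word X L'
  rw [hL'] at hw hN'
  have h1 := isPartitionOfSet_partitionOf (X := X) hw hN'
  rw [hspec.2] at h1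
  rw [hl.unique_set h1 hN hN'.pos hE hE']
  exact ⟨hw, hN', hspec.1.2⟩

end Partitions

/-! ### The order relation s_iλ < λ. -/

section BruhatOrder

/-- In type D the number of parts is |N \ {1}| and |N| is even, so 1 belongs to N exactly when the
length is odd; this turns the parity conditions into membership of 1. The other cases only shift
indices. -/
theorem isLowerable_iff {X : LieType} {i : ℕ} {l : StrictPartition} {N : Finset ℤ}
    (hN : ∀ k ∈ N, 0 < k) (hE : X = LieType.D → Even N.card) (hl : IsPartitionOfSet X l N) :
    IsLowerable X i l ↔ ∃ N', IsDrop X i N N' := by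
  have hBC : ∀ {X : LieType}, X ≠ LieType.D → IsPartitionOfSet X l N →
      ∀ k : ℕ, 0 < k → (k ∈ l.parts ↔ (k : ℤ) ∈ N) := fun {X} hX hl k hk => by
    rw [hl k, rowShift_of_ne hX, show (k : ℤ) + 1 - (1 : ℕ) = k by push_cast; ring]
    exact and_iff_right hk
  have hD : IsPartitionOfSet LieType.D l N →
      ∀ k : ℕ, 0 < k → (k ∈ l.parts ↔ (k : ℤ) + 1 ∈ N) := fun hl k hk => by
    rw [hl k, show (k : ℤ) + 1 - rowShift LieType.D = k + 1 by simp [rowShift]]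
    exact and_iff_right hk
  have hpar : IsPartitionOfSet LieType.D l N → Even N.card → (Odd l.length ↔ (1 : ℤ) ∈ N) :=
    fun hl hE => by
      rw [hl.length_D hN]
      by_cases h : (1 : ℤ) ∈ N
      · rw [← Finset.card_erase_add_one h, Nat.even_add_one, Nat.not_even_iff_odd] at hE
        exact iff_of_true hE h
      · rw [Finset.erase_eq_of_notMem h]
        exact iff_of_false (Nat.not_odd_iff_even.2 hE) h
  match X, i with
  | LieType.D, 0 =>
    rw [IsLowerable, hpar hl (hE rfl), hD hl 1 one_pos]
    exact ⟨fun h => ⟨_, h.2, h.1, rfl⟩, fun ⟨_, h, h', _⟩ => ⟨h', h⟩⟩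
  | LieType.D, 1 =>
    rw [IsLowerable, ← Nat.not_odd_iff_even, hpar hl (hE rfl), hD hl 1 one_pos]
    exact ⟨fun h => ⟨_, h.1, h.2, rfl⟩, fun ⟨_, h, h', _⟩ => ⟨h, h'⟩⟩
  | LieType.D, i + 2 =>
    rw [IsLowerable, hD hl _ (by omega), hD hl _ (by omega),
      show ((i + 2 : ℕ) : ℤ) + 1 = ((i + 1 : ℕ) : ℤ) + 2 by push_cast; ring]
    exact ⟨fun h => ⟨_, isDrop_succ.2 ⟨h.1, h.2, rfl⟩⟩, fun ⟨_, h⟩ =>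
      ⟨(isDrop_succ.1 h).1, (isDrop_succ.1 h).2.1⟩⟩
  | LieType.B, 0 =>
    rw [IsLowerable, hBC (by simp) hl 1 one_pos]
    · exact ⟨fun h => ⟨_, h, rfl⟩, fun ⟨_, h⟩ => h.1⟩
    · simp
  | LieType.C, 0 =>
    rw [IsLowerable, hBC (by simp) hl 1 one_pos]
    · exact ⟨fun h => ⟨_, h, rfl⟩, fun ⟨_, h⟩ => h.1⟩
    · simp
  | LieType.B, i + 1 =>
    rw [IsLowerable, hBC (by simp) hl _ (by omega), hBC (by simp) hl _ (by omega)]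
    · push_cast
      exact ⟨fun h => ⟨_, isDrop_succ.2 ⟨h.1, h.2, rfl⟩⟩, fun ⟨_, h⟩ =>
        ⟨(isDrop_succ.1 h).1, (isDrop_succ.1 h).2.1⟩⟩
    all_goals simp
  | LieType.C, i + 1 =>
    rw [IsLowerable, hBC (by simp) hl _ (by omega), hBC (by simp) hl _ (by omega)]
    · push_cast
      exact ⟨fun h => ⟨_, isDrop_succ.2 ⟨h.1, h.2, rfl⟩⟩, fun ⟨_, h⟩ =>
        ⟨(isDrop_succ.1 h).1, (isDrop_succ.1 h).2.1⟩⟩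
    all_goals simp

theorem bruhatLE.weylLength_le {X : LieType} {u v : Equiv.Perm ℤ} (h : bruhatLE X u v) :
    weylLength X u ≤ weylLength X v := by
  induction h with
  | refl => exact le_rfl
  | tail _ h ih => exact ih.trans h.1.le

theorem weylLength_grassmannianOf {X : LieType} {l : StrictPartition} {N : Finset ℤ}
    (hN : ∀ k ∈ N, 0 < k) (hE : X = LieType.D → Even N.card) (hl : IsPartitionOfSet X l N) :
    (weylLength X (grassmannianOf X l) : ℤ) = negWeight X N := by
  obtain ⟨h1, h2, h3⟩ := grassmannianOf_spec hN hE hl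
  exact weylLength_eq h1 h2 hE h3

/-- If N is lowered, s_i w is Grassmannian and one shorter, and a single reflection leads back up to
w. If N is raised, the length grows, which the Bruhat order forbids. Otherwise s_i fixes the
partition. -/
theorem partitionLT_iff_isLowerable (X : LieType) (i : ℕ) (l : StrictPartition) :
    partitionLT X (reflPartition X i l) l ↔ IsLowerable X i l := by
  obtain ⟨N, hN, hE, hl⟩ := exists_set_isPartitionOfSet X l
  obtain ⟨hw, hneg, hmono⟩ := grassmannianOf_spec hN hE hl
  have hlen := weylLength_grassmannianOf hN hE hl
  have hsw := mul_simpleRefl_neg X i hw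
  rw [isLowerable_iff hN hE hl]
  by_cases h : ∃ N', IsDrop X i N N'
  · refine iff_of_true ?_ h
    obtain ⟨N', h⟩ := h
    obtain ⟨m, hm⟩ := exists_isPartitionOfSet X N'
    have hE' : X = LieType.D → Even N'.card := by
      rintro rfl
      exact h.even_card_iff.1 (hE rfl)
    obtain ⟨hw', hneg', hmono'⟩ := grassmannianOf_spec (h.pos hN) hE' hm
    have hlen' := weylLength_grassmannianOf (h.pos hN) hE' hm
    have hwt := h.negWeight_eq
    have heq : grassmannianOf X m = simpleRefl X i * grassmannianOf X l :=
      eq_of_isNegSet hw' hsw hneg' (h.isNegSet hw hneg) hmono'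
        (strictMonoOn_simpleRefl_mul (.inl h) hw hneg hmono)
    rw [reflPartition, partitionOf_eq hsw (h.isNegSet hw hneg) hm]
    refine ⟨Relation.ReflTransGen.single ⟨by omega, simpleRefl X i,
      ⟨1, one_mem _, i, by simp⟩, ?_⟩, ?_⟩
    · rw [heq, ← mul_assoc, simpleRefl_mul_self, one_mul]
    · rintro rfl
      omega
  · refine iff_of_false ?_ h
    rintro ⟨hle, hne⟩
    have hle' := hle.weylLength_le
    by_cases h' : ∃ N', (∀ k ∈ N', 0 < k) ∧ IsDrop X i N' N
    · obtain ⟨N', hpos, h'⟩ := h'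
      obtain ⟨m, hm⟩ := exists_isPartitionOfSet X N'
      have hE' : X = LieType.D → Even N'.card := by
        rintro rfl
        exact h'.even_card_iff.2 (hE rfl)
      rw [reflPartition, partitionOf_eq hsw (h'.isNegSet_symm hw hneg hpos) hm] at hle'
      have hlen' := weylLength_grassmannianOf hpos hE' hm
      have hwt := h'.negWeight_eq
      omega
    · exact hne (partitionOf_eq hsw (isNegSet_of_not_isDrop h h' hw hneg) hl)

end BruhatOrder

/-! ### Removable boxes. -/

section Diagrams

theorem StrictPartition.part_pos_iff (l : StrictPartition) (a : ℕ) :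
    0 < l.part a ↔ a < l.length := by
  rw [StrictPartition.part, StrictPartition.length]
  constructor
  · intro h
    by_contra h'
    rw [List.getD_eq_default _ _ (by omega)] at h
    omega
  · intro h
    rw [List.getD_eq_getElem _ _ h]
    exact l.pos _ (List.getElem_mem h)

theorem StrictPartition.part_lt_part (l : StrictPartition) {a b : ℕ} (hab : a < b)
    (ha : a < l.length) : l.part b < l.part a := by
  by_cases hb : b < l.length
  · rw [StrictPartition.part, StrictPartition.part, List.getD_eq_getElem _ _ ha,
      List.getD_eq_getElem _ _ hb]
    exact List.pairwise_iff_getElem.1 l.decreasing a b ha hb hab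
  · have h1 := (l.part_pos_iff a).2 ha
    have h2 := mt (l.part_pos_iff b).1 hb
    omega

theorem StrictPartition.mem_parts_iff (l : StrictPartition) {k : ℕ} :
    k ∈ l.parts ↔ 0 < k ∧ ∃ a, l.part a = k := by
  constructor
  · intro h
    obtain ⟨a, ha, rfl⟩ := List.getElem_of_mem h
    exact ⟨l.pos _ h, a, List.getD_eq_getElem _ _ ha⟩
  · rintro ⟨hk, a, rfl⟩
    have ha := (l.part_pos_iff a).1 hk
    rw [StrictPartition.part, List.getD_eq_getElem _ _ ha]
    exact List.getElem_mem ha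

theorem StrictPartition.part_injective (l : StrictPartition) {a b : ℕ} (h : l.part a = l.part b)
    (ha : 0 < l.part a) : a = b := by
  have ha' := (l.part_pos_iff a).1 ha
  have hb' := (l.part_pos_iff b).1 (h ▸ ha)
  rcases lt_trichotomy a b with hab | hab | hab
  · have := l.part_lt_part hab ha'
    omega
  · exact hab
  · have := l.part_lt_part hab hb'
    omega

/-- Boxes are written with a zero-based row a and offset d from the diagonal, so that membership is
one inequality and d is the content in types B and C. -/
theorem StrictPartition.mem_diagram_iff (l : StrictPartition) (a d : ℕ) :
    (a + 1, a + 1 + d) ∈ l.diagram ↔ d < l.part a := by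
  have := l.part_pos_iff a
  rw [StrictPartition.diagram, Set.mem_ofPred_eq]
  dsimp only
  rw [Nat.add_sub_cancel]
  omega

theorem StrictPartition.exists_of_mem_diagram {l : StrictPartition} {p : ℕ × ℕ}
    (h : p ∈ l.diagram) : ∃ a d, p = (a + 1, a + 1 + d) := by
  obtain ⟨h1, -, h3, -⟩ := h
  exact ⟨p.1 - 1, p.2 - p.1, Prod.ext (by dsimp only; omega) (by dsimp only; omega)⟩

/-- Removing the box at the end of the row `a` lowers the part `a` by one. -/
theorem diagram_eq_diff_iff {l m : StrictPartition} {a d : ℕ} (ha : d < l.part a) :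
    m.diagram = l.diagram \ {(a + 1, a + 1 + d)} ↔
      l.part a = d + 1 ∧ m.part a = d ∧ ∀ b, b ≠ a → m.part b = l.part b := by
  have hbox : m.diagram = l.diagram \ {(a + 1, a + 1 + d)} ↔
      ∀ b e, e < m.part b ↔ e < l.part b ∧ ¬ (b = a ∧ e = d) := by
    constructor
    · intro h b e
      rw [← m.mem_diagram_iff, h, Set.mem_sdiff, l.mem_diagram_iff, Set.mem_singleton_iff,
        Prod.mk.injEq]
      refine and_congr_right fun _ => not_congr ?_
      omega
    · intro h
      ext p
      constructor
      · intro hp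
        obtain ⟨b, e, rfl⟩ := StrictPartition.exists_of_mem_diagram hp
        rw [m.mem_diagram_iff, h] at hp
        rw [Set.mem_sdiff, l.mem_diagram_iff, Set.mem_singleton_iff, Prod.mk.injEq]
        exact ⟨hp.1, fun h' => hp.2 (by omega)⟩
      · rintro ⟨hp, hp'⟩
        obtain ⟨b, e, rfl⟩ := StrictPartition.exists_of_mem_diagram hp
        rw [l.mem_diagram_iff] at hp
        rw [m.mem_diagram_iff, h]
        refine ⟨hp, ?_⟩
        rintro ⟨rfl, rfl⟩
        exact hp' rfl
  rw [hbox]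
  constructor
  · intro h
    -- Testing the offsets d, d + 1 and d - 1 in row a forces its length down from d + 1 to d. For d
    -- = 0 the last test repeats the first.
    have h1 := h a d
    have h2 := h a (d + 1)
    have h3 := h a (d - 1)
    refine ⟨by omega, by omega, fun b hb => ?_⟩
    have h4 := h b (m.part b)
    have h5 := h b (l.part b)
    omega
  · rintro ⟨h1, h2, h3⟩ b e
    by_cases hb : b = a
    · subst hb
      omega
    · rw [h3 b hb]
      omega

theorem IsLowering.part_eq {l m : StrictPartition} {k : ℕ} (h : IsLowering k l m) :
    ∃ a, l.part a = k ∧ m.part a = k - 1 ∧ (∀ b, b ≠ a → m.part b = l.part b) ∧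
      (k = 1 → l.length = a + 1) := by
  obtain ⟨pre, post, hl, hm⟩ := h
  refine ⟨pre.length, ?_, ?_, fun b hb => ?_, ?_⟩
  · rw [StrictPartition.part, hl, List.getD_append_right _ _ _ _ le_rfl]
    simp
  · by_cases hk : k = 1
    · subst hk
      obtain rfl := StrictPartition.post_eq_nil hl
      rw [StrictPartition.part, hm, List.getD_append_right _ _ _ _ le_rfl]
      simp
    · rw [StrictPartition.part, hm, if_neg hk, List.getD_append_right _ _ _ _ le_rfl]
      simp
  · rw [StrictPartition.part, StrictPartition.part, hl, hm]
    rcases lt_or_gt_of_ne hb with hb | hb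
    · rw [List.getD_append _ _ _ _ hb, List.getD_append _ _ _ _ hb]
    · rw [List.getD_append_right _ _ _ _ hb.le, List.getD_append_right _ _ _ _ hb.le]
      obtain ⟨c, hc⟩ : ∃ c, b - pre.length = c + 1 := ⟨b - pre.length - 1, by omega⟩
      by_cases hk : k = 1
      · subst hk
        obtain rfl := StrictPartition.post_eq_nil hl
        rw [hc]
        simp
      · rw [if_neg hk, hc, List.getD_cons_succ, List.getD_cons_succ]
  · rintro rfl
    obtain rfl := StrictPartition.post_eq_nil hl
    rw [StrictPartition.length, hl]
    simp

theorem content_B (a d : ℕ) : content LieType.B (a + 1, a + 1 + d) = d := by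
  simp [content]

theorem content_C (a d : ℕ) : content LieType.C (a + 1, a + 1 + d) = d := by
  simp [content]

theorem content_D_succ (a d : ℕ) : content LieType.D (a + 1, a + 1 + (d + 1)) = d + 2 := by
  rw [content, if_neg (by simp)]
  dsimp only
  omega

theorem content_D_zero (a : ℕ) :
    content LieType.D (a + 1, a + 1 + 0) = if Odd (a + 1) then 0 else 1 := by
  rw [content, if_pos (by simp)]

theorem IsLowerable.isRemoved {X : LieType} {i : ℕ} {l m : StrictPartition}
    (h : IsLowerable X i l) (hm : IsLowering (rootPart X i) l m) : IsRemoved X i l m := by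
  obtain ⟨a, h1, h2, h3, h4⟩ := hm.part_eq
  have hpos := l.pos _ h.mem
  refine ⟨(a + 1, a + 1 + (rootPart X i - 1)), (l.mem_diagram_iff _ _).2 (by omega), ?_,
    (diagram_eq_diff_iff (by omega)).2 ⟨by omega, h2, h3⟩⟩
  match X, i with
  | LieType.B, 0 => exact content_B _ _
  | LieType.B, i + 1 => exact content_B _ _
  | LieType.C, 0 => exact content_C _ _
  | LieType.C, i + 1 => exact content_C _ _
  | LieType.D, 0 =>
    have h5 := h.2
    rw [h4 rfl] at h5
    exact (content_D_zero a).trans (if_pos h5)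
  | LieType.D, 1 =>
    have h5 := h.2
    rw [h4 rfl, ← Nat.not_odd_iff_even] at h5
    exact (content_D_zero a).trans (if_neg h5)
  | LieType.D, i + 2 => exact content_D_succ a i

theorem IsRemoved.isLowerable {X : LieType} {i : ℕ} {l m : StrictPartition}
    (h : IsRemoved X i l m) : IsLowerable X i l := by
  obtain ⟨p, hp, hc, hd⟩ := h
  obtain ⟨a, d, rfl⟩ := StrictPartition.exists_of_mem_diagram hp
  rw [l.mem_diagram_iff] at hp
  obtain ⟨h1, h2, h3⟩ := (diagram_eq_diff_iff hp).1 hd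
  have hmem : d + 1 ∈ l.parts := l.mem_parts_iff.2 ⟨by omega, a, h1⟩
  -- A part d in another row of l survives in m, which already has d in row a; strictness of m
  -- forbids this.
  have hnot : d ∉ l.parts := fun h => by
    obtain ⟨hd0, b, hb⟩ := l.mem_parts_iff.1 h
    have hba : b ≠ a := by
      rintro rfl
      omega
    exact hba (m.part_injective ((h3 b hba).trans (hb.trans h2.symm)) (by rw [h3 b hba]; omega))
  -- A row consisting of one box is the last, so in type D the parity of its index, which decides
  -- the content, is the parity of the length.
  have hlen : d = 0 → l.length = a + 1 := by
    rintro rfl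
    have h4 := (l.part_pos_iff a).1 (by omega)
    by_contra h5
    have h6 := l.part_lt_part (Nat.lt_succ_self a) h4
    have h7 := (l.part_pos_iff (a + 1)).2 (by omega)
    rw [Nat.succ_eq_add_one] at h6
    omega
  cases X
  · rw [content_B] at hc
    subst hc
    cases d with
    | zero => exact hmem
    | succ d => exact ⟨hmem, hnot⟩
  · rw [content_C] at hc
    subst hc
    cases d with
    | zero => exact hmem
    | succ d => exact ⟨hmem, hnot⟩
  · cases d with
    | zero =>
      rw [content_D_zero, ← hlen rfl] at hc
      split_ifs at hc with h5
      · subst hc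
        exact ⟨hmem, h5⟩
      · subst hc
        exact ⟨hmem, Nat.not_odd_iff_even.1 h5⟩
    | succ d =>
      rw [content_D_succ] at hc
      subst hc
      exact ⟨hmem, hnot⟩

end Diagrams

theorem mainTheorem8 (X : LieType) :
    (∀ (i : ℕ) (F : Family), F ∈ GGammaRHat X →
      dividedDiff X i F ∈ GGammaRHat X ∧ IsDividedDifference X i F (dividedDiff X i F)) ∧
    (∀ l : StrictPartition, IsGXLimit X l (GX X l) ∧ GX X l ∈ GGammaRHat X) ∧
    (∀ (i : ℕ) (l : StrictPartition),
      (partitionLT X (reflPartition X i l) l →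
        ∃ m : StrictPartition, IsRemoved X i l m ∧ dividedDiff X i (GX X l) = GX X m) ∧
      (¬ partitionLT X (reflPartition X i l) l →
        (¬ ∃ m : StrictPartition, IsRemoved X i l m) ∧
          dividedDiff X i (GX X l) = -(betaIn CoeffRing • GX X l))) := by
  refine ⟨fun i F hF => dividedDiff_spec hF i,
    fun l => ⟨isGXLimit_GX X l, GX_mem_GGammaRHat X l⟩, fun i l => ?_⟩
  rw [partitionLT_iff_isLowerable]
  refine ⟨fun h => ?_, fun h => ⟨?_, dividedDiff_GX_of_not_isLowerable h⟩⟩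
  · obtain ⟨m, hm⟩ := exists_isLowering h.mem h.eq_one_or
    exact ⟨m, h.isRemoved hm, dividedDiff_GX_of_isLowerable h hm⟩
  · rintro ⟨m, hm⟩
    exact h hm.isLowerable
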